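/- **Notation.** $\mathfrak S_n$ is the symmetric group, $\mathbb C[\mathfrak S_n]$ its group algebra, and $\mathcal P_K=|K|^{-1}\sum_{k\in K}k$ for a subgroup $K$. $X_i=\sum_{a<i}(a\ i)$ are the Jucys–Murphy elements ($X_1=0$). $\mathcal M(2p)$ is the set of pair partitions of $\{1,\dots,2p\}$, $\pi_0=\{\{1,2\},\dots,\{2p-1,2p\}\}$, and $\mathcal H_{2p}\subset\mathfrak S_{2p}$ is the stabilizer of $\pi_0$ (the hyperoctahedral group). $\mathfrak S_p\times\mathfrak S_p\subset\mathfrak S_{2p}$ acts on $\{1,\dots,p\}$ and $\{p+1,\dots,2p\}$, $D(\mathfrak S_p)=\{\sigma\times\sigma:\sigma\in\mathfrak S_p\}$, and $\mathbb C[\mathfrak S_p]$ is embedded in $\mathbb C[\mathfrak S_{2p}]$ by $\sigma\mapsto\sigma\times\mathrm{Id}$. Put $$\mathbf G(z)=\sum_{\pi\in\mathcal M(2p)}z^{\#(\pi\vee\pi_0)}\sigma_\pi\in\mathbb C[\mathfrak S_{2p}],\qquad \Omega(z)=\sum_{\sigma\in\mathfrak S_p}z^{\#\sigma}\sigma\in\mathbb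 C[\mathfrak S_p],$$ where $(\sigma_\pi)$ is any family of permutations with $\sigma_\pi(\pi_0)=\pi$, $\#(\pi\vee\pi_0)$ is the number of blocks of the join and $\#\sigma$ is the number of cycles of $\sigma$. For $z\in\mathbb C$ put $$Z_i(z)=\frac{(1-z^{-1})\,i}{2}+z^{-1}\sum_{1\le a<b\le i}(a\ b),\qquad Y_i(z)=i+z^{-1}\sum_{\substack{1\le a<b\le i\ \text{or}\\ p<a<b\le p+i}}(a\ b)$$ in $\mathbb C[\mathfrak S_{2p}]$ (with the convention $0^{-1}=0$). An element $y$ is a pseudo-inverse of $x$ if $xyx=x$ and $yxy=y$. For $\lambda\vdash n$, $\mathcal P_\lambda\in\mathbb C[\mathfrak S_n]$ is the projection on the isotypic component $\lambda$, and $2\lambda=(2\lambda_1,2\lambda_2,\dots)$. For $\lambda\vdash p$, the cells of $\lambda$ being indexed by (row, column) $=(i,j)$ with $i,j\ge1$, put $$R_\lambda(z)=\prod_{(i,j)\in\lambda}(z+j-i),\qquad R_{2,\lambda}(z)=\prod_{(i,j)\in\lambda}\bigl(z+2(j-1)-(i-1)\bigr),$$ $$\mathbf W(z)=\sum_{\lambda\vdash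 p}R_{2,\lambda}(z)^{-1}\mathcal P_{2\lambda}\in\mathbb C[\mathfrak S_{2p}],\qquad \mathbf{Wg}(z)=\sum_{\lambda\vdash p}R_\lambda(z)^{-1}\mathcal P_\lambda\in\mathbb C[\mathfrak S_p],$$ where for a given $z$ the terms with $R_{2,\lambda}(z)=0$, resp. $R_\lambda(z)=0$, are omitted. $\rho_O$ is the representation of $\mathbb C[\mathfrak S_{2p}]$ on $(\mathbb C^N)^{\otimes 2p}$ by permutation of the tensor factors, and $\rho_S$ is the one on $(\mathbb C^{2N})^{\otimes 2p}$ by $\varepsilon(\sigma)$ times the permutation of the tensor factors. **Lemma.** i) For every integer $i\ge1$, in $\mathbb C[\mathfrak S_{2i}]$, $$(X_1+\cdots+X_{2i})\mathcal P_{\mathcal H_{2i}}=\mathcal P_{\mathcal H_{2i}}\,i(1+X_{2i-1})\,\mathcal P_{\mathcal H_{2i}},\qquad \sum_{\substack{1\le a<b\le i\ \text{or}\\ i<a<b\le 2i}}(a\ b)\,\mathcal P_{D(\mathfrak S_i)}=\mathcal P_{D(\mathfrak S_i)}\,iX_i\,\mathcal P_{D(\mathfrak S_i)}.$$ ii) Let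 $p\ge0$ and $z\in\mathbb C$. If $\mathbf G(z)$ and $Z_2(z),Z_4(z),\dots,Z_{2p}(z)$ are invertible, then $$z^p\,\mathbf G(z)^{-1}\mathcal P_{\mathcal H_{2p}}=p!\,\mathcal P_{\mathcal H_{2p}}Z_2(z)^{-1}Z_4(z)^{-1}\cdots Z_{2p}(z)^{-1}\mathcal P_{\mathcal H_{2p}}.$$ If $\Omega(z)$ and $Y_1(z),\dots,Y_p(z)$ are invertible, then $$z^p\,\Omega(z)^{-1}\mathcal P_{D(\mathfrak S_p)}=p!\,\mathcal P_{D(\mathfrak S_p)}Y_1(z)^{-1}Y_2(z)^{-1}\cdots Y_p(z)^{-1}\mathcal P_{D(\mathfrak S_p)}.$$ iii) For all $p\ge0$ and $z\in\mathbb C$, $\mathbf W(z)\mathcal P_{\mathcal H_{2p}}$ is a pseudo-inverse of $\mathbf G(z)\mathcal P_{\mathcal H_{2p}}$ and $\mathbf{Wg}(z)$ is a pseudo-inverse of $\Omega(z)$. Let $N\ge1$. The rational functions $\rho_S(\mathbf W(z))$, $\rho_O(\mathbf{Wg}(z))$ and $\rho_O(\mathbf W(z))$ have no pole at $z=-2N$,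 $z=N$ and $z=N$ respectively: $\rho_S(\mathcal P_{2\lambda})=0$ if $R_{2,\lambda}(-2N)=0$, $\rho_O(\mathcal P_\lambda)=0$ if $R_\lambda(N)=0$, and $\rho_O(\mathcal P_{2\lambda})=0$ if $R_{2,\lambda}(N)=0$. Moreover $$p!\,(-2N)^{-p}\rho_S\bigl(\mathcal P_{\mathcal H_{2p}}Z_2^{-1}(-2N)Z_4^{-1}(-2N)\cdots Z_{2p}^{-1}(-2N)\mathcal P_{\mathcal H_{2p}}\bigr)=\rho_S\bigl(\mathbf W(-2N)\mathcal P_{\mathcal H_{2p}}\bigr),$$ $$p!\,N^{-p}\rho_O\bigl(\mathcal P_{D(\mathfrak S_p)}Y_1^{-1}(N)Y_2^{-1}(N)\cdots Y_p^{-1}(N)\mathcal P_{D(\mathfrak S_p)}\bigr)=\rho_O\bigl(\mathbf{Wg}(N)\mathcal P_{D(\mathfrak S_p)}\bigr),$$ $$p!\,N^{-p}\rho_O\bigl(\mathcal P_{\mathcal H_{2p}}Z_2^{-1}(N)Z_4^{-1}(N)\cdots Z_{2p}^{-1}(N)\mathcal P_{\mathcal H_{2p}}\bigr)=\rho_O\bigl(\mathbf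 W(N)\mathcal P_{\mathcal H_{2p}}\bigr).$$ In these three identities $x^{-1}$ denotes, for the diagonalizable elements $x=Z_{2k}$ and $x=Y_k$ (which need not be invertible), the pseudo-inverse of $x$ in $\mathbb C[\mathfrak S_{2p}]$ that commutes with $x$, i.e. the one diagonal in the same bases as $x$. -/

import Mathlib

open scoped BigOperators TensorProduct

noncomputable section

namespace JMBrauer

/-! ### The group algebra of the symmetric group -/

/-- The group algebra `ℂ[𝔖ₙ]`. Points `1, …, n` are represented by `0, …, n - 1`. -/
abbrev GA (n : ℕ) : Type := MonoidAlgebra ℂ (Equiv.Perm (Fin n))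

/-- A permutation as an element of the group algebra. -/
def perm {n : ℕ} (σ : Equiv.Perm (Fin n)) : GA n := MonoidAlgebra.of ℂ _ σ

/-- The averaging idempotent `|K|⁻¹ ∑_{k ∈ K} k` of a subgroup `K`. -/
def avg {n : ℕ} (K : Subgroup (Equiv.Perm (Fin n))) : GA n :=
  by classical exact (Nat.card K : ℂ)⁻¹ • ∑ σ : Equiv.Perm (Fin n) with σ ∈ K, perm σ

/-- The sum of the transpositions `(a b)`, `a < b`, with both points in `C`. -/
def transpositionSum {n : ℕ} (C : Finset (Fin n)) : GA n :=
  ∑ b ∈ C, ∑ a ∈ C with a < b, perm (Equiv.swap a b)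

/-- The Jucys-Murphy element `X_i = (1 i) + ⋯ + (i-1 i)`, for `1 ≤ i ≤ n` (indexed from `1`). -/
def jucysMurphy (n i : ℕ) : GA n :=
  ∑ b : Fin n with b.val + 1 = i, ∑ a : Fin n with a < b, perm (Equiv.swap a b)

/-! ### Pair partitions and the hyperoctahedral group -/

/-- Pair partitions of `{1, …, 2p}`, as equivalence relations all of whose classes have two
elements. -/
def PairPartition (p : ℕ) : Type :=
  {r : Setoid (Fin (2 * p)) // ∀ a, {b | r a b}.ncard = 2}

instance (p : ℕ) : Finite (PairPartition p) :=
  Finite.of_injective (fun (π : PairPartition p) a b => π.1 a b) fun _ _ h =>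
    Subtype.ext (Setoid.ext fun a b => iff_of_eq (congrFun (congrFun h a) b))

instance (p : ℕ) : Fintype (PairPartition p) := Fintype.ofFinite _

/-- The partition `π₀ = {{1,2}, {3,4}, …, {2p-1,2p}}`. -/
def basePairing (p : ℕ) : PairPartition p :=
  ⟨Setoid.ker fun k : Fin (2 * p) => k.val / 2, fun a => by
    have h : {b : Fin (2 * p) | Setoid.ker (fun k : Fin (2 * p) => k.val / 2) a b} =
        {⟨2 * (a.val / 2), by omega⟩, ⟨2 * (a.val / 2) + 1, by omega⟩} := by
      ext b
      simp only [Set.mem_ofPred_eq, Setoid.ker_def, Set.mem_insert_iff, Set.mem_singleton_iff,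
        Fin.ext_iff]
      omega
    rw [h]
    exact Set.ncard_pair (by simp [Fin.ext_iff])⟩

/-- The natural action on pair partitions: `i` and `j` are in the same block of `σ • π` if and
only if `σ⁻¹ i` and `σ⁻¹ j` are in the same block of `π`. -/
instance (p : ℕ) : MulAction (Equiv.Perm (Fin (2 * p))) (PairPartition p) where
  smul σ π := ⟨π.1.comap σ.symm, fun a => by
    have h : {b | (π.1.comap σ.symm) a b} = σ '' {b | π.1 (σ.symm a) b} := by
      ext b
      simp [Setoid.comap_rel, Equiv.image_eq_preimage_symm]
    rw [h, Set.ncard_image_of_injective _ σ.injective]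
    exact π.2 _⟩
  one_smul π := Subtype.ext (Setoid.ext fun _ _ => Iff.rfl)
  mul_smul σ τ π := Subtype.ext (Setoid.ext fun _ _ => Iff.rfl)

/-- The hyperoctahedral group: the stabilizer of `π₀` in `𝔖₂ₚ`. -/
def hyperoctahedral (p : ℕ) : Subgroup (Equiv.Perm (Fin (2 * p))) :=
  MulAction.stabilizer _ (basePairing p)

/-- `#(π ∨ η)`, the number of blocks of the finest partition coarser than `π` and `η`. -/
def blocksJoin {p : ℕ} (π η : PairPartition p) : ℕ := Nat.card (Quotient (π.1 ⊔ η.1))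

/-- A choice of permutations `σ_π` with `σ_π(π₀) = π`. -/
def IsSection {p : ℕ} (s : PairPartition p → Equiv.Perm (Fin (2 * p))) : Prop :=
  ∀ π, s π • basePairing p = π

/-- `𝐆(z) = ∑_π z^{#(π ∨ π₀)} σ_π`. -/
def gramElement {p : ℕ} (s : PairPartition p → Equiv.Perm (Fin (2 * p))) (z : ℂ) :
    GA (2 * p) :=
  ∑ π, z ^ blocksJoin π (basePairing p) • perm (s π)

/-! ### The subgroup `𝔖ₚ × 𝔖ₚ` and its diagonal -/

/-- The embedding `𝔖ₚ × 𝔖ₚ → 𝔖₂ₚ`, the factors acting on `{1, …, p}` and `{p+1, …, 2p}`. -/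
def blockHom (p : ℕ) :
    Equiv.Perm (Fin p) × Equiv.Perm (Fin p) →* Equiv.Perm (Fin (2 * p)) :=
  (finSumFinEquiv.trans (finCongr (two_mul p).symm)).permCongrHom.toMonoidHom.comp
    (Equiv.Perm.sumCongrHom (Fin p) (Fin p))

/-- The diagonal subgroup `D(𝔖ₚ) = {σ × σ}` of `𝔖₂ₚ`. -/
def diagonal (p : ℕ) : Subgroup (Equiv.Perm (Fin (2 * p))) :=
  ((blockHom p).comp ((MonoidHom.id _).prod (MonoidHom.id _))).range

/-- The embedding `ℂ[𝔖ₚ] → ℂ[𝔖₂ₚ]`, `σ ↦ σ × id`. -/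
def inclFirst (p : ℕ) : GA p →ₐ[ℂ] GA (2 * p) :=
  MonoidAlgebra.mapDomainAlgHom ℂ ℂ ((blockHom p).comp (MonoidHom.inl _ _))

/-- `Ω(z) = ∑_σ z^{#σ} σ`, where `#σ` is the number of cycles of `σ` (fixed points included). -/
def omegaElement (p : ℕ) (z : ℂ) : GA p :=
  ∑ σ : Equiv.Perm (Fin p),
    z ^ Nat.card (Quotient (Equiv.Perm.SameCycle.setoid σ)) • perm σ

/-! ### The elements `Z_i` and `Y_i` -/

/-- `Z_C(z) = (1 - z⁻¹)|C|/2 + z⁻¹ ∑_{a < b in C} (a b)`. -/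
def zSet {n : ℕ} (C : Finset (Fin n)) (z : ℂ) : GA n :=
  ((1 - z⁻¹) * C.card / 2) • (1 : GA n) + z⁻¹ • transpositionSum C

/-- `Z_i = Z_{{1, …, i}}`. -/
def zElement (n i : ℕ) (z : ℂ) : GA n := zSet {k : Fin n | k.val < i} z

/-- The projection `ℂ[𝔖₂ₚ] → ℂ[𝔖ₚ × 𝔖ₚ]` killing all permutations that do not preserve
`{1, …, p}`: the restriction to `ℂ[𝔖₂ₚ]` of the projection onto the walled Brauer algebra. -/
def wallProj (p : ℕ) (x : GA (2 * p)) : GA (2 * p) := by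
  classical exact .ofCoeff (x.coeff.filter fun σ => ∀ k, (σ k).val < p ↔ k.val < p)

/-- `Y_C(z)`: the walled projection of `Z_C(z)`, plus `|C| z⁻¹ / 2`. -/
def ySet {p : ℕ} (C : Finset (Fin (2 * p))) (z : ℂ) : GA (2 * p) :=
  wallProj p (zSet C z) + (C.card * z⁻¹ / 2) • (1 : GA (2 * p))

/-- `Y_i = Y_{{1, …, i} ∪ {p+1, …, p+i}}`. -/
def yElement (p i : ℕ) (z : ℂ) : GA (2 * p) :=
  ySet {k : Fin (2 * p) | k.val < i ∨ (p ≤ k.val ∧ k.val < p + i)} z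

/-! ### Pseudo-inverses -/

/-- `y` is a pseudo-inverse of `x`. -/
def IsPseudoInverse {A : Type*} [Mul A] (x y : A) : Prop :=
  x * y * x = x ∧ y * x * y = y

/-- There is at most one pseudo-inverse of `x` commuting with `x`. -/
theorem commuting_pseudoInverse_unique {A : Type*} [Semigroup A] {x y y' : A}
    (h : IsPseudoInverse x y) (c : Commute x y) (h' : IsPseudoInverse x y')
    (c' : Commute x y') : y = y' := by
  obtain ⟨h1, h2⟩ := h
  obtain ⟨h1', h2'⟩ := h'
  have e : x * y = x * y' := by
    calc x * y = x * y' * x * y := by rw [h1']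
      _ = y' * x * (y * x) := by rw [mul_assoc (x * y'), c.eq, c'.eq]
      _ = y' * (x * y * x) := by simp only [mul_assoc]
      _ = x * y' := by rw [h1, c'.eq]
  calc y = y * x * y := h2.symm
    _ = x * y * y := by rw [c.eq]
    _ = x * y' * y := by rw [e]
    _ = y' * (x * y) := by rw [c'.eq, mul_assoc]
    _ = y' * x * y' := by rw [e, mul_assoc]
    _ = y' := h2'

open Classical in
/-- The pseudo-inverse of `x` commuting with `x` (if there is none, the value is `0`).
If `x` acts diagonally in some basis, it exists and is the pseudo-inverse that is diagonal in that
basis: its eigenvalues are `c⁻¹` where `x` has the eigenvalue `c ≠ 0`, and `0` where `x` has the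
eigenvalue `0`. It is the inverse of `x` if `x` is invertible. -/
def pinv {A : Type*} [Ring A] (x : A) : A :=
  if h : ∃ y, IsPseudoInverse x y ∧ Commute x y then h.choose else 0

/-! ### Partitions and isotypic projections -/

/-- Partitions of `n`, as Young diagrams with `n` cells. The cell `(i, j)` of the diagram (row `i`,
column `j`, both indexed from `0`) is the cell in row `i + 1` and column `j + 1`. -/
abbrev Shape (n : ℕ) : Type := {μ : YoungDiagram // μ.card = n}

instance (n : ℕ) : Finite (Shape n) := by
  have hb : ∀ μ : Shape n, ∀ c ∈ μ.1.cells, c.1 < n ∧ c.2 < n := by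
    rintro ⟨μ, hμ⟩ ⟨i, j⟩ hc
    constructor
    · have hs : (Finset.range (i + 1)).image (fun k => (k, j)) ⊆ μ.cells := by
        intro x hx
        obtain ⟨k, hk, rfl⟩ := Finset.mem_image.1 hx
        exact μ.up_left_mem (by simpa [Nat.lt_succ_iff] using hk) le_rfl hc
      have := Finset.card_le_card hs
      rw [Finset.card_image_of_injective _ (fun a b h => (Prod.ext_iff.1 h).1),
        Finset.card_range] at this
      change i < n
      exact lt_of_lt_of_le (Nat.lt_succ_self i) (this.trans_eq hμ)
    · have hs : (Finset.range (j + 1)).image (fun k => (i, k)) ⊆ μ.cells := by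
        intro x hx
        obtain ⟨k, hk, rfl⟩ := Finset.mem_image.1 hx
        exact μ.up_left_mem le_rfl (by simpa [Nat.lt_succ_iff] using hk) hc
      have := Finset.card_le_card hs
      rw [Finset.card_image_of_injective _ (fun a b h => (Prod.ext_iff.1 h).2),
        Finset.card_range] at this
      change j < n
      exact lt_of_lt_of_le (Nat.lt_succ_self j) (this.trans_eq hμ)
  refine Finite.of_injective
    (fun μ : Shape n => (⟨μ.1.cells, ?_⟩ :
      {s : Finset (ℕ × ℕ) // s ∈ (Finset.range n ×ˢ Finset.range n).powerset})) ?_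
  · rw [Finset.mem_powerset]
    intro c hc
    simpa using hb μ c hc
  · intro μ ν h
    exact Subtype.ext (YoungDiagram.ext (Subtype.ext_iff.1 h))

instance (n : ℕ) : Fintype (Shape n) := Fintype.ofFinite _

/-- The partition `2λ`, all of whose rows are twice as long as those of `λ`. -/
def Shape.double {n : ℕ} (μ : Shape n) : Shape (2 * n) :=
  ⟨{ cells := μ.1.cells.biUnion fun c => {(c.1, 2 * c.2), (c.1, 2 * c.2 + 1)}
     isLowerSet := by
      rintro ⟨i, j⟩ ⟨i', j'⟩ hle h
      obtain ⟨hi, hj⟩ := Prod.mk_le_mk.1 hle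
      simp only [Finset.coe_biUnion, Set.mem_iUnion, Finset.coe_insert, Finset.coe_singleton,
        Set.mem_insert_iff, Set.mem_singleton_iff, Prod.mk.injEq, Finset.mem_coe] at h ⊢
      obtain ⟨⟨a, b⟩, hab, h⟩ := h
      refine ⟨(i', j' / 2), μ.1.up_left_mem (i2 := a) (j2 := b) ?_ ?_ hab, ?_⟩ <;>
        omega }, by
    change (μ.1.cells.biUnion _).card = _
    rw [Finset.card_biUnion]
    · rw [Finset.sum_const_nat (m := 2) (fun c _ => Finset.card_pair (by simp)), mul_comm]
      exact congrArg (2 * ·) μ.2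
    · rintro ⟨a, b⟩ _ ⟨c, d⟩ _ h
      refine Finset.disjoint_left.2 ?_
      rintro ⟨i, j⟩ h1 h2
      simp only [Finset.mem_insert, Finset.mem_singleton, Prod.mk.injEq] at h1 h2
      apply h
      ext <;> simp only <;> omega⟩

/-- A filling of the diagram `μ` by the `n` points (any filling gives an isomorphic Specht
module). -/
def Shape.filling {n : ℕ} (μ : Shape n) : μ.1.cells ≃ Fin n :=
  μ.1.cells.equivFinOfCardEq μ.2

/-- The cell of `μ` containing `k`. -/
def Shape.cellOf {n : ℕ} (μ : Shape n) (k : Fin n) : ℕ × ℕ := (μ.filling.symm k).1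

open Classical in
/-- The Young symmetrizer: sum over the permutations `r` preserving the rows and the permutations
`c` preserving the columns of `ε(c) r c`. -/
def Shape.youngSymmetrizer {n : ℕ} (μ : Shape n) : GA n :=
  (∑ r : Equiv.Perm (Fin n) with ∀ k, (μ.cellOf (r k)).1 = (μ.cellOf k).1, perm r) *
  (∑ c : Equiv.Perm (Fin n) with ∀ k, (μ.cellOf (c k)).2 = (μ.cellOf k).2,
    ((Equiv.Perm.sign c : ℤ) : ℂ) • perm c)

/-- The irreducible module `V^μ` of `𝔖ₙ` (Specht module): the left ideal of `ℂ[𝔖ₙ]` generated by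
the Young symmetrizer. -/
def Shape.specht {n : ℕ} (μ : Shape n) : Ideal (GA n) := Ideal.span {μ.youngSymmetrizer}

/-- The character of `V^μ`. -/
def Shape.character {n : ℕ} (μ : Shape n) (σ : Equiv.Perm (Fin n)) : ℂ :=
  LinearMap.trace ℂ μ.specht (Algebra.lsmul ℂ ℂ μ.specht (perm σ))

/-- `𝒫_μ`, the projection on the isotypic component `μ`:
`(dim V^μ / n!) ∑_σ χ^μ(σ⁻¹) σ`. -/
def Shape.proj {n : ℕ} (μ : Shape n) : GA n :=
  ((Module.finrank ℂ μ.specht : ℂ) / (n.factorial : ℂ)) •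
    ∑ σ : Equiv.Perm (Fin n), μ.character σ⁻¹ • perm σ

/-- `R_λ(z) = ∏_{(i,j) ∈ λ} (z + j - i)`. -/
def Shape.R {p : ℕ} (μ : Shape p) (z : ℂ) : ℂ :=
  ∏ c ∈ μ.1.cells, (z + (c.2 : ℂ) - (c.1 : ℂ))

/-- `R_{2,λ}(z) = ∏_{(i,j) ∈ λ} (z + 2(j-1) - (i-1))`, the product being over the cells with rows
and columns indexed from `1`. -/
def Shape.R₂ {p : ℕ} (μ : Shape p) (z : ℂ) : ℂ :=
  ∏ c ∈ μ.1.cells, (z + 2 * (c.2 : ℂ) - (c.1 : ℂ))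

/-- `𝐖(z) = ∑_{λ ⊢ p} R_{2,λ}(z)⁻¹ 𝒫_{2λ}`; terms with `R_{2,λ}(z) = 0` are omitted. -/
def weingartenO (p : ℕ) (z : ℂ) : GA (2 * p) := ∑ μ : Shape p, (μ.R₂ z)⁻¹ • μ.double.proj

/-- `𝐖𝐠(z) = ∑_{λ ⊢ p} R_λ(z)⁻¹ 𝒫_λ`; terms with `R_λ(z) = 0` are omitted. -/
def weingartenU (p : ℕ) (z : ℂ) : GA p := ∑ μ : Shape p, (μ.R z)⁻¹ • μ.proj

/-! ### Tensor representations -/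

/-- The space `(ℂ^d)^{⊗ n}`. -/
abbrev Tensor (d n : ℕ) : Type := ⨂[ℂ] _ : Fin n, (Fin d → ℂ)

/-- `σ.(v₁ ⊗ ⋯ ⊗ vₙ) = v_{σ⁻¹(1)} ⊗ ⋯ ⊗ v_{σ⁻¹(n)}`. -/
def permTensor (d n : ℕ) : Equiv.Perm (Fin n) →* Module.End ℂ (Tensor d n) where
  toFun σ := (PiTensorProduct.reindex ℂ (fun _ : Fin n => (Fin d → ℂ)) σ).toLinearMap
  map_one' := by
    refine PiTensorProduct.ext (MultilinearMap.ext fun v => ?_)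
    exact PiTensorProduct.reindex_tprod _ _
  map_mul' σ τ := by
    refine PiTensorProduct.ext (MultilinearMap.ext fun v => ?_)
    simp only [LinearMap.compMultilinearMap_apply, Module.End.mul_apply, LinearEquiv.coe_coe]
    refine (PiTensorProduct.reindex_tprod _ _).trans ?_
    refine Eq.trans ?_ (congrArg
      (PiTensorProduct.reindex ℂ (fun _ : Fin n => (Fin d → ℂ)) σ)
      (PiTensorProduct.reindex_tprod (R := ℂ) (s := fun _ : Fin n => (Fin d → ℂ)) τ v)).symm
    exact (PiTensorProduct.reindex_tprod (R := ℂ) (s := fun _ : Fin n => (Fin d → ℂ)) σ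
      (fun i => v (τ.symm i))).symm

/-- `σ.(v₁ ⊗ ⋯ ⊗ vₙ) = ε(σ) v_{σ⁻¹(1)} ⊗ ⋯ ⊗ v_{σ⁻¹(n)}`. -/
def signedPermTensor (d n : ℕ) : Equiv.Perm (Fin n) →* Module.End ℂ (Tensor d n) where
  toFun σ := ((Equiv.Perm.sign σ : ℤ) : ℂ) • permTensor d n σ
  map_one' := by simp
  map_mul' σ τ := by simp [smul_smul, mul_comm]

/-- The restriction to `ℂ[𝔖ₙ]` of the representation `ρ_O` of the Brauer algebra `ℬₙ(N)` on
`(ℂ^N)^{⊗ n}`. -/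
def rhoO (N n : ℕ) : GA n →ₐ[ℂ] Module.End ℂ (Tensor N n) :=
  MonoidAlgebra.lift ℂ _ _ (permTensor N n)

/-- The restriction to `ℂ[𝔖ₙ]` of the representation `ρ_S` of the Brauer algebra `ℬₙ(-2N)` on
`(ℂ^{2N})^{⊗ n}`. -/
def rhoS (N n : ℕ) : GA n →ₐ[ℂ] Module.End ℂ (Tensor (2 * N) n) :=
  MonoidAlgebra.lift ℂ _ _ (signedPermTensor (2 * N) n)

end JMBrauer

end

open JMBrauer

noncomputable section

namespace JMBrauer

open Equiv (Perm swap)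

variable {n : ℕ}

/-! ### Coefficients in the group algebra -/

/-! The unitary and the hyperoctahedral statements follow one pattern: factorize, diagonalize,
telescope.

Factorization. A permutation of `k + 1` points is uniquely `(a q) σ'` with `q` the last point and
`σ'` fixing `q`; if `a ≠ q`, the product has one cycle less than `σ'`. Hence `Ω(z)` is the product
of the `z + X_k`. Pair partitions can be built the same way by moving one point of each pair only,
so `𝐆(z) 𝒫_ℋ` is the product of the `z + X_{2k-1}` times `𝒫_ℋ`. Both are cases of `chain_expansion`.

Diagonalization. Let `b` and `a` be the column antisymmetrizer and the row symmetrizer of a tableau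
filled column by column. A Garnir relation gives `X_k b a = (content of k) b a`
(`IsTableau.jm_mul`), so `Ω(z)` is `R_λ(z)` on the component `λ`. For the shape `2λ`, with every
pair in two adjacent cells of a row, the same computation holds for the odd Jucys-Murphy elements
modulo smaller hyperoctahedral averages, with eigenvalue `2(j-1) - (i-1)`
(`IsTableau.subAvg_mul_oddFactor`). It determines `𝐆(z) 𝒫_ℋ` because `𝒫_ℋ b a ≠ 0`: the coefficients
of `b a` on `ℋ` are nonnegative integers, and the one at the identity is `1`
(`IsTableau.avg_mul_ne_zero`). Completeness is a dimension count (`exists_eq_sum_smul`): the `𝒫_λ`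
are orthogonal idempotents of the center, and the `𝒫_ℋ 𝒫_{2λ}` are orthogonal idempotents of `𝒫_ℋ
ℂ[𝔖_{2p}] 𝒫_ℋ`; both algebras are spanned by a class function on `𝔖_p` (for the center, `𝔖_n` with
`n = p`), and there are at most as many classes as diagrams. Pseudo-inverses are then read off from
the eigenvalues.

Telescoping. The sum of all transpositions is half the sum over the points `q` of the stars `∑_{a ≠
q} (a q)`; the averaging group permutes the relevant stars transitively, so all have the same
compression. This is (i), and it turns `P (z + X) P` into `z / k` times `Z_{2k} P` or `Y_k P`. The
averages are nested and commute with the neighbouring factors, so the products collapse from the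
inside (`mul_chain_mul_prod_mul`).

Singular parameters. `ρ_O` kills diagrams with more than `N` rows, `ρ_S` those with more than `2N`
columns. A vanishing eigenvalue of `Z_{2k}` or `Y_k` forces such a diagram: in a column of height
`h` the odd numbers `1, 3, …` sum to `h²`, which makes the eigenvalue sum strictly positive when all
heights are at most `N`, and rows are treated alike with the opposite sign. After applying the
representation, pseudo-inverses therefore act as inverses. -/

theorem perm_eq_single (σ : Perm (Fin n)) : perm σ = MonoidAlgebra.single σ (1 : ℂ) :=
  MonoidAlgebra.of_apply _ _ _

@[simp]
theorem perm_one : perm (1 : Perm (Fin n)) = 1 := map_one _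

theorem perm_mul (σ τ : Perm (Fin n)) : perm (σ * τ) = perm σ * perm τ := map_mul _ _ _

theorem coeff_perm (σ τ : Perm (Fin n)) : (perm σ).coeff τ = if σ = τ then 1 else 0 := by
  classical
  rw [perm_eq_single, MonoidAlgebra.coeff_single, Finsupp.single_apply]

theorem ga_induction {motive : GA n → Prop} (x : GA n) (hp : ∀ σ, motive (perm σ))
    (ha : ∀ x y, motive x → motive y → motive (x + y))
    (hs : ∀ (r : ℂ) x, motive x → motive (r • x)) : motive x :=
  MonoidAlgebra.induction_on x hp ha hs

/-- The coefficient of `σ`, as a linear form. -/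
def coef (σ : Perm (Fin n)) : GA n →ₗ[ℂ] ℂ where
  toFun x := x.coeff σ
  map_add' _ _ := rfl
  map_smul' _ _ := rfl

@[simp]
theorem coef_perm (σ τ : Perm (Fin n)) : coef τ (perm σ) = if σ = τ then 1 else 0 :=
  coeff_perm σ τ

theorem ga_ext {x y : GA n} (h : ∀ σ, coef σ x = coef σ y) : x = y :=
  MonoidAlgebra.ext (Finsupp.ext h)

theorem eq_sum_coef (x : GA n) : x = ∑ σ, coef σ x • perm σ := by
  refine ga_ext fun τ => ?_
  simp

theorem linearMap_ext {V : Type*} [AddCommMonoid V] [Module ℂ V] {f g : GA n →ₗ[ℂ] V}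
    (h : ∀ σ, f (perm σ) = g (perm σ)) : f = g := by
  refine LinearMap.ext fun x => ?_
  induction x using ga_induction with
  | hp σ => exact h σ
  | ha x y hx hy => rw [map_add, map_add, hx, hy]
  | hs r x hx => rw [map_smul, map_smul, hx]

theorem coef_perm_mul (g σ : Perm (Fin n)) (x : GA n) :
    coef σ (perm g * x) = coef (g⁻¹ * σ) x := by
  induction x using ga_induction with
  | hp τ => simp [← perm_mul, eq_inv_mul_iff_mul_eq]
  | ha x y hx hy => rw [mul_add, map_add, map_add, hx, hy]
  | hs r x hx => rw [mul_smul_comm, map_smul, map_smul, hx]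

theorem coef_mul_perm (g σ : Perm (Fin n)) (x : GA n) :
    coef σ (x * perm g) = coef (σ * g⁻¹) x := by
  induction x using ga_induction with
  | hp τ => simp [← perm_mul, eq_mul_inv_iff_mul_eq]
  | ha x y hx hy => rw [add_mul, map_add, map_add, hx, hy]
  | hs r x hx => rw [smul_mul_assoc, map_smul, map_smul, hx]

theorem commute_of_perm {x : GA n} (h : ∀ σ, Commute (perm σ) x) (y : GA n) : Commute y x := by
  induction y using ga_induction with
  | hp τ => exact h τ
  | ha a b ha hb => exact ha.add_left hb
  | hs r a ha => exact ha.smul_left r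

theorem smul_one_commute {A : Type*} [Ring A] [Algebra ℂ A] (r : ℂ) (y : A) :
    Commute (r • (1 : A)) y := (Commute.one_left y).smul_left r

/-- The anti-automorphism `σ ↦ σ⁻¹`. -/
def flip : GA n →ₗ[ℂ] GA n :=
  Fintype.linearCombination ℂ (fun σ : Perm (Fin n) => perm σ⁻¹) ∘ₗ LinearMap.pi coef

@[simp]
theorem flip_perm (σ : Perm (Fin n)) : flip (perm σ) = perm σ⁻¹ := by
  simp [flip, Fintype.linearCombination_apply]

theorem flip_mul (x y : GA n) : flip (x * y) = flip y * flip x := by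
  induction x using ga_induction with
  | hp σ =>
    induction y using ga_induction with
    | hp τ => rw [← perm_mul, flip_perm, flip_perm, flip_perm, ← perm_mul, mul_inv_rev]
    | ha x y hx hy => rw [mul_add, map_add, map_add, hx, hy, add_mul]
    | hs r x hx => rw [mul_smul_comm, map_smul, map_smul, hx, smul_mul_assoc]
  | ha x y hx hy => rw [add_mul, map_add, map_add, hx, hy, mul_add]
  | hs r x hx => rw [smul_mul_assoc, map_smul, map_smul, hx, mul_smul_comm]

@[simp]
theorem flip_one : flip (1 : GA n) = 1 := by
  rw [← perm_one, flip_perm, inv_one]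

theorem flip_swap (a b : Fin n) : flip (perm (swap a b)) = perm (swap a b) := by
  rw [flip_perm, Equiv.swap_inv]

/-! ### Row and column symmetrizers -/

/-- The sum of `χ(σ) σ` over the permutations `σ` preserving `f`. -/
def levelSym (χ : Perm (Fin n) →* ℤˣ) (f : Fin n → ℕ) : GA n :=
  ∑ σ : Perm (Fin n) with ∀ k, f (σ k) = f k, ((χ σ : ℤ) : ℂ) • perm σ

/-- The sum of the permutations preserving `f`. -/
abbrev rowSym (f : Fin n → ℕ) : GA n := levelSym 1 f

/-- The signed sum of the permutations preserving `f`. -/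
abbrev colSym (f : Fin n → ℕ) : GA n := levelSym Equiv.Perm.sign f

theorem unit_cast_mul_self (u : ℤˣ) : ((u : ℤ) : ℂ) * ((u : ℤ) : ℂ) = 1 := by
  rw [← Int.cast_mul, Int.units_coe_mul_self, Int.cast_one]

theorem perm_apply_inv_self (σ : Perm (Fin n)) (k : Fin n) : σ (σ⁻¹ k) = k :=
  σ.apply_symm_apply k

theorem perm_inv_apply_self (σ : Perm (Fin n)) (k : Fin n) : σ⁻¹ (σ k) = k :=
  σ.symm_apply_apply k

theorem eq_zero_of_eq_neg {V : Type*} [AddCommGroup V] [Module ℂ V] {x : V} (h : x = -x) :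
    x = 0 := by
  have h2 : (2 : ℂ) • x = 0 := by rw [two_smul]; nth_rw 2 [h]; exact add_neg_cancel x
  exact (smul_eq_zero.1 h2).resolve_left two_ne_zero

theorem perm_mul_levelSym (χ : Perm (Fin n) →* ℤˣ) {f : Fin n → ℕ} {σ : Perm (Fin n)}
    (h : ∀ k, f (σ k) = f k) : perm σ * levelSym χ f = ((χ σ : ℤ) : ℂ) • levelSym χ f := by
  simp only [levelSym, Finset.mul_sum, Finset.smul_sum]
  refine Finset.sum_bij (fun τ _ => σ * τ) (fun τ hτ => ?_) (fun _ _ _ _ h => mul_left_cancel h)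
    (fun τ hτ => ⟨σ⁻¹ * τ, ?_, by simp⟩) (fun τ hτ => ?_)
  · simp only [Finset.mem_filter_univ] at hτ ⊢
    intro k
    rw [Equiv.Perm.mul_apply, h, hτ]
  · simp only [Finset.mem_filter_univ] at hτ ⊢
    intro k
    rw [← h, Equiv.Perm.mul_apply, perm_apply_inv_self, hτ]
  · rw [mul_smul_comm, ← perm_mul, smul_smul, map_mul, Units.val_mul, Int.cast_mul, ← mul_assoc,
      unit_cast_mul_self, one_mul]

theorem flip_levelSym (χ : Perm (Fin n) →* ℤˣ) (f : Fin n → ℕ) :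
    flip (levelSym χ f) = levelSym χ f := by
  simp only [levelSym, map_sum, map_smul, flip_perm]
  refine Finset.sum_bij (fun τ _ => τ⁻¹) (fun τ hτ => ?_) (fun _ _ _ _ h => inv_injective h)
    (fun τ hτ => ⟨τ⁻¹, ?_, by simp⟩) (fun τ hτ => ?_)
  · simp only [Finset.mem_filter_univ] at hτ ⊢
    intro k
    rw [← hτ, perm_apply_inv_self]
  · simp only [Finset.mem_filter_univ] at hτ ⊢
    intro k
    rw [← hτ, perm_apply_inv_self]
  · rw [map_inv, Int.units_inv_eq_self]

theorem levelSym_mul_perm (χ : Perm (Fin n) →* ℤˣ) {f : Fin n → ℕ} {σ : Perm (Fin n)}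
    (h : ∀ k, f (σ k) = f k) : levelSym χ f * perm σ = ((χ σ : ℤ) : ℂ) • levelSym χ f := by
  have h' : ∀ k, f (σ⁻¹ k) = f k := fun k => by rw [← h, perm_apply_inv_self]
  have := congrArg flip (perm_mul_levelSym χ h')
  rwa [flip_mul, map_smul, flip_levelSym, flip_perm, inv_inv, map_inv,
    Int.units_inv_eq_self] at this

/-- Conjugation by `g` relabels the points, and a character with values in a commutative group is
constant on conjugates. -/
theorem perm_mul_levelSym_mul (χ : Perm (Fin n) →* ℤˣ) (f : Fin n → ℕ) (g : Perm (Fin n)) :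
    perm g * levelSym χ (f ∘ g) = levelSym χ f * perm g := by
  simp only [levelSym, Finset.mul_sum, Finset.sum_mul]
  refine Finset.sum_bij (fun τ _ => g * τ * g⁻¹) (fun τ hτ => ?_)
    (fun _ _ _ _ h => mul_left_cancel (mul_right_cancel h))
    (fun τ hτ => ⟨g⁻¹ * τ * g, ?_, by simp [mul_assoc]⟩) (fun τ hτ => ?_)
  · simp only [Finset.mem_filter_univ, Function.comp_apply] at hτ ⊢
    intro k
    simp [hτ]
  · simp only [Finset.mem_filter_univ, Function.comp_apply] at hτ ⊢
    intro k
    simp [hτ]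
  · rw [mul_smul_comm, smul_mul_assoc, ← perm_mul, ← perm_mul, map_mul, map_mul, map_inv,
      mul_right_comm, mul_inv_cancel, one_mul, inv_mul_cancel_right]

theorem coef_levelSym (χ : Perm (Fin n) →* ℤˣ) (f : Fin n → ℕ) (σ : Perm (Fin n)) :
    coef σ (levelSym χ f) = if ∀ k, f (σ k) = f k then ((χ σ : ℤ) : ℂ) else 0 := by
  simp only [levelSym, map_sum, map_smul, coef_perm, smul_eq_mul, mul_ite, mul_one, mul_zero,
    Finset.sum_ite_eq', Finset.mem_filter_univ]

theorem rowSym_mul_swap {f : Fin n → ℕ} {x y : Fin n} (h : f x = f y) :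
    rowSym f * perm (swap x y) = rowSym f := by
  rw [levelSym_mul_perm]
  · simp
  · intro k
    by_cases hx : k = x
    · rw [hx, Equiv.swap_apply_left, h]
    by_cases hy : k = y
    · rw [hy, Equiv.swap_apply_right, h]
    rw [Equiv.swap_apply_of_ne_of_ne hx hy]

theorem colSym_mul_swap {f : Fin n → ℕ} {x y : Fin n} (hne : x ≠ y) (h : f x = f y) :
    colSym f * perm (swap x y) = -colSym f := by
  rw [levelSym_mul_perm]
  · simp [Equiv.Perm.sign_swap hne]
  · intro k
    by_cases hx : k = x
    · rw [hx, Equiv.swap_apply_left, h]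
    by_cases hy : k = y
    · rw [hy, Equiv.swap_apply_right, h]
    rw [Equiv.swap_apply_of_ne_of_ne hx hy]

theorem swap_mul_rowSym {f : Fin n → ℕ} {x y : Fin n} (h : f x = f y) :
    perm (swap x y) * rowSym f = rowSym f := by
  have := congrArg flip (rowSym_mul_swap h)
  rwa [flip_mul, flip_swap, flip_levelSym] at this

theorem swap_mul_colSym {f : Fin n → ℕ} {x y : Fin n} (hne : x ≠ y) (h : f x = f y) :
    perm (swap x y) * colSym f = -colSym f := by
  have := congrArg flip (colSym_mul_swap hne h)
  rwa [flip_mul, flip_swap, map_neg, flip_levelSym] at this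

/-- If two points lie in a common level set of `ρ` and of `κ`, the symmetrizers annihilate each
other. -/
theorem colSym_mul_rowSym_eq_zero {ρ κ : Fin n → ℕ} {x y : Fin n} (hne : x ≠ y) (hρ : ρ x = ρ y)
    (hκ : κ x = κ y) : colSym κ * rowSym ρ = 0 := by
  have h : colSym κ * rowSym ρ = -(colSym κ * rowSym ρ) := by
    conv_lhs => rw [← swap_mul_rowSym hρ, ← mul_assoc, colSym_mul_swap hne hκ, neg_mul]
  exact eq_zero_of_eq_neg h

end JMBrauer

end

noncomputable section

namespace JMBrauer

open Equiv (Perm swap)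

variable {n : ℕ}

/-! ### Tableaux and their weights -/

/-- `t` is a bijective filling of the diagram `μ`: the point `k` is in the cell `t k`. -/
def IsTableau (μ : Shape n) (t : Fin n → ℕ × ℕ) : Prop :=
  Function.Injective t ∧ ∀ k, t k ∈ μ.1.cells

theorem IsTableau.image {μ : Shape n} {t : Fin n → ℕ × ℕ} (ht : IsTableau μ t) :
    Finset.univ.image t = μ.1.cells := by
  refine Finset.eq_of_subset_of_card_le (fun c hc => ?_) ?_
  · obtain ⟨k, -, rfl⟩ := Finset.mem_image.1 hc
    exact ht.2 k
  · rw [Finset.card_image_of_injective _ ht.1, Finset.card_univ, Fintype.card_fin]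
    exact μ.2.le

theorem IsTableau.exists_eq {μ : Shape n} {t : Fin n → ℕ × ℕ} (ht : IsTableau μ t) {c : ℕ × ℕ}
    (hc : c ∈ μ.1.cells) : ∃ k, t k = c := by
  rw [← ht.image] at hc
  obtain ⟨k, -, hk⟩ := Finset.mem_image.1 hc
  exact ⟨k, hk⟩

theorem IsTableau.sum_comp {M : Type*} [AddCommMonoid M] {μ : Shape n} {t : Fin n → ℕ × ℕ}
    (ht : IsTableau μ t) (f : ℕ × ℕ → M) : ∑ k, f (t k) = ∑ c ∈ μ.1.cells, f c := by
  rw [← ht.image, Finset.sum_image fun _ _ _ _ h => ht.1 h]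

theorem IsTableau.prod_comp {M : Type*} [CommMonoid M] {μ : Shape n} {t : Fin n → ℕ × ℕ}
    (ht : IsTableau μ t) (f : ℕ × ℕ → M) : ∏ k, f (t k) = ∏ c ∈ μ.1.cells, f c := by
  rw [← ht.image, Finset.prod_image fun _ _ _ _ h => ht.1 h]

theorem Shape.isTableau_cellOf (μ : Shape n) : IsTableau μ μ.cellOf :=
  ⟨fun _ _ h => μ.filling.symm.injective (Subtype.ext h), fun k => (μ.filling.symm k).2⟩

/-- Two tableaux of the same shape differ by a permutation. -/
theorem IsTableau.exists_perm {μ : Shape n} {t u : Fin n → ℕ × ℕ} (ht : IsTableau μ t)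
    (hu : IsTableau μ u) : ∃ g : Perm (Fin n), t ∘ g = u := by
  choose g hg using fun k => ht.exists_eq (hu.2 k)
  have hinj : Function.Injective g := fun x y h => hu.1 (by rw [← hg x, ← hg y, h])
  exact ⟨Equiv.ofBijective g (Finite.injective_iff_bijective.1 hinj), funext hg⟩

theorem IsTableau.comp_perm {μ : Shape n} {t : Fin n → ℕ × ℕ} (ht : IsTableau μ t)
    (g : Perm (Fin n)) : IsTableau μ (t ∘ g) :=
  ⟨ht.1.comp g.injective, fun k => ht.2 (g k)⟩

/-- Among the sets of `m` natural numbers, `{0, …, m - 1}` has the smallest sum. -/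
theorem sum_range_add_card_le (S : Finset ℕ) :
    ∑ j ∈ Finset.range S.card, j + (S \ Finset.range S.card).card ≤ ∑ j ∈ S, j := by
  set R := Finset.range S.card with hR
  have hd : (R \ S).card = (S \ R).card := by
    rw [Finset.card_sdiff_comm]; simp [hR]
  have h1 : ∑ j ∈ R \ S, j + ∑ j ∈ R ∩ S, j = ∑ j ∈ R, j := by
    rw [add_comm, Finset.sum_inter_add_sum_sdiff]
  have h2 : ∑ j ∈ S \ R, j + ∑ j ∈ R ∩ S, j = ∑ j ∈ S, j := by
    rw [add_comm, Finset.inter_comm, Finset.sum_inter_add_sum_sdiff]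
  -- The elements of `R \ S` are below `|S|`, those of `S \ R` are not, and both sets have the same
  -- cardinality. The `+ 1` of the strict bound produces the defect `|S \ R|`.
  have h3 : ∑ j ∈ R \ S, (j + 1) ≤ (R \ S).card * S.card := by
    rw [← smul_eq_mul]
    refine Finset.sum_le_card_nsmul _ _ _ fun j hj => ?_
    have := Finset.mem_range.1 (Finset.mem_sdiff.1 hj).1
    omega
  have h4 : (S \ R).card * S.card ≤ ∑ j ∈ S \ R, j := by
    rw [← smul_eq_mul]
    refine Finset.card_nsmul_le_sum _ _ _ fun j hj => ?_
    have := (Finset.mem_sdiff.1 hj).2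
    rwa [hR, Finset.mem_range, not_lt] at this
  rw [Finset.sum_add_distrib, Finset.sum_const, smul_eq_mul, mul_one] at h3
  rw [hd] at h3
  omega

/-- If a filling `κ` by columns puts the points of every row of the tableau `t` in distinct
columns, its weight is at least that of `t`, with equality only if it fills the same diagram. -/
theorem IsTableau.weight_le {μ : Shape n} {t : Fin n → ℕ × ℕ} (ht : IsTableau μ t)
    {κ : Fin n → ℕ} (hκ : ∀ x y, (t x).1 = (t y).1 → κ x = κ y → x = y) :
    ∑ k, (t k).2 ≤ ∑ k, κ k ∧
      (∑ k, κ k = ∑ k, (t k).2 → ∀ k, ((t k).1, κ k) ∈ μ.1.cells) := by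
  let I : ℕ → Finset (Fin n) := fun i => Finset.univ.filter fun k => (t k).1 = i
  let rows := Finset.univ.image fun k => (t k).1
  have hsum : ∀ f : Fin n → ℕ, ∑ i ∈ rows, ∑ k ∈ I i, f k = ∑ k, f k := fun f =>
    Finset.sum_fiberwise_of_maps_to (fun k _ => Finset.mem_image_of_mem _ (Finset.mem_univ k)) f
  have hinjI : ∀ i, Set.InjOn κ (I i) := fun i x hx y hy h => by
    refine hκ x y ?_ h
    simp only [I, Finset.coe_filter, Finset.mem_univ, true_and, Set.mem_ofPred_eq] at hx hy
    rw [hx, hy]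
  have himg : ∀ i, (I i).image (fun k => (t k).2) = Finset.range (μ.1.rowLen i) := fun i => by
    ext j
    rw [Finset.mem_range, ← YoungDiagram.mem_iff_lt_rowLen, ← YoungDiagram.mem_cells]
    constructor
    · intro h
      obtain ⟨k, hk, rfl⟩ := Finset.mem_image.1 h
      rw [← (Finset.mem_filter_univ (p := fun k => (t k).1 = i) k).1 hk]
      exact ht.2 k
    · intro h
      obtain ⟨k, hk⟩ := ht.exists_eq h
      exact Finset.mem_image.2 ⟨k, by simp [I, hk], by rw [hk]⟩
  have hinjt : ∀ i, Set.InjOn (fun k => (t k).2) (I i) := fun i x hx y hy h => by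
    simp only [I, Finset.coe_filter, Finset.mem_univ, true_and, Set.mem_ofPred_eq] at hx hy
    exact ht.1 (Prod.ext (hx.trans hy.symm) h)
  have hcard : ∀ i, (I i).card = μ.1.rowLen i := fun i => by
    rw [← Finset.card_image_of_injOn (hinjt i), himg, Finset.card_range]
  -- On each row `κ` is injective, so its values form a set of `rowLen i` numbers, to be compared
  -- with `{0, …, rowLen i - 1}`.
  have key : ∀ i, ∑ k ∈ I i, (t k).2 +
      ((I i).image κ \ Finset.range (μ.1.rowLen i)).card ≤ ∑ k ∈ I i, κ k := fun i => by
    have h := sum_range_add_card_le ((I i).image κ)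
    rw [Finset.card_image_of_injOn (hinjI i), hcard, Finset.sum_image (hinjI i), ← himg,
      Finset.sum_image (hinjt i), himg] at h
    exact h
  have tot := Finset.sum_le_sum fun i (_ : i ∈ rows) => key i
  rw [Finset.sum_add_distrib, hsum, hsum] at tot
  refine ⟨by omega, fun he k => ?_⟩
  -- With equal weights every defect vanishes, so the values of `κ` on each row are the legal
  -- columns of that row.
  have hz : ∑ i ∈ rows, ((I i).image κ \ Finset.range (μ.1.rowLen i)).card = 0 := by omega
  have hz' := Finset.sum_eq_zero_iff.1 hz (t k).1
    (Finset.mem_image_of_mem _ (Finset.mem_univ k))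
  rw [Finset.card_eq_zero, Finset.sdiff_eq_empty_iff_subset] at hz'
  have := hz' (Finset.mem_image_of_mem κ (a := k) (by simp [I]))
  rwa [Finset.mem_range, ← YoungDiagram.mem_iff_lt_rowLen] at this

/-- The column filling `κ` is too light for the shape of `t`. -/
theorem IsTableau.colSym_mul_mul_rowSym {μ : Shape n} {t : Fin n → ℕ × ℕ} (ht : IsTableau μ t)
    {κ : Fin n → ℕ} (hκ : ∑ k, κ k < ∑ k, (t k).2) (x : GA n) :
    colSym κ * x * rowSym (fun k => (t k).1) = 0 := by
  induction x using ga_induction with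
  | hp g =>
    have ht' := ht.comp_perm g⁻¹
    have hg : perm g * rowSym (fun k => (t k).1) =
        rowSym (fun k => ((t ∘ ⇑g⁻¹) k).1) * perm g := by
      rw [← perm_mul_levelSym_mul]
      congr 2
      ext k
      simp
    rw [mul_assoc, hg, ← mul_assoc]
    -- If no two points shared a row of `t ∘ g⁻¹` and a column of `κ`, then `κ` would be at least as
    -- heavy as the tableau. Such a pair makes the symmetrizers annihilate each other.
    have hne : ¬∀ x y, ((t ∘ ⇑g⁻¹) x).1 = ((t ∘ ⇑g⁻¹) y).1 → κ x = κ y → x = y := fun h => by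
      have h1 := (ht'.weight_le h).1
      rw [ht'.sum_comp (fun c => c.2), ← ht.sum_comp (fun c => c.2)] at h1
      omega
    push Not at hne
    obtain ⟨x, y, h1, h2, h3⟩ := hne
    rw [colSym_mul_rowSym_eq_zero h3 h1 h2, zero_mul]
  | ha x y hx hy => rw [mul_add, add_mul, hx, hy, add_zero]
  | hs r x hx => rw [mul_smul_comm, smul_mul_assoc, hx, smul_zero]

theorem IsTableau.rowSym_mul_mul_colSym {μ : Shape n} {t : Fin n → ℕ × ℕ} (ht : IsTableau μ t)
    {κ : Fin n → ℕ} (hκ : ∑ k, κ k < ∑ k, (t k).2) (x : GA n) :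
    rowSym (fun k => (t k).1) * x * colSym κ = 0 := by
  induction x using ga_induction with
  | hp g =>
    have h := congrArg flip (ht.colSym_mul_mul_rowSym hκ (perm g⁻¹))
    rwa [flip_mul, flip_mul, flip_levelSym, flip_levelSym, flip_perm, inv_inv, map_zero,
      ← mul_assoc] at h
  | ha x y hx hy => rw [mul_add, add_mul, hx, hy, add_zero]
  | hs r x hx => rw [mul_smul_comm, smul_mul_assoc, hx, smul_zero]

/-- If `b x a ≠ 0` with column symmetrizer `b` of shape `ν` and row symmetrizer `a` of shape `μ`
of the same weights, then `μ = ν`. -/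
theorem IsTableau.shape_eq {μ ν : Shape n} {t u : Fin n → ℕ × ℕ} (ht : IsTableau μ t)
    (hu : IsTableau ν u) (hw : ∑ k, (u k).2 = ∑ k, (t k).2) {x : GA n}
    (hx : colSym (fun k => (u k).2) * x * rowSym (fun k => (t k).1) ≠ 0) : μ = ν := by
  induction x using ga_induction with
  | hp g =>
    have ht' := ht.comp_perm g⁻¹
    have hg : perm g * rowSym (fun k => (t k).1) =
        rowSym (fun k => ((t ∘ ⇑g⁻¹) k).1) * perm g := by
      rw [← perm_mul_levelSym_mul]
      congr 2
      ext k
      simp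
    rw [mul_assoc, hg, ← mul_assoc] at hx
    have hinj : ∀ x y, ((t ∘ ⇑g⁻¹) x).1 = ((t ∘ ⇑g⁻¹) y).1 → (u x).2 = (u y).2 → x = y := by
      intro x y h1 h2
      by_contra h3
      exact hx (by rw [colSym_mul_rowSym_eq_zero h3 h1 h2, zero_mul])
    have hmem := (ht'.weight_le hinj).2 (by
      rw [ht'.sum_comp (fun c => c.2), ← ht.sum_comp (fun c => c.2), hw])
    -- The rows of `t ∘ g⁻¹` and the columns of `u` combine into a tableau of shape `μ`. Its column
    -- filling is that of `u`, so `μ` and `ν` have the same column lengths.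
    have hs : IsTableau μ fun k => (((t ∘ ⇑g⁻¹) k).1, (u k).2) :=
      ⟨fun x y h => hinj x y (Prod.ext_iff.1 h).1 (Prod.ext_iff.1 h).2, hmem⟩
    have hcol : ∀ j, μ.1.colLen j = ν.1.colLen j := fun j => by
      rw [YoungDiagram.colLen_eq_card, YoungDiagram.colLen_eq_card, YoungDiagram.col,
        YoungDiagram.col, ← hs.image, ← hu.image, Finset.filter_image, Finset.filter_image,
        Finset.card_image_of_injective _ hs.1, Finset.card_image_of_injective _ hu.1]
    refine Subtype.ext (YoungDiagram.ext (Finset.ext fun c => ?_))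
    rw [YoungDiagram.mem_cells, YoungDiagram.mem_cells, ← Prod.mk.eta (p := c),
      YoungDiagram.mem_iff_lt_colLen, YoungDiagram.mem_iff_lt_colLen, hcol]
  | ha x y ihx ihy =>
    by_cases h : colSym (fun k => (u k).2) * x * rowSym (fun k => (t k).1) = 0
    · exact ihy fun h' => hx (by rw [mul_add, add_mul, h, h', add_zero])
    · exact ihx h
  | hs r x ih =>
    exact ih fun h => hx (by rw [mul_smul_comm, smul_mul_assoc, h, smul_zero])

end JMBrauer

end

noncomputable section

namespace JMBrauer

open Equiv (Perm swap)

variable {n : ℕ}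

/-! ### Young symmetrizers and isotypic projections -/

instance : Module.Finite ℂ (GA n) := Module.Finite.of_basis (MonoidAlgebra.basis (Perm (Fin n)) ℂ)

instance : Module.Free ℂ (GA n) := Module.Free.of_basis (MonoidAlgebra.basis (Perm (Fin n)) ℂ)

theorem trace_ga (f : GA n →ₗ[ℂ] GA n) : LinearMap.trace ℂ (GA n) f = ∑ σ, coef σ (f (perm σ)) := by
  classical
  rw [LinearMap.trace_eq_matrix_trace ℂ (MonoidAlgebra.basis (Perm (Fin n)) ℂ), Matrix.trace]
  refine Finset.sum_congr rfl fun σ _ => ?_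
  rw [Matrix.diag_apply, LinearMap.toMatrix_apply, MonoidAlgebra.basis_apply, ← perm_eq_single]
  rfl

theorem coef_one_mul (x y : GA n) : coef 1 (x * y) = ∑ σ, coef σ x * coef σ⁻¹ y := by
  conv_lhs => rw [eq_sum_coef x, Finset.sum_mul, map_sum]
  refine Finset.sum_congr rfl fun σ _ => ?_
  rw [smul_mul_assoc, map_smul, coef_perm_mul, mul_one, smul_eq_mul]

/-- The sum of the conjugates of `x`. -/
def conjSum : GA n →ₗ[ℂ] GA n :=
  ∑ g : Perm (Fin n), LinearMap.mulLeft ℂ (perm g) ∘ₗ LinearMap.mulRight ℂ (perm g⁻¹)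

theorem conjSum_apply (x : GA n) : conjSum x = ∑ g : Perm (Fin n), perm g * x * perm g⁻¹ := by
  simp [conjSum, mul_assoc]

theorem commute_conjSum (x y : GA n) : Commute y (conjSum x) := by
  refine commute_of_perm (fun σ => ?_) y
  rw [Commute, SemiconjBy, conjSum_apply, Finset.mul_sum, Finset.sum_mul]
  refine Fintype.sum_equiv (Equiv.mulLeft σ) _ _ fun g => ?_
  simp only [Equiv.coe_mulLeft, mul_inv_rev, perm_mul, mul_assoc]
  rw [← perm_mul σ⁻¹ σ, inv_mul_cancel, perm_one, mul_one]

theorem conjSum_perm_mul (x : GA n) (σ : Perm (Fin n)) :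
    conjSum (perm σ * x) = conjSum (x * perm σ) := by
  rw [conjSum_apply, conjSum_apply]
  refine Fintype.sum_equiv (Equiv.mulRight σ) _ _ fun g => ?_
  simp only [Equiv.coe_mulRight, mul_inv_rev, perm_mul, mul_assoc]
  rw [← mul_assoc (perm σ) (perm σ⁻¹), ← perm_mul σ σ⁻¹, mul_inv_cancel, perm_one, one_mul]

theorem conjSum_mul_comm (x y : GA n) : conjSum (x * y) = conjSum (y * x) := by
  induction x using ga_induction with
  | hp g => exact conjSum_perm_mul _ _
  | ha x x' hx hy => rw [add_mul, mul_add, map_add, map_add, hx, hy]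
  | hs r x hx => rw [mul_smul_comm, smul_mul_assoc, map_smul, map_smul, hx]

theorem coef_conjSum (x : GA n) (σ : Perm (Fin n)) :
    coef σ (conjSum x) = ∑ g, coef (g⁻¹ * σ * g) x := by
  rw [conjSum_apply, map_sum]
  refine Finset.sum_congr rfl fun g _ => ?_
  rw [coef_mul_perm, coef_perm_mul, inv_inv, mul_assoc]

theorem mul_conjSum {x y : GA n} (h : ∀ g, Commute (perm g) y) : y * conjSum x = conjSum (y * x) := by
  simp only [conjSum_apply, Finset.mul_sum]
  refine Finset.sum_congr rfl fun g _ => ?_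
  rw [← mul_assoc, ← mul_assoc, ← (h g).eq, mul_assoc (perm g) y]

/-- An element `c` with `c A c = ℂ c`, normalized by its coefficient at the identity. -/
structure IsQuasiPrimitive (c : GA n) : Prop where
  coef_one : coef 1 c = 1
  exists_smul : ∀ x, ∃ s : ℂ, c * x * c = s • c

namespace IsQuasiPrimitive

variable {c : GA n} (hc : IsQuasiPrimitive c)
include hc

theorem mul_mul (x : GA n) : c * x * c = coef 1 (c * x * c) • c := by
  obtain ⟨s, hs⟩ := hc.exists_smul x
  rw [hs, map_smul, hc.coef_one, smul_eq_mul, mul_one]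

theorem mul_self : c * c = coef 1 (c * c) • c := by
  have := hc.mul_mul 1
  rwa [mul_one] at this

theorem ne_zero : c ≠ 0 := fun h => by
  have := hc.coef_one
  rw [h, map_zero] at this
  exact zero_ne_one this

/-- If `c² = 0`, right multiplication by `c` is nilpotent and has trace `0`; but its trace on the
group algebra is `n!` times the coefficient of `c` at the identity. -/
theorem hook_ne_zero : coef 1 (c * c) ≠ 0 := by
  intro h
  have h0 : c * c = 0 := by rw [hc.mul_self, h, zero_smul]
  have hnil : IsNilpotent (LinearMap.mulRight ℂ c) := ⟨2, by
    ext x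
    simp [pow_two, Module.End.mul_apply, mul_assoc, h0]⟩
  have htr := (LinearMap.isNilpotent_trace_of_isNilpotent hnil).eq_zero
  rw [trace_ga] at htr
  simp only [LinearMap.mulRight_apply, coef_perm_mul, inv_mul_cancel, hc.coef_one,
    Finset.sum_const, Finset.card_univ, nsmul_eq_mul, mul_one] at htr
  exact Fintype.card_ne_zero (Nat.cast_eq_zero.1 htr)

/-- The sum of conjugates is central, so it acts on `c` by a scalar, namely the coefficient at the
identity of `conjSum c * c`. Averaging that coefficient over translates reduces it to the
coefficient of `c³ = h² c`. -/
theorem conjSum_mul : conjSum c * c = (coef 1 (c * c) ^ 2) • c := by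
  have hne := hc.hook_ne_zero
  set h := coef 1 (c * c) with hh
  have h1 : conjSum c * c = coef 1 (conjSum c * c) • c := by
    have h2 : h • (conjSum c * c) = c * conjSum c * c := by
      rw [← mul_smul_comm, ← hc.mul_self, (commute_conjSum c c).eq, mul_assoc]
    have h3 : conjSum c * c = h⁻¹ • (c * conjSum c * c) := by
      rw [← h2, smul_smul, inv_mul_cancel₀ hne, one_smul]
    obtain ⟨s, hs⟩ := hc.exists_smul (conjSum c)
    rw [h3, hs, smul_smul, map_smul, hc.coef_one, smul_eq_mul, mul_one]
  rw [h1]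
  congr 1
  have hN : ((Fintype.card (Perm (Fin n)) : ℕ) : ℂ) ≠ 0 := Nat.cast_ne_zero.2 Fintype.card_ne_zero
  refine mul_left_cancel₀ hN ?_
  -- By centrality all the summands are equal.
  have e1 : ∑ x : Perm (Fin n), coef x (conjSum c * perm x * c) =
      (Fintype.card (Perm (Fin n)) : ℂ) * coef 1 (conjSum c * c) := by
    rw [Finset.sum_congr rfl (g := fun _ => coef 1 (conjSum c * c)), Finset.sum_const,
      nsmul_eq_mul, Finset.card_univ]
    intro x _
    rw [← (commute_conjSum c (perm x)).eq, mul_assoc, coef_perm_mul, inv_mul_cancel]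
  -- Since `c x c` is its coefficient at the identity times `c`, the summand is that coefficient
  -- times the coefficient of `c` at `x`; this is what expanding the middle factor of `c³` yields.
  have e2 : ∑ x : Perm (Fin n), coef x (c * perm x * c) = h ^ 2 := by
    have e3 : c * c * c = h ^ 2 • c := by
      have hs : c * c = h • c := hc.mul_self
      rw [hs, smul_mul_assoc, hs, smul_smul, pow_two]
    have e4 : c * c * c = ∑ x, coef x c • (c * perm x * c) := by
      conv_lhs => enter [1, 2]; rw [eq_sum_coef c]
      simp only [Finset.mul_sum, Finset.sum_mul, mul_smul_comm, smul_mul_assoc]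
    have e5 := congrArg (coef 1) (e4.symm.trans e3)
    rw [map_smul, hc.coef_one, smul_eq_mul, mul_one] at e5
    rw [← e5, map_sum]
    refine Finset.sum_congr rfl fun x _ => ?_
    rw [hc.mul_mul, map_smul, map_smul, map_smul, smul_eq_mul, smul_eq_mul, smul_eq_mul,
      hc.coef_one, mul_one, mul_comm]
  rw [← e1, ← e2]
  -- After the substitution `x ↦ g⁻¹ x` the contribution of each conjugate `g c g⁻¹` no longer
  -- depends on `g`.
  simp only [conjSum_apply, Finset.sum_mul, map_sum]
  rw [Finset.sum_comm, Finset.sum_congr rfl (g := fun _ => ∑ x, coef x (c * perm x * c)),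
    Finset.sum_const, nsmul_eq_mul, Finset.card_univ]
  intro g _
  refine Fintype.sum_equiv (Equiv.mulLeft g⁻¹) _ _ fun x => ?_
  rw [Equiv.coe_mulLeft, perm_mul, mul_assoc, mul_assoc, mul_assoc, coef_perm_mul]
  simp only [mul_assoc]

/-- The trace of `σ` on the left ideal generated by `c`. -/
theorem trace_lsmul (σ : Perm (Fin n)) :
    LinearMap.trace ℂ (Ideal.span {c}) (Algebra.lsmul ℂ ℂ (Ideal.span {c} : Ideal (GA n)) (perm σ)) =
      (coef 1 (c * c))⁻¹ * coef σ⁻¹ (conjSum c) := by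
  have hne := hc.hook_ne_zero
  set h := coef 1 (c * c) with hh
  set V : Submodule ℂ (GA n) := (Ideal.span {c} : Ideal (GA n)).restrictScalars ℂ with hV
  -- Since `c² = h c`, the map `x ↦ h⁻¹ x c` is a projection of the group algebra onto the left
  -- ideal. By cyclicity the trace on the ideal becomes a trace on the whole algebra, where the
  -- permutations are a basis.
  let q : GA n →ₗ[ℂ] V := LinearMap.codRestrict V (h⁻¹ • LinearMap.mulRight ℂ c) fun x => by
    rw [LinearMap.smul_apply, LinearMap.mulRight_apply, ← mul_smul_comm, hV,
      Submodule.restrictScalars_mem, mul_smul_comm, ← smul_mul_assoc]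
    exact Ideal.mul_mem_left _ _ (Ideal.subset_span rfl)
  have hq : ∀ v : V, h⁻¹ • ((v : GA n) * c) = v := fun v => by
    obtain ⟨x, hx⟩ := Ideal.mem_span_singleton'.1 v.2
    rw [← hx, mul_assoc, hc.mul_self, mul_smul_comm, smul_smul, inv_mul_cancel₀ hne, one_smul]
  have e : (Algebra.lsmul ℂ ℂ (Ideal.span {c} : Ideal (GA n)) (perm σ) : V →ₗ[ℂ] V) =
      q ∘ₗ (LinearMap.mulLeft ℂ (perm σ) ∘ₗ V.subtype) := by
    refine LinearMap.ext fun v => Subtype.ext ?_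
    change perm σ * (v : GA n) = h⁻¹ • ((perm σ * (v : GA n)) * c)
    conv_lhs => rw [← hq v]
    rw [mul_smul_comm, mul_assoc]
  change LinearMap.trace ℂ V _ = _
  rw [e, LinearMap.trace_comp_comm', trace_ga, coef_conjSum, Finset.mul_sum]
  refine Finset.sum_congr rfl fun g _ => ?_
  change coef g (perm σ * (h⁻¹ • (perm g * c))) = _
  rw [mul_smul_comm, map_smul, smul_eq_mul, coef_perm_mul, coef_perm_mul, mul_assoc]

end IsQuasiPrimitive

end JMBrauer

end

/-! ### Tableau symmetrizers and central idempotents. -/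

noncomputable section

namespace JMBrauer

open Equiv (Perm swap)

variable {n : ℕ}

/-- The row symmetrizer of the filling `t`. -/
abbrev rowT (t : Fin n → ℕ × ℕ) : GA n := rowSym fun k => (t k).1

/-- The column antisymmetrizer of the filling `t`. -/
abbrev colT (t : Fin n → ℕ × ℕ) : GA n := colSym fun k => (t k).2

theorem perm_mul_rowT (t : Fin n → ℕ × ℕ) (g : Perm (Fin n)) :
    perm g * rowT (t ∘ g) = rowT t * perm g :=
  perm_mul_levelSym_mul 1 (fun k => (t k).1) g

theorem perm_mul_colT (t : Fin n → ℕ × ℕ) (g : Perm (Fin n)) :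
    perm g * colT (t ∘ g) = colT t * perm g :=
  perm_mul_levelSym_mul Equiv.Perm.sign (fun k => (t k).2) g

theorem Shape.youngSymmetrizer_eq (μ : Shape n) :
    μ.youngSymmetrizer = rowT μ.cellOf * colT μ.cellOf := by
  rw [Shape.youngSymmetrizer]
  congr 1
  simp only [rowT, levelSym, MonoidHom.one_apply, Units.val_one, Int.cast_one, one_smul]

/-- Von Neumann's lemma. For `x = g`, either two points share a row of `t ∘ g⁻¹` and a column of
`t`, and the product vanishes; or these rows and columns form a tableau `t ∘ c` of the same shape,
and then `g = c⁻¹ (c g)` with `c` preserving columns and `c g` preserving rows, so both factors are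
absorbed. -/
theorem IsTableau.colT_mul_mul_rowT {μ : Shape n} {t : Fin n → ℕ × ℕ} (ht : IsTableau μ t)
    (x : GA n) : ∃ s : ℂ, colT t * x * rowT t = s • (colT t * rowT t) := by
  induction x using ga_induction with
  | hp g =>
    have ht' := ht.comp_perm g⁻¹
    have hg : perm g * rowT t = rowT (t ∘ ⇑g⁻¹) * perm g := by
      rw [← perm_mul_rowT]
      congr 2
      ext k <;> simp
    by_cases hinj : ∀ x y, ((t ∘ ⇑g⁻¹) x).1 = ((t ∘ ⇑g⁻¹) y).1 → (t x).2 = (t y).2 → x = y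
    · have hmem := (ht'.weight_le hinj).2 (by
        rw [ht'.sum_comp (fun c => c.2), ← ht.sum_comp (fun c => c.2)])
      have hs : IsTableau μ fun k => (((t ∘ ⇑g⁻¹) k).1, (t k).2) :=
        ⟨fun x y h => hinj x y (Prod.ext_iff.1 h).1 (Prod.ext_iff.1 h).2, hmem⟩
      obtain ⟨c, hc⟩ := ht.exists_perm hs
      have hc2 : ∀ k, (t (c k)).2 = (t k).2 := fun k => (Prod.ext_iff.1 (congrFun hc k)).2
      have hc1 : ∀ k, (t (c k)).1 = (t (g⁻¹ k)).1 := fun k => (Prod.ext_iff.1 (congrFun hc k)).1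
      have hc2' : ∀ k, (t (c⁻¹ k)).2 = (t k).2 := fun k => by
        rw [← hc2, perm_apply_inv_self]
      have hr : ∀ k, (t ((c * g) k)).1 = (t k).1 := fun k => by
        rw [Equiv.Perm.mul_apply, hc1, perm_inv_apply_self]
      refine ⟨((Equiv.Perm.sign c⁻¹ : ℤ) : ℂ), ?_⟩
      have e : g = c⁻¹ * (c * g) := by group
      rw [e, perm_mul, ← mul_assoc, levelSym_mul_perm _ hc2', mul_assoc, perm_mul_levelSym _ hr,
        smul_mul_assoc]
      simp
    · push Not at hinj
      obtain ⟨x, y, h1, h2, h3⟩ := hinj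
      refine ⟨0, ?_⟩
      rw [mul_assoc, hg, ← mul_assoc, colSym_mul_rowSym_eq_zero h3 h1 h2, zero_mul, zero_smul]
  | ha x y hx hy =>
    obtain ⟨s, hs⟩ := hx
    obtain ⟨s', hs'⟩ := hy
    exact ⟨s + s', by rw [mul_add, add_mul, hs, hs', add_smul]⟩
  | hs r x hx =>
    obtain ⟨s, hs⟩ := hx
    exact ⟨r * s, by rw [mul_smul_comm, smul_mul_assoc, hs, smul_smul]⟩

/-- Only the identity preserves both the rows and the columns of a tableau. -/
theorem IsTableau.coef_one_colT_mul_rowT {μ : Shape n} {t : Fin n → ℕ × ℕ} (ht : IsTableau μ t) :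
    coef 1 (colT t * rowT t) = 1 := by
  rw [coef_one_mul, Finset.sum_eq_single 1]
  · simp [coef_levelSym]
  · intro σ _ hσ
    rw [coef_levelSym, coef_levelSym]
    by_cases h1 : ∀ k, (t (σ k)).2 = (t k).2
    · by_cases h2 : ∀ k, (t (σ⁻¹ k)).1 = (t k).1
      · refine absurd (Equiv.ext fun k => ?_) hσ
        refine ht.1 (Prod.ext ?_ (h1 k))
        rw [← h2, perm_inv_apply_self]
        rfl
      · rw [if_neg h2, mul_zero]
    · rw [if_neg h1, zero_mul]
  · simp

theorem IsTableau.isQuasiPrimitive {μ : Shape n} {t : Fin n → ℕ × ℕ} (ht : IsTableau μ t) :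
    IsQuasiPrimitive (colT t * rowT t) where
  coef_one := ht.coef_one_colT_mul_rowT
  exists_smul x := by
    obtain ⟨s, hs⟩ := ht.colT_mul_mul_rowT (rowT t * x * colT t)
    refine ⟨s, ?_⟩
    rw [← hs]
    simp only [mul_assoc]

theorem coef_one_flip (x : GA n) : coef 1 (flip x) = coef 1 x := by
  induction x using ga_induction with
  | hp σ => simp
  | ha x y hx hy => rw [map_add, map_add, map_add, hx, hy]
  | hs r x hx => rw [map_smul, map_smul, map_smul, hx]

theorem flip_flip (x : GA n) : flip (flip x) = x := by
  induction x using ga_induction with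
  | hp σ => simp
  | ha x y hx hy => rw [map_add, map_add, hx, hy]
  | hs r x hx => rw [map_smul, map_smul, hx]

/-- The inversion of permutations exchanges `b a` and `a b`. The Specht modules are generated by `a
b`, whereas the Jucys-Murphy elements are diagonal on `b a`. -/
theorem IsTableau.isQuasiPrimitive' {μ : Shape n} {t : Fin n → ℕ × ℕ} (ht : IsTableau μ t) :
    IsQuasiPrimitive (rowT t * colT t) where
  coef_one := by
    rw [← coef_one_flip, flip_mul, flip_levelSym, flip_levelSym]
    exact ht.coef_one_colT_mul_rowT
  exists_smul x := by
    obtain ⟨s, hs⟩ := ht.isQuasiPrimitive.exists_smul (flip x)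
    refine ⟨s, ?_⟩
    have := congrArg flip hs
    simpa only [flip_mul, flip_flip, map_smul, flip_levelSym, mul_assoc] using this

theorem conjSum_conj (x : GA n) (g : Perm (Fin n)) :
    conjSum (perm g * x * perm g⁻¹) = conjSum x := by
  rw [conjSum_mul_comm, ← mul_assoc, ← perm_mul, inv_mul_cancel, perm_one, one_mul]

/-- `conjSum (b a)` depends only on the shape of the tableau. -/
theorem IsTableau.conjSum_eq {μ : Shape n} {t u : Fin n → ℕ × ℕ} (ht : IsTableau μ t)
    (hu : IsTableau μ u) : conjSum (colT t * rowT t) = conjSum (colT u * rowT u) := by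
  obtain ⟨g, rfl⟩ := ht.exists_perm hu
  rw [← conjSum_conj (colT (t ∘ g) * rowT (t ∘ g)) g]
  congr 1
  rw [← mul_assoc, perm_mul_colT, mul_assoc (colT t), perm_mul_rowT, mul_assoc, mul_assoc,
    ← perm_mul, mul_inv_cancel, perm_one, mul_one]

theorem factorial_eq_card : (n.factorial : ℂ) = (Fintype.card (Perm (Fin n)) : ℂ) := by
  rw [Fintype.card_perm, Fintype.card_fin]

/-- `𝒫_μ` is a multiple of the sum of the conjugates of the Young symmetrizer. -/
theorem Shape.proj_eq (μ : Shape n) : μ.proj =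
    ((coef 1 (μ.youngSymmetrizer * μ.youngSymmetrizer))⁻¹) ^ 2 • conjSum μ.youngSymmetrizer := by
  have hc : IsQuasiPrimitive μ.youngSymmetrizer := by
    rw [μ.youngSymmetrizer_eq]
    exact μ.isTableau_cellOf.isQuasiPrimitive'
  have hchar : ∀ σ, μ.character σ = (coef 1 (μ.youngSymmetrizer * μ.youngSymmetrizer))⁻¹ *
      coef σ⁻¹ (conjSum μ.youngSymmetrizer) := fun σ => hc.trace_lsmul σ
  -- The character at the identity: each of the `n!` conjugates of the symmetrizer has coefficient
  -- `1` there.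
  have hdim : (Module.finrank ℂ μ.specht : ℂ) =
      (coef 1 (μ.youngSymmetrizer * μ.youngSymmetrizer))⁻¹ * n.factorial := by
    have h1 := hchar 1
    have h2 : μ.character 1 = (Module.finrank ℂ μ.specht : ℂ) := by
      rw [Shape.character, perm_one, map_one]
      exact LinearMap.trace_one ℂ (μ.specht.restrictScalars ℂ)
    rw [← h2, h1, inv_one, coef_conjSum]
    congr 1
    rw [Finset.sum_congr rfl (g := fun _ => 1)]
    · rw [Finset.sum_const, nsmul_eq_mul, mul_one, factorial_eq_card, Finset.card_univ]
    · intro g _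
      rw [mul_one, inv_mul_cancel, hc.coef_one]
  have hf : (n.factorial : ℂ) ≠ 0 := Nat.cast_ne_zero.2 n.factorial_ne_zero
  rw [Shape.proj, hdim, mul_div_assoc, div_self hf, mul_one, pow_two, mul_smul]
  congr 1
  conv_rhs => rw [eq_sum_coef (conjSum μ.youngSymmetrizer), Finset.smul_sum]
  refine Finset.sum_congr rfl fun σ _ => ?_
  rw [hchar, inv_inv, smul_smul]

/-- This frees `𝒫_μ` from the filling chosen in its definition: `conjSum` takes the same value on `a
b` and `b a`, and is insensitive to relabelling the points. -/
theorem Shape.exists_proj_eq (μ : Shape n) : ∃ s : ℂ, s ≠ 0 ∧ ∀ t, IsTableau μ t →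
    μ.proj = s • conjSum (colT t * rowT t) := by
  have hc : IsQuasiPrimitive μ.youngSymmetrizer := by
    rw [μ.youngSymmetrizer_eq]
    exact μ.isTableau_cellOf.isQuasiPrimitive'
  refine ⟨_, pow_ne_zero 2 (inv_ne_zero hc.hook_ne_zero), fun t ht => ?_⟩
  rw [μ.proj_eq]
  congr 1
  rw [μ.youngSymmetrizer_eq, conjSum_mul_comm, ht.conjSum_eq μ.isTableau_cellOf]

theorem Shape.commute_proj (μ : Shape n) (y : GA n) : Commute y μ.proj := by
  rw [μ.proj_eq]
  exact (commute_conjSum _ _).smul_right _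

theorem Shape.proj_mul_young (μ : Shape n) :
    μ.proj * μ.youngSymmetrizer = μ.youngSymmetrizer := by
  have hc : IsQuasiPrimitive μ.youngSymmetrizer := by
    rw [μ.youngSymmetrizer_eq]
    exact μ.isTableau_cellOf.isQuasiPrimitive'
  rw [μ.proj_eq, smul_mul_assoc, hc.conjSum_mul, smul_smul, ← mul_pow,
    inv_mul_cancel₀ hc.hook_ne_zero, one_pow, one_smul]

theorem Shape.proj_mul_conjSum (μ : Shape n) :
    μ.proj * conjSum μ.youngSymmetrizer = conjSum μ.youngSymmetrizer := by
  rw [mul_conjSum fun g => μ.commute_proj _, μ.proj_mul_young]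

theorem Shape.proj_mul_self (μ : Shape n) : μ.proj * μ.proj = μ.proj := by
  conv_lhs => enter [2]; rw [μ.proj_eq]
  rw [mul_smul_comm, μ.proj_mul_conjSum, ← μ.proj_eq]

theorem IsTableau.proj_mul {μ : Shape n} {t : Fin n → ℕ × ℕ} (ht : IsTableau μ t) :
    μ.proj * (colT t * rowT t) = colT t * rowT t := by
  have hc := ht.isQuasiPrimitive
  obtain ⟨s, hs0, hs⟩ := μ.exists_proj_eq
  have h1 : μ.proj * (colT t * rowT t) =
      (s * coef 1 (colT t * rowT t * (colT t * rowT t)) ^ 2) • (colT t * rowT t) := by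
    rw [hs t ht, smul_mul_assoc, hc.conjSum_mul, smul_smul]
  set r := s * coef 1 (colT t * rowT t * (colT t * rowT t)) ^ 2 with hr
  have hr0 : r ≠ 0 := mul_ne_zero hs0 (pow_ne_zero 2 hc.hook_ne_zero)
  -- `𝒫_μ` acts on `b a` by a nonzero scalar `r`, and idempotence gives `r = r²`.
  have h2 : r • (colT t * rowT t) = (r * r) • (colT t * rowT t) := by
    rw [← h1]
    conv_lhs => rw [← μ.proj_mul_self, mul_assoc, h1, mul_smul_comm, h1, smul_smul]
  have h3 := congrArg (coef 1) h2
  rw [map_smul, map_smul, hc.coef_one, smul_eq_mul, smul_eq_mul, mul_one, mul_one] at h3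
  have h4 : r = 1 := by
    have := mul_left_cancel₀ hr0 ((mul_one r).trans h3)
    exact this.symm
  rw [h1, h4, one_smul]

theorem Shape.proj_ne_zero (μ : Shape n) : μ.proj ≠ 0 := fun h => by
  have h1 := μ.isTableau_cellOf.proj_mul
  rw [h, zero_mul] at h1
  exact μ.isTableau_cellOf.isQuasiPrimitive.ne_zero h1.symm

theorem conjSum_mul_conjSum_eq_zero {x y : GA n} (h : ∀ z, x * z * y = 0) :
    conjSum x * conjSum y = 0 := by
  rw [conjSum_apply, conjSum_apply, Finset.sum_mul]
  refine Finset.sum_eq_zero fun g _ => ?_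
  rw [Finset.mul_sum]
  refine Finset.sum_eq_zero fun g' _ => ?_
  have e : perm g * x * perm g⁻¹ * (perm g' * y * perm g'⁻¹) =
      perm g * (x * (perm g⁻¹ * perm g') * y) * perm g'⁻¹ := by simp only [mul_assoc]
  rw [e, h, mul_zero, zero_mul]

/-- The weight, the sum of the column indices, replaces the dominance order: being totally ordered,
it leaves only two cases for a pair of shapes, and these are exchanged because the idempotents are
central. -/
theorem Shape.proj_mul_proj_of_weight_le {μ ν : Shape n} (hne : μ ≠ ν)
    (hw : ∑ k, (ν.cellOf k).2 ≤ ∑ k, (μ.cellOf k).2) : μ.proj * ν.proj = 0 := by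
  obtain ⟨s, -, hs⟩ := μ.exists_proj_eq
  obtain ⟨s', -, hs'⟩ := ν.exists_proj_eq
  -- A lighter column filling is annihilated outright; at equal weights a nonzero product would
  -- force equal shapes.
  have key : ∀ z, rowT μ.cellOf * z * colT ν.cellOf = 0 := fun z => by
    rcases hw.lt_or_eq with h | h
    · exact μ.isTableau_cellOf.rowSym_mul_mul_colSym h z
    · by_contra h0
      refine hne (μ.isTableau_cellOf.shape_eq ν.isTableau_cellOf h (x := flip z) fun h1 => h0 ?_)
      have := congrArg flip h1
      rwa [flip_mul, flip_mul, flip_flip, flip_levelSym, flip_levelSym, map_zero,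
        ← mul_assoc] at this
  rw [hs _ μ.isTableau_cellOf, hs' _ ν.isTableau_cellOf, smul_mul_assoc, mul_smul_comm,
    conjSum_mul_conjSum_eq_zero, smul_zero, smul_zero]
  intro z
  have e : colT μ.cellOf * rowT μ.cellOf * z * (colT ν.cellOf * rowT ν.cellOf) =
      colT μ.cellOf * (rowT μ.cellOf * z * colT ν.cellOf) * rowT ν.cellOf := by
    simp only [mul_assoc]
  rw [e, key, mul_zero, zero_mul]

theorem Shape.proj_mul_proj {μ ν : Shape n} (hne : μ ≠ ν) : μ.proj * ν.proj = 0 := by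
  rcases le_total (∑ k, (ν.cellOf k).2) (∑ k, (μ.cellOf k).2) with h | h
  · exact proj_mul_proj_of_weight_le hne h
  · rw [(ν.commute_proj μ.proj).eq]
    exact proj_mul_proj_of_weight_le hne.symm h

/-- A central element acts on the isotypic component `μ` as it does on `b a`. -/
theorem IsTableau.mul_proj {μ : Shape n} {t : Fin n → ℕ × ℕ} (ht : IsTableau μ t) {y : GA n}
    (hy : ∀ g, Commute (perm g) y) {r : ℂ} (h : y * (colT t * rowT t) = r • (colT t * rowT t)) :
    y * μ.proj = r • μ.proj := by
  obtain ⟨s, -, hs⟩ := μ.exists_proj_eq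
  rw [hs t ht, mul_smul_comm, mul_conjSum hy, h, map_smul, smul_comm]

theorem IsTableau.map_proj_eq_zero {μ : Shape n} {t : Fin n → ℕ × ℕ} (ht : IsTableau μ t)
    {B : Type*} [Semiring B] [Algebra ℂ B] (F : GA n →ₐ[ℂ] B)
    (h : F (colT t) = 0 ∨ F (rowT t) = 0) : F μ.proj = 0 := by
  obtain ⟨s, -, hs⟩ := μ.exists_proj_eq
  rw [hs t ht, conjSum_apply, map_smul, map_sum, Finset.sum_eq_zero, smul_zero]
  intro g _
  rw [map_mul, map_mul, map_mul]
  rcases h with h | h <;> simp [h]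

end JMBrauer

end

noncomputable section

namespace JMBrauer

open Equiv (Perm swap)

variable {n : ℕ}

/-! ### Jucys-Murphy elements and contents -/

/-- Let `S` be the group preserving `κ` and fixing `k`. The group preserving the columns after `k`
is moved to column `j` contains `S`, with coset representatives `1` and the `(a k)`, `a` in column
`j`. The factor `S` is absorbed by `colSym κ`, which leaves `N = |S|`, and each `(a k)` contributes
its sign. -/
theorem colSym_update_mul_colSym {κ : Fin n → ℕ} {k : Fin n} {j : ℕ} (hj : κ k ≠ j) :
    ∃ N : ℂ, N ≠ 0 ∧ colSym (Function.update κ k j) * colSym κ =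
      N • (colSym κ - ∑ a : Fin n with κ a = j, perm (swap a k) * colSym κ) := by
  classical
  set S : Finset (Perm (Fin n)) := Finset.univ.filter fun σ => σ k = k ∧ ∀ x, κ (σ x) = κ x with hS
  set A : Finset (Fin n) := insert k (Finset.univ.filter fun a => κ a = j) with hA
  have hkA : k ∉ Finset.univ.filter fun a => κ a = j := by simpa using hj
  have hmemA : ∀ a, a ∈ A ↔ Function.update κ k j a = j := fun a => by
    by_cases h : a = k
    · simp [hA, h]
    · simp [hA, h]
  refine ⟨(S.card : ℂ), ?_, ?_⟩
  · exact Nat.cast_ne_zero.2 (Finset.card_ne_zero_of_mem (a := 1) (by simp [hS]))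
  have hsum : colSym (Function.update κ k j) =
      ∑ x ∈ A ×ˢ S, ((Equiv.Perm.sign (swap x.1 k * x.2) : ℤ) : ℂ) • perm (swap x.1 k * x.2) := by
    refine (Finset.sum_bij (fun x _ => swap x.1 k * x.2) ?_ ?_ ?_ ?_).symm
    · rintro ⟨a, s⟩ hx
      obtain ⟨ha, hs⟩ := Finset.mem_product.1 hx
      rw [hmemA] at ha
      simp only [hS, Finset.mem_filter_univ] at hs ⊢
      intro x
      simp only [Equiv.Perm.mul_apply]
      have hu : ∀ y, Function.update κ k j (swap a k y) = Function.update κ k j y := fun y => by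
        by_cases h1 : y = a
        · rw [h1, Equiv.swap_apply_left, ha, Function.update_self]
        by_cases h2 : y = k
        · rw [h2, Equiv.swap_apply_right, ha, Function.update_self]
        rw [Equiv.swap_apply_of_ne_of_ne h1 h2]
      rw [hu]
      by_cases hx : x = k
      · rw [hx, hs.1]
      · have : s x ≠ k := fun h => hx (s.injective (h.trans hs.1.symm))
        rw [Function.update_of_ne this, Function.update_of_ne hx, hs.2]
    · rintro ⟨a, s⟩ hx ⟨a', s'⟩ hx' h
      obtain ⟨-, hs⟩ := Finset.mem_product.1 hx
      obtain ⟨-, hs'⟩ := Finset.mem_product.1 hx'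
      simp only [hS, Finset.mem_filter_univ] at hs hs' h
      have h1 := congrFun (congrArg (fun σ : Perm (Fin n) => (σ : Fin n → Fin n)) h) k
      simp only [Equiv.Perm.mul_apply, hs.1, hs'.1, Equiv.swap_apply_right] at h1
      subst h1
      rw [mul_left_cancel h]
    · intro σ hσ
      simp only [Finset.mem_filter_univ] at hσ
      -- The coset of `σ` is determined by the image of `k`.
      have hσk : Function.update κ k j (σ k) = j := by rw [hσ, Function.update_self]
      refine ⟨(σ k, swap (σ k) k * σ), Finset.mem_product.2 ⟨(hmemA _).2 hσk, ?_⟩, ?_⟩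
      · simp only [hS, Finset.mem_filter_univ, Equiv.Perm.mul_apply, Equiv.swap_apply_left,
          true_and]
        intro x
        by_cases hx : x = k
        · rw [hx, Equiv.swap_apply_left]
        have h1 : σ x ≠ σ k := fun h => hx (σ.injective h)
        by_cases h2 : σ x = k
        · rw [h2, Equiv.swap_apply_right]
          have h3 : σ k ≠ k := fun h => h1 (h2.trans h.symm)
          have h4 := hσ x
          rw [h2, Function.update_self, Function.update_of_ne hx] at h4
          rw [Function.update_of_ne h3] at hσk
          rw [hσk, h4]
        · rw [Equiv.swap_apply_of_ne_of_ne h1 h2]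
          have h4 := hσ x
          rwa [Function.update_of_ne h2, Function.update_of_ne hx] at h4
      · rw [← mul_assoc, Equiv.swap_mul_self, one_mul]
    · intro x _
      rfl
  have hterm : ∀ a, ∑ s ∈ S, ((Equiv.Perm.sign (swap a k * s) : ℤ) : ℂ) •
      perm (swap a k * s) * colSym κ =
        (S.card : ℂ) • ((Equiv.Perm.sign (swap a k) : ℤ) : ℂ) • (perm (swap a k) * colSym κ) := by
    intro a
    rw [Finset.sum_congr rfl (g := fun _ => ((Equiv.Perm.sign (swap a k) : ℤ) : ℂ) •
      (perm (swap a k) * colSym κ)), Finset.sum_const, Nat.cast_smul_eq_nsmul]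
    intro s hs
    rw [smul_mul_assoc, perm_mul, mul_assoc,
      perm_mul_levelSym _ ((Finset.mem_filter_univ s).1 hs).2, mul_smul_comm, smul_smul, map_mul,
      Units.val_mul, Int.cast_mul, mul_assoc, unit_cast_mul_self, mul_one]
  rw [hsum, Finset.sum_mul, Finset.sum_product, Finset.sum_congr rfl fun a _ => hterm a,
    ← Finset.smul_sum, hA, Finset.sum_insert hkA, Equiv.swap_self]
  congr 1
  rw [sub_eq_add_neg, ← Finset.sum_neg_distrib]
  congr 1
  · rw [← Equiv.Perm.one_def, map_one, perm_one, one_mul, Units.val_one, Int.cast_one, one_smul]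
  · refine Finset.sum_congr rfl fun a ha => ?_
    have hne : a ≠ k := fun h => hkA (h ▸ ha)
    rw [Equiv.Perm.sign_swap hne]
    simp

/-- Garnir relation. Moving `k` to a column further left makes the filling lighter than the tableau,
so its antisymmetrizer annihilates `b a`; expanding it over cosets of the old column group gives the
identity. -/
theorem IsTableau.garnir {μ : Shape n} {t : Fin n → ℕ × ℕ} (ht : IsTableau μ t) {k : Fin n} {j : ℕ}
    (hj : j < (t k).2) :
    ∑ a : Fin n with (t a).2 = j, perm (swap a k) * (colT t * rowT t) = colT t * rowT t := by
  obtain ⟨N, hN, h⟩ := colSym_update_mul_colSym (κ := fun k => (t k).2) (k := k) hj.ne'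
  have hw : ∑ x, Function.update (fun k => (t k).2) k j x < ∑ x, (t x).2 := by
    refine Finset.sum_lt_sum (fun x _ => ?_) ⟨k, Finset.mem_univ k, by simpa using hj⟩
    by_cases hx : x = k
    · rw [hx, Function.update_self]
      exact hj.le
    · rw [Function.update_of_ne hx]
  have h0 := ht.colSym_mul_mul_rowSym hw (colT t)
  rw [h, smul_mul_assoc, sub_mul, Finset.sum_mul] at h0
  have h1 := sub_eq_zero.1 ((smul_eq_zero.1 h0).resolve_left hN)
  simp only [mul_assoc] at h1
  exact h1.symm

/-- Columns are counted from `0`, so there are `(t k).2` of them to the left of `k`, and each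
contributes `b a` once by the Garnir relation. -/
theorem IsTableau.sum_left {μ : Shape n} {t : Fin n → ℕ × ℕ} (ht : IsTableau μ t) (k : Fin n) :
    ∑ a : Fin n with (t a).2 < (t k).2, perm (swap a k) * (colT t * rowT t) =
      ((t k).2 : ℂ) • (colT t * rowT t) := by
  have h := Finset.sum_fiberwise_of_maps_to
    (s := Finset.univ.filter fun a : Fin n => (t a).2 < (t k).2) (t := Finset.range (t k).2)
    (g := fun a => (t a).2) (fun a ha => by simpa using ha)
    (fun a => perm (swap a k) * (colT t * rowT t))
  rw [← h, Finset.sum_congr rfl (g := fun _ => colT t * rowT t), Finset.sum_const,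
    Finset.card_range, Nat.cast_smul_eq_nsmul]
  intro j hj
  rw [Finset.mem_range] at hj
  rw [Finset.filter_filter, ← ht.garnir hj]
  refine Finset.sum_congr (Finset.filter_congr fun a _ => ?_) fun _ _ => by rw [ht.garnir hj]
  exact ⟨fun h => h.2, fun h => ⟨by omega, h⟩⟩

theorem IsTableau.card_above {μ : Shape n} {t : Fin n → ℕ × ℕ} (ht : IsTableau μ t) (k : Fin n) :
    (Finset.univ.filter fun a : Fin n => (t a).2 = (t k).2 ∧ (t a).1 < (t k).1).card =
      (t k).1 := by
  have h0 := Finset.card_image_of_injective (Finset.range (t k).1) (f := fun i => (i, (t k).2))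
    fun i i' h => (Prod.ext_iff.1 h).1
  rw [Finset.card_range] at h0
  refine (Finset.card_image_of_injective _ ht.1).symm.trans (Eq.trans ?_ h0)
  congr 1
  ext c
  simp only [Finset.mem_image, Finset.mem_filter_univ, Finset.mem_range]
  constructor
  · rintro ⟨a, ⟨h1, h2⟩, rfl⟩
    exact ⟨(t a).1, h2, Prod.ext rfl h1.symm⟩
  · rintro ⟨i, hi, rfl⟩
    obtain ⟨a, ha⟩ := ht.exists_eq (c := (i, (t k).2))
      (μ.1.up_left_mem hi.le le_rfl (ht.2 k))
    exact ⟨a, by rw [ha]; exact ⟨rfl, hi⟩, ha⟩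

theorem IsTableau.sum_above {μ : Shape n} {t : Fin n → ℕ × ℕ} (ht : IsTableau μ t) (k : Fin n) :
    ∑ a : Fin n with (t a).2 = (t k).2 ∧ (t a).1 < (t k).1,
      perm (swap a k) * (colT t * rowT t) = -((t k).1 : ℂ) • (colT t * rowT t) := by
  rw [Finset.sum_congr rfl (g := fun _ => -(colT t * rowT t)), Finset.sum_const, ht.card_above,
    ← Nat.cast_smul_eq_nsmul ℂ, smul_neg, neg_smul]
  intro a ha
  obtain ⟨h1, h2⟩ := (Finset.mem_filter_univ a).1 ha
  rw [← mul_assoc, swap_mul_colSym (by rintro rfl; exact lt_irrefl _ h2) h1, neg_mul]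

/-- The Jucys-Murphy element attached to the point `k`. -/
def jm (k : Fin n) : GA n := ∑ a : Fin n with a < k, perm (swap a k)

theorem jucysMurphy_eq {i : ℕ} (h : i < n) : jucysMurphy n (i + 1) = jm ⟨i, h⟩ := by
  rw [jucysMurphy, Finset.sum_eq_single ⟨i, h⟩]
  · rfl
  · intro b hb hne
    refine absurd (Fin.ext ?_) hne
    simpa using hb
  · simp

/-- The columns of `t` are filled one after the other. -/
def IsColumnReading (t : Fin n → ℕ × ℕ) : Prop :=
  ∀ a k, a < k ↔ (t a).2 < (t k).2 ∨ ((t a).2 = (t k).2 ∧ (t a).1 < (t k).1)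

/-- The cells are enumerated in the lexicographic order of (column, row). -/
theorem Shape.exists_columnReading (μ : Shape n) : ∃ t, IsTableau μ t ∧ IsColumnReading t := by
  let s : Finset (ℕ ×ₗ ℕ) := μ.1.cells.map
    ((Equiv.prodComm ℕ ℕ).trans toLex).toEmbedding
  have hs : s.card = n := by rw [Finset.card_map]; exact μ.2
  have hmem : ∀ k, s.orderEmbOfFin hs k ∈ s := fun k => Finset.orderEmbOfFin_mem _ _ _
  refine ⟨fun k => (ofLex (s.orderEmbOfFin hs k)).swap, ⟨fun x y h => ?_, fun k => ?_⟩,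
    fun a k => ?_⟩
  · exact (s.orderEmbOfFin hs).injective (ofLex.injective (Prod.swap_injective h))
  · obtain ⟨c, hc, hc'⟩ := Finset.mem_map.1 (hmem k)
    change (ofLex (s.orderEmbOfFin hs k)).swap ∈ μ.1.cells
    rw [← hc']
    exact hc
  · rw [← (s.orderEmbOfFin hs).lt_iff_lt, Prod.Lex.lt_iff]
    rfl

/-- In a column reading the points before `k` are those in the columns to the left, which contribute
the column index, and those above `k` in its column, each contributing `-1` by antisymmetry. No
standard basis is needed: `b a` is a common eigenvector. -/
theorem IsTableau.jm_mul {μ : Shape n} {t : Fin n → ℕ × ℕ} (ht : IsTableau μ t)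
    (hr : IsColumnReading t) (k : Fin n) :
    jm k * (colT t * rowT t) = (((t k).2 : ℂ) - (t k).1) • (colT t * rowT t) := by
  have hd : Finset.univ.filter (fun a : Fin n => a < k) =
      Finset.univ.filter (fun a => (t a).2 < (t k).2) ∪
        Finset.univ.filter (fun a => (t a).2 = (t k).2 ∧ (t a).1 < (t k).1) := by
    rw [← Finset.filter_or]
    exact Finset.filter_congr fun a _ => hr a k
  rw [jm, Finset.sum_mul, hd, Finset.sum_union, ht.sum_left, ht.sum_above, sub_smul, neg_smul,
    sub_eq_add_neg]
  exact Finset.disjoint_filter.2 fun a _ h1 h2 => h1.ne h2.1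

theorem transpositionSum_univ : transpositionSum (Finset.univ : Finset (Fin n)) = ∑ k, jm k := rfl

/-- The sum of the contents of the cells of `μ`. -/
def Shape.content (μ : Shape n) : ℂ := ∑ c ∈ μ.1.cells, ((c.2 : ℂ) - c.1)

theorem perm_conj_swap (g : Perm (Fin n)) (a b : Fin n) :
    perm g * perm (swap a b) = perm (swap (g a) (g b)) * perm g := by
  rw [← perm_mul, ← perm_mul, Equiv.mul_swap_eq_swap_mul]

/-- The doubled sum does not refer to the order of the points, so conjugation merely permutes its
terms; this is how centrality is obtained. -/
theorem two_smul_sum_jm : (2 : ℂ) • ∑ k : Fin n, jm k =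
    ∑ k, ∑ a with a ≠ k, perm (swap a k) := by
  have h1 : ∑ k : Fin n, jm k = ∑ k, ∑ a with k < a, perm (swap a k) := by
    simp only [jm, Finset.sum_filter]
    rw [Finset.sum_comm]
    simp only [Equiv.swap_comm]
  rw [two_smul]
  nth_rw 2 [h1]
  rw [← Finset.sum_add_distrib]
  refine Finset.sum_congr rfl fun k _ => ?_
  rw [jm, ← Finset.sum_union (Finset.disjoint_filter.2 fun a _ h1 h2 => lt_asymm h1 h2),
    ← Finset.filter_or]
  exact Finset.sum_congr (Finset.filter_congr fun a _ => lt_or_lt_iff_ne) fun _ _ => rfl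

theorem perm_conj_star (g : Perm (Fin n)) (k : Fin n) :
    perm g * ∑ a with a ≠ k, perm (swap a k) =
      (∑ a with a ≠ g k, perm (swap a (g k))) * perm g := by
  rw [Finset.mul_sum, Finset.sum_mul]
  refine Finset.sum_bij (fun a _ => g a) (fun a ha => ?_) (fun _ _ _ _ h => g.injective h)
    (fun b hb => ⟨g.symm b, ?_, g.apply_symm_apply b⟩) (fun a _ => perm_conj_swap g a k)
  · simpa using ha
  · simp only [Finset.mem_filter_univ] at hb ⊢
    rintro rfl
    exact hb (g.apply_symm_apply b).symm

theorem commute_sum_jm (y : GA n) : Commute y (∑ k, jm k) := by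
  have h : ∀ g, Commute (perm g) ((2 : ℂ) • ∑ k : Fin n, jm k) := fun g => by
    rw [Commute, SemiconjBy, two_smul_sum_jm, Finset.mul_sum, Finset.sum_mul]
    exact Fintype.sum_equiv g _ _ fun k => perm_conj_star g k
  have h2 := (commute_of_perm h y).smul_right ((2 : ℂ)⁻¹)
  rwa [smul_smul, inv_mul_cancel₀ two_ne_zero, one_smul] at h2

theorem Shape.sum_jm_mul_proj (μ : Shape n) : (∑ k, jm k) * μ.proj = μ.content • μ.proj := by
  obtain ⟨t, ht, hr⟩ := μ.exists_columnReading
  refine ht.mul_proj (fun g => commute_sum_jm _) ?_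
  rw [Finset.sum_mul, Finset.sum_congr rfl fun k _ => ht.jm_mul hr k, ← Finset.sum_smul,
    ht.sum_comp (fun c => (c.2 : ℂ) - c.1), Shape.content]

end JMBrauer

end

noncomputable section

namespace JMBrauer

open Equiv (Perm swap)

variable {n : ℕ}

/-! ### Merging two classes of an equivalence relation -/

section Merge

variable {α : Type*}

open Classical in
/-- The equivalence relation obtained from `r` by merging the classes of `x` and `y`. -/
def merge (r : Setoid α) (x y : α) : Setoid α :=
  Setoid.ker fun u => if r u y then (Quotient.mk r x) else Quotient.mk r u

theorem le_merge (r : Setoid α) (x y : α) : r ≤ merge r x y := by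
  classical
  intro u v h
  have h1 : r u y ↔ r v y := ⟨fun h' => r.trans (r.symm h) h', fun h' => r.trans h h'⟩
  change (if _ then _ else _) = (if _ then _ else _)
  rw [Quotient.sound (s := r) h]
  simp only [h1]

theorem merge_rel (r : Setoid α) (x y : α) : merge r x y x y := by
  classical
  change (if _ then _ else _) = (if _ then _ else _)
  rw [if_pos (r.refl y)]
  split_ifs <;> rfl

theorem merge_le {r s : Setoid α} {x y : α} (h : r ≤ s) (hxy : s x y) : merge r x y ≤ s := by
  classical
  intro u v huv
  change (if _ then _ else _) = (if _ then _ else _) at huv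
  split_ifs at huv with h1 h2 h2
  · exact s.trans (h h1) (s.symm (h h2))
  · exact s.trans (s.trans (h h1) (s.symm hxy)) (h (Quotient.exact huv))
  · exact s.trans (h (Quotient.exact huv)) (s.trans hxy (s.symm (h h2)))
  · exact h (Quotient.exact huv)

theorem card_merge [Finite α] {r : Setoid α} {x y : α} (h : ¬r x y) :
    Nat.card (Quotient (merge r x y)) + 1 = Nat.card (Quotient r) := by
  classical
  have hr : Set.range (fun u => if r u y then (Quotient.mk r x) else Quotient.mk r u) =
      {Quotient.mk r y}ᶜ := by
    ext c
    rw [Set.mem_compl_singleton_iff]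
    constructor
    · rintro ⟨u, rfl⟩
      simp only
      split_ifs with hu
      · exact fun hc => h (Quotient.exact hc)
      · exact fun hc => hu (Quotient.exact hc)
    · induction c using Quotient.ind with
      | _ u =>
        intro hc
        exact ⟨u, if_neg fun hu => hc (Quotient.sound hu)⟩
  have e : Nat.card (Quotient (merge r x y)) = Nat.card _ :=
    Nat.card_congr (Setoid.quotientKerEquivRange _)
  rw [e, hr, Nat.card_coe_set_eq,
    Set.compl_eq_univ_sdiff, Set.ncard_sdiff_singleton_of_mem (Set.mem_univ _), Set.ncard_univ]
  have : Nonempty (Quotient r) := ⟨Quotient.mk r y⟩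
  have := Nat.card_pos (α := Quotient r)
  omega

end Merge

/-! ### Expansions of products of Jucys-Murphy elements -/

/-- The product `x (k - 1) ⋯ x 1 * x 0`. -/
def chain {A : Type*} [Monoid A] (x : ℕ → A) : ℕ → A
  | 0 => 1
  | k + 1 => x k * chain x k

/-- Going from `L k` to `L (k + 1)`, every element arises exactly once as `(a q) m`. The choice `a =
q` keeps the count `c` and brings the factor `z`; the other choices lower `c` by one and bring none.
The exponent `c m + k - p` records this, and the first conclusion ensures that its truncated
subtraction is a true one. The set `M` is later `𝔖_p` with the number of cycles, or the pair
partitions with the number of blocks of the join with `π₀`. -/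
theorem chain_expansion {M : Type*} [MulAction (Perm (Fin n)) M] (Φ : M → GA n)
    (hΦ : ∀ (σ : Perm (Fin n)) m, Φ (σ • m) = perm σ * Φ m) (c : M → ℕ) (L : ℕ → Finset M)
    (x : ℕ → GA n) (p : ℕ) (z : ℂ)
    (step : ∀ k < p, ∃ (q : Fin n) (S : Finset (Fin n)), q ∉ S ∧
      x k = z • 1 + ∑ a ∈ S, perm (swap a q) ∧
      Set.BijOn (fun y : Fin n × M => swap y.1 q • y.2) ↑(insert q S ×ˢ L k) ↑(L (k + 1)) ∧
      ∀ a ∈ S, ∀ m ∈ L k, c (swap a q • m) + 1 = c m)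
    (o : M) (hL : L 0 = {o}) (ho : c o = p) (k : ℕ) (hk : k ≤ p) :
    (∀ m ∈ L k, p ≤ c m + k) ∧ ∑ m ∈ L k, z ^ (c m + k - p) • Φ m = chain x k * Φ o := by
  induction k with
  | zero =>
    rw [hL]
    refine ⟨fun m hm => ?_, ?_⟩
    · rw [Finset.mem_singleton.1 hm, ho]
      exact le_rfl
    · simp [ho, chain]
  | succ k ih =>
    obtain ⟨ih1, ih2⟩ := ih (by omega)
    obtain ⟨q, S, hq, hx, hb, hc⟩ := step k (by omega)
    have hqq : ∀ m : M, swap q q • m = m := fun m => by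
      rw [Equiv.swap_self, ← Equiv.Perm.one_def, one_smul]
    constructor
    · intro m hm
      obtain ⟨⟨a, m'⟩, hy, rfl⟩ := hb.surjOn hm
      rw [Finset.mem_coe, Finset.mem_product, Finset.mem_insert] at hy
      obtain ⟨ha, hm'⟩ := hy
      have h1 := ih1 m' hm'
      rcases ha with rfl | ha
      · simp only [hqq]
        omega
      · have h2 := hc a ha m' hm'
        simp only at h1 h2 ⊢
        omega
    · have e : ∑ m ∈ L (k + 1), z ^ (c m + (k + 1) - p) • Φ m =
          ∑ y ∈ insert q S ×ˢ L k, z ^ (c (swap y.1 q • y.2) + (k + 1) - p) •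
            Φ (swap y.1 q • y.2) :=
        (Finset.sum_bij (fun y _ => swap y.1 q • y.2) (fun y hy => hb.mapsTo hy)
          (fun y hy y' hy' h => hb.injOn hy hy' h)
          (fun m hm => by
            obtain ⟨y, hy, h⟩ := hb.surjOn hm
            exact ⟨y, hy, h⟩) fun y _ => rfl).symm
      rw [e, Finset.sum_product, Finset.sum_insert hq, chain, hx, add_mul, add_mul, mul_assoc,
        ← ih2]
      congr 1
      · rw [smul_mul_assoc, one_mul, Finset.smul_sum]
        refine Finset.sum_congr rfl fun m hm => ?_
        have := ih1 m hm
        rw [hqq, smul_smul, ← pow_succ', show c m + (k + 1) - p = c m + k - p + 1 by omega]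
      · rw [mul_assoc, ← ih2, Finset.sum_mul]
        refine Finset.sum_congr rfl fun a ha => ?_
        rw [Finset.mul_sum]
        refine Finset.sum_congr rfl fun m hm => ?_
        have := hc a ha m hm
        rw [hΦ, mul_smul_comm, show c (swap a q • m) + (k + 1) - p = c m + k - p by omega]

theorem sameCycle_setoid_le {α : Type*} {σ : Perm α} {s : Setoid α} (h : ∀ u, s u (σ u)) :
    Equiv.Perm.SameCycle.setoid σ ≤ s := by
  rintro u v ⟨i, rfl⟩
  induction i using Int.induction_on with
  | zero => exact s.refl u
  | succ i ih =>
    rw [add_comm, zpow_add, zpow_one, Equiv.Perm.mul_apply]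
    exact s.trans ih (h _)
  | pred i ih =>
    refine s.trans ih (s.symm ?_)
    have := h ((σ ^ (-(i : ℤ) - 1)) u)
    rwa [← Equiv.Perm.mul_apply, ← zpow_one_add, add_sub_cancel] at this

/-- Multiplying by `(a k)` inserts the fixed point `k` into the cycle of `a`. -/
theorem sameCycle_swap_mul {α : Type*} [DecidableEq α] {σ : Perm α} {a k : α} (hk : σ k = k) :
    Equiv.Perm.SameCycle.setoid (swap a k * σ) = merge (Equiv.Perm.SameCycle.setoid σ) a k := by
  set s := Equiv.Perm.SameCycle.setoid (swap a k * σ) with hs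
  have hs1 : ∀ u, s u (swap a k (σ u)) := fun u => ⟨1, by rw [zpow_one, Equiv.Perm.mul_apply]⟩
  have hak : s a k := by
    have := hs1 k
    rw [hk, Equiv.swap_apply_right] at this
    exact s.symm this
  refine le_antisymm (sameCycle_setoid_le fun u => ?_) (merge_le (sameCycle_setoid_le fun u => ?_)
    hak)
  · have h1 : merge (Equiv.Perm.SameCycle.setoid σ) a k u (σ u) :=
      le_merge _ _ _ ⟨1, by rw [zpow_one]⟩
    rw [Equiv.Perm.mul_apply]
    refine (merge _ a k).trans h1 ?_
    have h2 := merge_rel (Equiv.Perm.SameCycle.setoid σ) a k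
    rw [Equiv.swap_apply_def]
    split_ifs with h h
    · rw [h]; exact h2
    · rw [h]; exact (merge _ a k).symm h2
    · exact (merge _ a k).refl _
  · have h1 := hs1 u
    refine s.trans h1 ?_
    rw [Equiv.swap_apply_def]
    split_ifs with h h
    · rw [h]; exact s.symm hak
    · rw [h]; exact hak
    · exact s.refl _

/-- `Ω(z) = (z + X_p) ⋯ (z + X_1)`. -/
theorem omegaElement_eq_chain (p : ℕ) (z : ℂ) :
    omegaElement p z = chain (fun k => z • 1 + jucysMurphy p (k + 1)) p := by
  classical
  -- Here `L k` is `𝔖_k`, the permutations fixing all points from `k` on, and the factor `(a k)` of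
  -- `σ ∈ 𝔖_{k+1}` is recovered from `a = σ k`.
  have h := (chain_expansion (M := Perm (Fin p)) (fun σ => perm σ) (fun σ τ => perm_mul σ τ)
    (fun σ => Nat.card (Quotient (Equiv.Perm.SameCycle.setoid σ)))
    (fun k => Finset.univ.filter fun σ => ∀ j : Fin p, k ≤ j.val → σ j = j)
    (fun k => z • 1 + jucysMurphy p (k + 1)) p z ?_ 1 ?_ ?_ p le_rfl).2
  · rw [perm_one, mul_one] at h
    rw [← h, omegaElement, Finset.filter_true_of_mem]
    · simp
    · intro σ _ j hj
      exact absurd j.2 (by omega)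
  · intro k hk
    have hlt : ∀ a : Fin p, a ∈ Finset.univ.filter (fun a => a < (⟨k, hk⟩ : Fin p)) ↔ a.val < k :=
      fun a => by rw [Finset.mem_filter_univ, Fin.lt_def]
    refine ⟨⟨k, hk⟩, Finset.univ.filter fun a => a < ⟨k, hk⟩, by simp, ?_, ⟨?_, ?_, ?_⟩, ?_⟩
    · rw [jucysMurphy_eq hk]
      rfl
    · rintro ⟨a, σ⟩ hy
      rw [Finset.mem_coe, Finset.mem_product, Finset.mem_insert, hlt, Finset.mem_filter_univ] at hy
      rw [Finset.mem_coe, Finset.mem_filter_univ]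
      intro j hj
      change (swap a ⟨k, hk⟩ * σ) j = j
      rw [Equiv.Perm.mul_apply, hy.2 j (by omega)]
      refine Equiv.swap_apply_of_ne_of_ne ?_ ?_
      · rintro rfl
        rcases hy.1 with h | h
        · simp only at h
          rw [h] at hj
          simp at hj
        · simp only at h
          omega
      · rintro rfl
        simp at hj
    · rintro ⟨a, σ⟩ hy ⟨a', σ'⟩ hy' h
      rw [Finset.mem_coe, Finset.mem_product, Finset.mem_filter_univ] at hy hy'
      simp only [smul_eq_mul] at h
      have h1 := congrArg (fun σ : Perm (Fin p) => σ ⟨k, hk⟩) h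
      simp only [Equiv.Perm.mul_apply] at h1
      rw [hy.2 _ le_rfl, hy'.2 _ le_rfl, Equiv.swap_apply_right, Equiv.swap_apply_right] at h1
      subst h1
      rw [mul_left_cancel h]
    · intro σ hσ
      rw [Finset.mem_coe, Finset.mem_filter_univ] at hσ
      have hle : (σ ⟨k, hk⟩).val ≤ k := by
        by_contra hlt'
        have h1 := hσ (σ ⟨k, hk⟩) (by omega)
        have h2 := congrArg Fin.val (σ.injective h1)
        simp only at h2
        omega
      refine ⟨(σ ⟨k, hk⟩, swap (σ ⟨k, hk⟩) ⟨k, hk⟩ * σ), ?_, ?_⟩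
      · rw [Finset.mem_coe, Finset.mem_product, Finset.mem_insert, hlt, Finset.mem_filter_univ,
          Fin.ext_iff]
        refine ⟨by simp only; omega, fun j hj => ?_⟩
        rw [Equiv.Perm.mul_apply]
        rcases hj.eq_or_lt with h | h
        · have : j = ⟨k, hk⟩ := Fin.ext h.symm
          rw [this, Equiv.swap_apply_left]
        · rw [hσ j h]
          refine Equiv.swap_apply_of_ne_of_ne ?_ ?_
          · rintro rfl
            omega
          · rintro rfl
            simp at h
      · simp only [smul_eq_mul]
        rw [← mul_assoc, Equiv.swap_mul_self, one_mul]
    · intro a ha σ hσ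
      rw [hlt] at ha
      rw [Finset.mem_filter_univ] at hσ
      have hk' := hσ ⟨k, hk⟩ le_rfl
      rw [smul_eq_mul, sameCycle_swap_mul hk', card_merge]
      -- The point `k` is alone in its cycle and `a < k`, so the two cycles are distinct and the
      -- merge loses exactly one.
      rintro ⟨i, hi⟩
      have h1 : (σ ^ (-i)) ⟨k, hk⟩ = ⟨k, hk⟩ := Equiv.Perm.zpow_apply_eq_self_of_apply_eq_self hk' _
      rw [← hi, ← Equiv.Perm.mul_apply, ← zpow_add, neg_add_cancel, zpow_zero,
        Equiv.Perm.one_apply, hi] at h1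
      rw [h1] at ha
      simp at ha
  · ext σ
    rw [Finset.mem_filter_univ, Finset.mem_singleton]
    constructor
    · exact fun h => Equiv.ext fun j => h j (Nat.zero_le _)
    · rintro rfl j -
      rfl
  · have hle : Equiv.Perm.SameCycle.setoid (1 : Perm (Fin p)) ≤ ⊥ :=
      sameCycle_setoid_le fun u => rfl
    have hb : Function.Bijective
        (Quotient.mk (Equiv.Perm.SameCycle.setoid (1 : Perm (Fin p)))) :=
      ⟨fun u v h => hle (Quotient.exact h), Quotient.mk_surjective⟩
    exact (Nat.card_congr (Equiv.ofBijective _ hb)).symm.trans (Nat.card_fin p)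

end JMBrauer

end

noncomputable section

namespace JMBrauer

open Equiv (Perm swap)

variable {n : ℕ}

/-! ### Averaging idempotents -/

section Avg

variable (K : Subgroup (Perm (Fin n)))

theorem card_subgroup_ne_zero : (Nat.card K : ℂ) ≠ 0 := Nat.cast_ne_zero.2 Nat.card_pos.ne'

theorem perm_mul_avg {σ : Perm (Fin n)} (h : σ ∈ K) : perm σ * avg K = avg K := by
  classical
  rw [avg, mul_smul_comm, Finset.mul_sum]
  congr 1
  refine Finset.sum_bij (fun τ _ => σ * τ) (fun τ hτ => ?_) (fun _ _ _ _ h => mul_left_cancel h)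
    (fun τ hτ => ⟨σ⁻¹ * τ, ?_, by simp⟩) (fun τ hτ => (perm_mul _ _).symm)
  · simp only [Finset.mem_filter_univ] at hτ ⊢
    exact K.mul_mem h hτ
  · simp only [Finset.mem_filter_univ] at hτ ⊢
    exact K.mul_mem (K.inv_mem h) hτ

theorem flip_avg : flip (avg K) = avg K := by
  classical
  rw [avg, map_smul, map_sum]
  congr 1
  refine Finset.sum_bij (fun τ _ => τ⁻¹) (fun τ hτ => ?_) (fun _ _ _ _ h => inv_injective h)
    (fun τ hτ => ⟨τ⁻¹, ?_, by simp⟩) (fun τ hτ => flip_perm τ)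
  · simp only [Finset.mem_filter_univ] at hτ ⊢
    exact K.inv_mem hτ
  · simp only [Finset.mem_filter_univ] at hτ ⊢
    exact K.inv_mem hτ

theorem avg_mul_perm {σ : Perm (Fin n)} (h : σ ∈ K) : avg K * perm σ = avg K := by
  have := congrArg flip (perm_mul_avg K (K.inv_mem h))
  rwa [flip_mul, flip_avg, flip_perm, inv_inv] at this

theorem card_filter_mem [DecidablePred (· ∈ K)] :
    (Finset.univ.filter fun σ => σ ∈ K).card = Nat.card K := by
  rw [Nat.card_eq_fintype_card, Fintype.card_subtype]

theorem avg_mul_of_forall {x : GA n} (h : ∀ σ ∈ K, perm σ * x = x) : avg K * x = x := by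
  classical
  rw [avg, smul_mul_assoc, Finset.sum_mul, Finset.sum_congr rfl (g := fun _ => x), Finset.sum_const,
    card_filter_mem, ← Nat.cast_smul_eq_nsmul ℂ, smul_smul,
    inv_mul_cancel₀ (card_subgroup_ne_zero K), one_smul]
  exact fun σ hσ => h σ (by simpa using hσ)

theorem avg_mul_avg : avg K * avg K = avg K := avg_mul_of_forall K fun _ h => perm_mul_avg K h

theorem commute_avg {x : GA n} (h : ∀ σ ∈ K, Commute (perm σ) x) : Commute (avg K) x := by
  classical
  rw [avg]
  refine Commute.smul_left (Commute.sum_left _ _ _ fun σ hσ => h σ (by simpa using hσ)) _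

end Avg

/-! ### Pair partitions -/

variable {p : ℕ}

/-- The other point of the block of `π₀` containing `x`. -/
def mate (x : Fin (2 * p)) : Fin (2 * p) :=
  ⟨if x.val % 2 = 0 then x.val + 1 else x.val - 1, by split_ifs <;> omega⟩

theorem mate_val (x : Fin (2 * p)) :
    (mate x).val = if x.val % 2 = 0 then x.val + 1 else x.val - 1 := rfl

@[simp]
theorem mate_mate (x : Fin (2 * p)) : mate (mate x) = x := by
  refine Fin.ext ?_
  rw [mate_val, mate_val]
  split_ifs <;> omega

theorem mate_ne (x : Fin (2 * p)) : mate x ≠ x := by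
  rw [Ne, Fin.ext_iff, mate_val]
  split_ifs <;> omega

theorem basePairing_rel (u v : Fin (2 * p)) :
    (basePairing p).1 u v ↔ v = u ∨ v = mate u := by
  change u.val / 2 = v.val / 2 ↔ _
  rw [Fin.ext_iff, Fin.ext_iff, mate_val]
  split_ifs <;> omega

theorem smul_rel (σ : Perm (Fin (2 * p))) (π : PairPartition p) (u v : Fin (2 * p)) :
    (σ • π).1 u v ↔ π.1 (σ⁻¹ u) (σ⁻¹ v) := Iff.rfl

theorem PairPartition.ext {π η : PairPartition p} (h : ∀ u v, π.1 u v → η.1 u v) : π = η := by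
  refine Subtype.ext (Setoid.ext fun u v => ⟨h u v, fun huv => ?_⟩)
  have hs : {b | π.1 u b} = {b | η.1 u b} :=
    Set.eq_of_subset_of_ncard_le (fun b hb => h u b hb) (by rw [π.2, η.2]) (Set.toFinite _)
  have : v ∈ {b | η.1 u b} := huv
  rwa [← hs] at this

theorem PairPartition.unique (π : PairPartition p) {u v w : Fin (2 * p)} (hv : π.1 u v)
    (hw : π.1 u w) (hvu : v ≠ u) (hwu : w ≠ u) : v = w := by
  obtain ⟨a, b, hab, h⟩ := Set.ncard_eq_two.1 (π.2 u)
  have h1 : u ∈ ({a, b} : Set _) := h ▸ π.1.refl u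
  have h2 : v ∈ ({a, b} : Set _) := h ▸ hv
  have h3 : w ∈ ({a, b} : Set _) := h ▸ hw
  simp only [Set.mem_insert_iff, Set.mem_singleton_iff] at h1 h2 h3
  rcases h1 with rfl | rfl <;> rcases h2 with rfl | rfl <;> rcases h3 with rfl | rfl <;> tauto

theorem PairPartition.exists_rel (π : PairPartition p) (u : Fin (2 * p)) :
    ∃ v, v ≠ u ∧ π.1 u v := by
  obtain ⟨v, hv, hne⟩ := Set.exists_ne_of_one_lt_ncard (by rw [π.2 u]; norm_num) u
  exact ⟨v, hne, hv⟩

theorem mem_hyperoctahedral (σ : Perm (Fin (2 * p))) :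
    σ ∈ hyperoctahedral p ↔ ∀ x, σ (mate x) = mate (σ x) := by
  rw [hyperoctahedral, MulAction.mem_stabilizer_iff]
  constructor
  · intro h x
    have h1 : (σ • basePairing p).1 (σ x) (σ (mate x)) := by
      rw [smul_rel, perm_inv_apply_self, perm_inv_apply_self, basePairing_rel]
      exact Or.inr rfl
    rw [h, basePairing_rel] at h1
    exact h1.resolve_left fun h2 => mate_ne x (σ.injective h2)
  · intro h
    refine PairPartition.ext fun u v huv => ?_
    rw [smul_rel, basePairing_rel] at huv
    rw [basePairing_rel]
    rcases huv with h1 | h1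
    · exact Or.inl (σ⁻¹.injective h1)
    · right
      rw [← perm_apply_inv_self σ u, ← h, ← h1, perm_apply_inv_self]

theorem swap_mate_mem (x : Fin (2 * p)) : swap (mate x) x ∈ hyperoctahedral p := by
  rw [mem_hyperoctahedral]
  intro y
  by_cases h1 : y = x
  · rw [h1, Equiv.swap_apply_left, Equiv.swap_apply_right, mate_mate]
  by_cases h2 : y = mate x
  · rw [h2, mate_mate, Equiv.swap_apply_right, Equiv.swap_apply_left]
  rw [Equiv.swap_apply_of_ne_of_ne h2 h1, Equiv.swap_apply_of_ne_of_ne]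
  · exact fun h => h1 (by rw [← mate_mate y, h, mate_mate])
  · exact fun h => h2 (by rw [← mate_mate y, h])

/-- The transposition turns the block `{q, mate q}` of `π` into a block containing `a` and `mate q`,
and `π₀` links `mate q` to `q`, so `a` and `q` become equivalent. Conversely, once they are
equivalent, applying the transposition to points does not change their classes. -/
theorem blocksJoin_merge (π : PairPartition p) {a q : Fin (2 * p)} (hq : π.1 q (mate q))
    (ha' : a ≠ mate q) :
    (swap a q • π).1 ⊔ (basePairing p).1 = merge (π.1 ⊔ (basePairing p).1) a q := by
  set s := (swap a q • π).1 ⊔ (basePairing p).1 with hs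
  have hinv : (swap a q)⁻¹ = swap a q := Equiv.swap_inv _ _
  have hsaq : s a q := by
    have h1 : s a (mate q) := by
      refine (le_sup_left : (swap a q • π).1 ≤ s) ?_
      rw [smul_rel, hinv, Equiv.swap_apply_left,
        Equiv.swap_apply_of_ne_of_ne ha'.symm (mate_ne q)]
      exact hq
    refine s.trans h1 ((le_sup_right : (basePairing p).1 ≤ s) ?_)
    rw [basePairing_rel, mate_mate]
    exact Or.inr rfl
  have key : ∀ (r : Setoid (Fin (2 * p))), r a q → ∀ u, r u (swap a q u) := fun r h u => by
    rw [Equiv.swap_apply_def]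
    split_ifs with h1 h1
    · rwa [h1]
    · rw [h1]; exact r.symm h
    · exact r.refl u
  refine le_antisymm (sup_le ?_ (le_sup_right.trans (le_merge _ _ _)))
    (merge_le (sup_le ?_ le_sup_right) hsaq)
  · intro u v huv
    rw [smul_rel, hinv] at huv
    have hm := key _ (merge_rel (π.1 ⊔ (basePairing p).1) a q)
    exact (merge _ a q).trans (hm u) ((merge _ a q).trans
      (le_merge _ _ _ ((le_sup_left : π.1 ≤ π.1 ⊔ (basePairing p).1) huv))
      ((merge _ a q).symm (hm v)))
  · intro u v huv
    refine s.trans (key s hsaq u) (s.trans ((le_sup_left : (swap a q • π).1 ≤ s) ?_)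
      (s.symm (key s hsaq v)))
    rw [smul_rel, hinv, Equiv.swap_apply_self, Equiv.swap_apply_self]
    exact huv

/-- The pair `{q, mate q}` is a block of both partitions, hence a whole class of their join; `a`
lies outside it, so the merge is a proper one. -/
theorem blocksJoin_swap (π : PairPartition p) {a q : Fin (2 * p)} (hq : π.1 q (mate q))
    (ha : a ≠ q) (ha' : a ≠ mate q) :
    blocksJoin (swap a q • π) (basePairing p) + 1 = blocksJoin π (basePairing p) := by
  rw [blocksJoin, blocksJoin_merge π hq ha', card_merge, blocksJoin]
  have hle : π.1 ⊔ (basePairing p).1 ≤ Setoid.ker fun u => u = q ∨ u = mate q := by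
    refine sup_le (fun u v huv => ?_) fun u v huv => ?_
    · have key : ∀ u v, π.1 u v → u = q ∨ u = mate q → v = q ∨ v = mate q := by
        rintro u v huv (rfl | rfl)
        · by_contra! h
          exact h.2 (π.unique huv hq h.1 (mate_ne _))
        · by_contra! h
          exact h.1 (π.unique huv (π.1.symm hq) h.2 (mate_ne q).symm)
      exact propext ⟨key u v huv, key v u (π.1.symm huv)⟩
    · rw [basePairing_rel] at huv
      rcases huv with rfl | rfl
      · rfl
      · refine propext ⟨?_, ?_⟩
        · rintro (rfl | rfl)
          · exact Or.inr rfl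
          · exact Or.inl (mate_mate q)
        · rintro (h | h)
          · exact Or.inr (by rw [← h, mate_mate])
          · exact Or.inl (by rw [← mate_mate u, h, mate_mate])
  intro h
  have h1 : (a = q ∨ a = mate q) = (q = q ∨ q = mate q) := hle h
  have h2 : a = q ∨ a = mate q := by rw [h1]; exact Or.inl rfl
  tauto

/-- Two permutations with the same effect on `π₀` differ on the right by an element of `ℋ`, which
the average absorbs. Multiplied by `𝒫_ℋ`, the choice of `σ_π` thus becomes equivariant. -/
theorem perm_section_mul_avg {s : PairPartition p → Perm (Fin (2 * p))} (hs : IsSection s)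
    (σ : Perm (Fin (2 * p))) (π : PairPartition p) :
    perm (s (σ • π)) * avg (hyperoctahedral p) =
      perm σ * (perm (s π) * avg (hyperoctahedral p)) := by
  have h : (σ * s π)⁻¹ * s (σ • π) ∈ hyperoctahedral p := by
    rw [hyperoctahedral, MulAction.mem_stabilizer_iff, mul_smul, hs, inv_smul_eq_iff, mul_smul, hs]
  rw [← mul_assoc, ← perm_mul]
  conv_rhs => rw [← perm_mul_avg _ h]
  rw [← mul_assoc, ← perm_mul, mul_inv_cancel_left]

/-- Take for `a` the partner of `mate q` in `π`. It precedes `mate q`, because all later points are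
already paired as in `π₀`, and exchanging it with `q` pairs `q` with `mate q`. -/
theorem exists_swap_smul {k : ℕ} {q : Fin (2 * p)} (hqv : q.val = 2 * k) {π : PairPartition p}
    (hπ : ∀ j : Fin (2 * p), 2 * (k + 1) ≤ j.val → π.1 j (mate j)) :
    ∃ (a : Fin (2 * p)) (π' : PairPartition p), a.val ≤ 2 * k ∧
      (∀ j : Fin (2 * p), 2 * k ≤ j.val → π'.1 j (mate j)) ∧ swap a q • π' = π := by
  have hmq : (mate q).val = 2 * k + 1 := by
    rw [mate_val, if_pos (by rw [hqv]; omega), hqv]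
  obtain ⟨a, hne, ha⟩ := π.exists_rel (mate q)
  have hale : a.val ≤ 2 * k := by
    by_contra hlt'
    have h0 : a.val ≠ 2 * k + 1 := fun h => hne (Fin.ext (by rw [hmq, h]))
    have h1 := hπ a (by omega)
    have h2 := π.unique (π.1.symm ha) h1 hne.symm (mate_ne a)
    have h3 := congrArg Fin.val h2
    rw [hmq, mate_val] at h3
    split_ifs at h3 <;> omega
  have hamq : mate q ≠ a := fun h => by rw [← h, hmq] at hale; omega
  refine ⟨a, swap a q • π, hale, fun j hj => ?_, ?_⟩
  · change π.1 ((swap a q)⁻¹ j) ((swap a q)⁻¹ (mate j))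
    rw [Equiv.swap_inv]
    by_cases h1 : j = q
    · rw [h1, Equiv.swap_apply_right, Equiv.swap_apply_of_ne_of_ne hamq (mate_ne q)]
      exact π.1.symm ha
    by_cases h2 : j = mate q
    · rw [h2, mate_mate, Equiv.swap_apply_right, Equiv.swap_apply_of_ne_of_ne hamq (mate_ne q)]
      exact ha
    have h1' : j.val ≠ 2 * k := fun h => h1 (Fin.ext (by rw [h, hqv]))
    have h2' : j.val ≠ 2 * k + 1 := fun h => h2 (Fin.ext (by rw [hmq, h]))
    have hmj : 2 * k + 1 < (mate j).val := by
      rw [mate_val]; split_ifs <;> omega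
    have hfix : ∀ j : Fin (2 * p), 2 * k + 1 < j.val → swap a q j = j := fun j hj => by
      refine Equiv.swap_apply_of_ne_of_ne ?_ ?_
      · rintro rfl; omega
      · rintro rfl; omega
    rw [hfix j (by omega), hfix _ hmj]
    exact hπ j (by omega)
  · rw [← mul_smul, Equiv.swap_mul_self, one_smul]

theorem eq_basePairing {π : PairPartition p} (h : ∀ j, π.1 j (mate j)) : π = basePairing p := by
  refine (PairPartition.ext fun u v huv => ?_).symm
  rw [basePairing_rel] at huv
  rcases huv with rfl | rfl
  · exact π.1.refl _
  · exact h u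

theorem exists_isSection (p : ℕ) : ∃ s : PairPartition p → Perm (Fin (2 * p)), IsSection s := by
  have key : ∀ k ≤ p, ∀ π : PairPartition p, (∀ j : Fin (2 * p), 2 * k ≤ j.val → π.1 j (mate j)) →
      ∃ σ : Perm (Fin (2 * p)), σ • basePairing p = π := by
    intro k
    induction k with
    | zero => exact fun _ π h => ⟨1, by rw [one_smul, eq_basePairing fun j => h j (Nat.zero_le _)]⟩
    | succ k ih =>
      intro hk π h
      obtain ⟨a, π', -, h', rfl⟩ := exists_swap_smul (q := ⟨2 * k, by omega⟩) rfl h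
      obtain ⟨σ, rfl⟩ := ih (by omega) π' h'
      exact ⟨_, mul_smul _ _ _⟩
  choose s hs using fun π => key p le_rfl π fun j hj => absurd j.2 (by omega)
  exact ⟨s, hs⟩

/-- `𝐆(z) 𝒫_H = (z + X_{2p-1}) ⋯ (z + X_3) (z + X_1) 𝒫_H`. -/
theorem gramElement_mul_avg {s : PairPartition p → Perm (Fin (2 * p))} (hs : IsSection s) (z : ℂ) :
    gramElement s z * avg (hyperoctahedral p) =
      chain (fun k => z • 1 + jucysMurphy (2 * p) (2 * k + 1)) p * avg (hyperoctahedral p) := by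
  classical
  have hs0 : perm (s (basePairing p)) * avg (hyperoctahedral p) = avg (hyperoctahedral p) :=
    perm_mul_avg _ (by rw [hyperoctahedral, MulAction.mem_stabilizer_iff, hs])
  -- Here `L k` consists of the partitions that agree with `π₀` from the point `2k` on (counted from
  -- `0`). Only the first point `q = 2k` of each pair is moved, so only odd-indexed Jucys-Murphy
  -- elements occur.
  have h := (chain_expansion (M := PairPartition p)
    (fun π => perm (s π) * avg (hyperoctahedral p)) (fun σ π => perm_section_mul_avg hs σ π)
    (fun π => blocksJoin π (basePairing p))
    (fun k => Finset.univ.filter fun π => ∀ j : Fin (2 * p), 2 * k ≤ j.val → π.1 j (mate j))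
    (fun k => z • 1 + jucysMurphy (2 * p) (2 * k + 1)) p z ?_ (basePairing p) ?_ ?_ p le_rfl).2
  · rw [hs0] at h
    rw [← h, gramElement, Finset.filter_true_of_mem, Finset.sum_mul]
    · simp
    · intro σ _ j hj
      exact absurd j.2 (by omega)
  · intro k hk
    have hk2 : 2 * k < 2 * p := by omega
    set q : Fin (2 * p) := ⟨2 * k, hk2⟩ with hq
    have hqv : q.val = 2 * k := rfl
    have hmq : (mate q).val = 2 * k + 1 := by
      rw [mate_val, if_pos (by rw [hqv]; omega)]
    have hlt : ∀ a : Fin (2 * p), a ∈ Finset.univ.filter (fun a => a < q) ↔ a.val < 2 * k :=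
      fun a => by rw [Finset.mem_filter_univ, Fin.lt_def]
    have hle : ∀ a : Fin (2 * p), a ∈ insert q (Finset.univ.filter (fun a => a < q)) ↔
        a.val ≤ 2 * k := fun a => by
      rw [Finset.mem_insert, hlt, Fin.ext_iff, hqv]; omega
    have hamq : ∀ a : Fin (2 * p), a.val ≤ 2 * k → mate q ≠ a := fun a ha h => by
      rw [← h, hmq] at ha; omega
    have hsw : ∀ (a : Fin (2 * p)) (π : PairPartition p), a.val ≤ 2 * k → π.1 q (mate q) →
        (swap a q • π).1 a (mate q) := fun a π ha hπ => by
      rw [smul_rel, Equiv.swap_inv, Equiv.swap_apply_left,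
        Equiv.swap_apply_of_ne_of_ne (hamq a ha) (mate_ne q)]
      exact hπ
    refine ⟨q, Finset.univ.filter fun a => a < q, by simp, ?_, ⟨?_, ?_, ?_⟩, ?_⟩
    · rw [jucysMurphy_eq hk2]
      rfl
    · rintro ⟨a, π⟩ hy
      rw [Finset.mem_coe, Finset.mem_product, hle, Finset.mem_filter_univ] at hy
      rw [Finset.mem_coe, Finset.mem_filter_univ]
      intro j hj
      have hmj : 2 * (k + 1) ≤ (mate j).val := by
        rw [mate_val]; split_ifs <;> omega
      have h1 : ∀ j : Fin (2 * p), 2 * (k + 1) ≤ j.val → swap a q j = j := fun j hj => by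
        refine Equiv.swap_apply_of_ne_of_ne ?_ ?_
        · rintro rfl
          have := hy.1
          simp only at this
          omega
        · rintro rfl
          omega
      change (swap a q • π).1 j (mate j)
      rw [smul_rel, Equiv.swap_inv, h1 j hj, h1 _ hmj]
      exact hy.2 j (by omega)
    · rintro ⟨a, π⟩ hy ⟨a', π'⟩ hy' h
      rw [Finset.mem_coe, Finset.mem_product, hle, Finset.mem_filter_univ] at hy hy'
      change swap a q • π = swap a' q • π' at h
      -- Injectivity: `a` is recovered as the partner of `mate q` in the image partition.
      have h1 := hsw a π hy.1 (hy.2 q le_rfl)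
      have h2 := hsw a' π' hy'.1 (hy'.2 q le_rfl)
      rw [← h] at h2
      have h3 := PairPartition.unique _ ((swap a q • π).1.symm h1) ((swap a q • π).1.symm h2)
        (hamq a hy.1).symm (hamq a' hy'.1).symm
      subst h3
      rw [MulAction.injective (swap a q) h]
    · intro π hπ
      rw [Finset.mem_coe, Finset.mem_filter_univ] at hπ
      obtain ⟨a, π', hale, hπ', h⟩ := exists_swap_smul hqv hπ
      refine ⟨(a, π'), ?_, h⟩
      rw [Finset.mem_coe, Finset.mem_product, hle, Finset.mem_filter_univ]
      exact ⟨hale, hπ'⟩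
    · intro a ha π hπ
      rw [hlt] at ha
      rw [Finset.mem_filter_univ] at hπ
      refine blocksJoin_swap π (hπ q le_rfl) ?_ (hamq a ha.le).symm
      rintro rfl
      omega
  · ext π
    rw [Finset.mem_filter_univ, Finset.mem_singleton]
    constructor
    · exact fun h => eq_basePairing fun j => h j (Nat.zero_le _)
    · rintro rfl j -
      rw [basePairing_rel]
      exact Or.inr rfl
  · rw [blocksJoin, sup_idem]
    have hsurj : Function.Surjective fun x : Fin (2 * p) => (⟨x.val / 2, by omega⟩ : Fin p) :=
      fun y => ⟨⟨2 * y.val, by omega⟩, Fin.ext (by simp)⟩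
    have e : (basePairing p).1 =
        Setoid.ker fun x : Fin (2 * p) => (⟨x.val / 2, by omega⟩ : Fin p) := by
      ext u v
      rw [Setoid.ker_def, Fin.ext_iff]
      rfl
    rw [e, Nat.card_congr (Setoid.quotientKerEquivOfSurjective _ hsurj), Nat.card_fin]

end JMBrauer

end

noncomputable section

namespace JMBrauer

open Equiv (Perm swap)

variable {n m p : ℕ}

/-! ### Embeddings of group algebras -/

/-- The map of group algebras induced by a map of groups. -/
def mapGA (f : Perm (Fin m) →* Perm (Fin n)) : GA m →ₐ[ℂ] GA n :=
  MonoidAlgebra.mapDomainAlgHom ℂ ℂ f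

@[simp]
theorem mapGA_perm (f : Perm (Fin m) →* Perm (Fin n)) (σ : Perm (Fin m)) :
    mapGA f (perm σ) = perm (f σ) := by
  rw [perm_eq_single, perm_eq_single]
  exact MonoidAlgebra.mapDomain_single

theorem mapGA_comp {l : ℕ} (f : Perm (Fin m) →* Perm (Fin n)) (g : Perm (Fin l) →* Perm (Fin m))
    (x : GA l) : mapGA (f.comp g) x = mapGA f (mapGA g x) := by
  have h : (mapGA (f.comp g)).toLinearMap = (mapGA f).toLinearMap ∘ₗ (mapGA g).toLinearMap :=
    linearMap_ext fun σ => by simp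
  exact LinearMap.congr_fun h x

theorem commute_mapGA {f : Perm (Fin m) →* Perm (Fin n)} {y : GA n}
    (h : ∀ σ, Commute (perm (f σ)) y) (x : GA m) : Commute (mapGA f x) y := by
  induction x using ga_induction with
  | hp σ => rw [mapGA_perm]; exact h σ
  | ha x y hx hy => rw [map_add]; exact hx.add_left hy
  | hs r x hx => rw [map_smul]; exact hx.smul_left r

theorem avg_mul_mapGA_avg {K : Subgroup (Perm (Fin n))} {K' : Subgroup (Perm (Fin m))}
    {f : Perm (Fin m) →* Perm (Fin n)} (h : ∀ σ ∈ K', f σ ∈ K) :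
    avg K * mapGA f (avg K') = avg K := by
  classical
  have e : avg K' = (Nat.card K' : ℂ)⁻¹ • ∑ σ : Perm (Fin m) with σ ∈ K', perm σ := by
    rw [avg]
  rw [e, map_smul, map_sum, mul_smul_comm, Finset.mul_sum,
    Finset.sum_congr rfl (g := fun _ => avg K), Finset.sum_const, card_filter_mem,
    ← Nat.cast_smul_eq_nsmul ℂ, smul_smul, inv_mul_cancel₀ (card_subgroup_ne_zero K'), one_smul]
  intro σ hσ
  rw [mapGA_perm]
  exact avg_mul_perm K (h σ (by simpa using hσ))

theorem mapGA_avg_mul_avg {K : Subgroup (Perm (Fin n))} {K' : Subgroup (Perm (Fin m))}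
    {f : Perm (Fin m) →* Perm (Fin n)} (h : ∀ σ ∈ K', f σ ∈ K) :
    mapGA f (avg K') * avg K = avg K := by
  classical
  have e : avg K' = (Nat.card K' : ℂ)⁻¹ • ∑ σ : Perm (Fin m) with σ ∈ K', perm σ := by
    rw [avg]
  rw [e, map_smul, map_sum, smul_mul_assoc, Finset.sum_mul,
    Finset.sum_congr rfl (g := fun _ => avg K), Finset.sum_const, card_filter_mem,
    ← Nat.cast_smul_eq_nsmul ℂ, smul_smul, inv_mul_cancel₀ (card_subgroup_ne_zero K'), one_smul]
  intro σ hσ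
  rw [mapGA_perm]
  exact perm_mul_avg K (h σ (by simpa using hσ))

/-- The permutations of `{1, …, m}` as permutations of `{1, …, n}`. -/
def castHom (h : m ≤ n) : Perm (Fin m) →* Perm (Fin n) :=
  Equiv.Perm.viaEmbeddingHom (Fin.castLEEmb h)

theorem castHom_castLE (h : m ≤ n) (σ : Perm (Fin m)) (x : Fin m) :
    castHom h σ (Fin.castLE h x) = Fin.castLE h (σ x) :=
  Equiv.Perm.viaEmbedding_apply σ (Fin.castLEEmb h) x

theorem castHom_val_lt (h : m ≤ n) (σ : Perm (Fin m)) {x : Fin n} (hx : x.val < m) :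
    (castHom h σ x).val = (σ ⟨x.val, hx⟩).val := by
  have := castHom_castLE h σ ⟨x.val, hx⟩
  exact congrArg Fin.val this

theorem castHom_of_le (h : m ≤ n) (σ : Perm (Fin m)) {x : Fin n} (hx : m ≤ x.val) :
    castHom h σ x = x := by
  refine Equiv.Perm.viaEmbedding_apply_of_notMem σ (Fin.castLEEmb h) x ?_
  rintro ⟨y, rfl⟩
  have := y.2
  simp at hx
  omega

theorem castHom_self (σ : Perm (Fin n)) : castHom le_rfl σ = σ :=
  Equiv.ext fun x => Fin.ext (castHom_val_lt _ _ x.2)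

theorem castHom_comp {l : ℕ} (h : l ≤ m) (h' : m ≤ n) :
    castHom (h.trans h') = (castHom h').comp (castHom h) := by
  refine MonoidHom.ext fun σ => Equiv.ext fun x => ?_
  rw [MonoidHom.comp_apply]
  by_cases h1 : x.val < l
  · refine Fin.ext ?_
    have h2 : x.val < m := by omega
    rw [castHom_val_lt (h.trans h') _ h1, castHom_val_lt h' _ h2]
    exact (castHom_val_lt h σ (x := ⟨x.val, h2⟩) h1).symm
  · rw [castHom_of_le _ _ (by omega)]
    by_cases h2 : x.val < m
    · refine Fin.ext ?_
      rw [castHom_val_lt h' _ h2, castHom_of_le h _ (x := ⟨x.val, h2⟩) (by simpa using h1)]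
    · rw [castHom_of_le _ _ (by omega)]

theorem castHom_swap (h : m ≤ n) (a b : Fin m) :
    castHom h (swap a b) = swap (Fin.castLE h a) (Fin.castLE h b) := by
  refine Equiv.ext fun x => ?_
  by_cases hx : x.val < m
  · have e : x = Fin.castLE h ⟨x.val, hx⟩ := rfl
    rw [e, castHom_castLE, ← Function.Injective.swap_apply (Fin.castLE_injective h)]
  · rw [castHom_of_le _ _ (by omega), Equiv.swap_apply_of_ne_of_ne]
    · rintro rfl
      exact hx a.2
    · rintro rfl
      exact hx b.2

theorem mapGA_castHom_jm (h : m ≤ n) (q : Fin m) :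
    mapGA (castHom h) (jm q) = jm (Fin.castLE h q) := by
  rw [jm, jm, map_sum]
  refine Finset.sum_bij (fun a _ => Fin.castLE h a) (fun a ha => ?_)
    (fun _ _ _ _ h' => Fin.castLE_injective h h') (fun b hb => ?_) (fun a _ => ?_)
  · simpa using ha
  · rw [Finset.mem_filter_univ, Fin.lt_def] at hb
    have hbq : b.val < q.val := hb
    exact ⟨⟨b.val, hbq.trans q.2⟩, (Finset.mem_filter_univ _).2 hbq, rfl⟩
  · rw [mapGA_perm, castHom_swap]

theorem mapGA_castHom_jucysMurphy (h : m ≤ n) {i : ℕ} (hi : i < m) :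
    mapGA (castHom h) (jucysMurphy m (i + 1)) = jucysMurphy n (i + 1) := by
  rw [jucysMurphy_eq hi, jucysMurphy_eq (hi.trans_le h), mapGA_castHom_jm]
  rfl

theorem commute_jm {g : Perm (Fin n)} {q : Fin n} (hq : g q = q)
    (h : ∀ a, a < q → g a < q) : Commute (perm g) (jm q) := by
  rw [Commute, SemiconjBy, jm, Finset.mul_sum, Finset.sum_mul]
  refine Finset.sum_bij (fun a _ => g a) (fun a ha => ?_) (fun _ _ _ _ h' => g.injective h')
    (fun b hb => ?_) (fun a _ => ?_)
  · rw [Finset.mem_filter_univ] at ha ⊢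
    exact h a ha
  · have hi : Set.InjOn g (Finset.univ.filter fun a => a < q) := g.injective.injOn
    have := Finset.surj_on_of_inj_on_of_card_le (s := Finset.univ.filter fun a => a < q)
      (t := Finset.univ.filter fun a => a < q) (fun a _ => g a)
      (fun a ha => by rw [Finset.mem_filter_univ] at ha ⊢; exact h a ha)
      (fun _ _ _ _ h' => g.injective h') le_rfl b hb
    obtain ⟨a, ha, hab⟩ := this
    exact ⟨a, ha, hab.symm⟩
  · rw [perm_conj_swap, hq]

/-- Permutations of the first `m` points fix every later point `q` and permute the points before
`q`. -/
theorem commute_castHom_jm (h : m ≤ n) {q : Fin n} (hq : m ≤ q.val) (x : GA m) :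
    Commute (mapGA (castHom h) x) (jm q) := by
  refine commute_mapGA (fun σ => commute_jm (castHom_of_le h σ hq) fun a ha => ?_) x
  by_cases h1 : a.val < m
  · rw [Fin.lt_def, castHom_val_lt h σ h1]
    have := (σ ⟨a.val, h1⟩).2
    omega
  · rwa [castHom_of_le h σ (by omega)]

/-! ### The hyperoctahedral average of the sum of transpositions -/

theorem exists_val_div (x : Fin (2 * p)) : x.val / 2 < p := by omega

/-- The permutation of the blocks of `π₀` given by `τ`. -/
def pairPerm (τ : Perm (Fin p)) : Perm (Fin (2 * p)) where
  toFun x := ⟨2 * (τ ⟨x.val / 2, exists_val_div x⟩).val + x.val % 2, by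
    have := (τ ⟨x.val / 2, exists_val_div x⟩).2
    omega⟩
  invFun x := ⟨2 * (τ⁻¹ ⟨x.val / 2, exists_val_div x⟩).val + x.val % 2, by
    have := (τ⁻¹ ⟨x.val / 2, exists_val_div x⟩).2
    omega⟩
  left_inv x := by
    refine Fin.ext ?_
    have h1 : ∀ a b : ℕ, b < 2 → (2 * a + b) / 2 = a := fun a b h => by omega
    have h2 : x.val % 2 < 2 := Nat.mod_lt _ two_pos
    simp only [h1 _ _ h2, Fin.eta, perm_inv_apply_self]
    omega
  right_inv x := by
    refine Fin.ext ?_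
    have h1 : ∀ a b : ℕ, b < 2 → (2 * a + b) / 2 = a := fun a b h => by omega
    have h2 : x.val % 2 < 2 := Nat.mod_lt _ two_pos
    simp only [h1 _ _ h2, Fin.eta, perm_apply_inv_self]
    omega

theorem pairPerm_val (τ : Perm (Fin p)) (x : Fin (2 * p)) :
    (pairPerm τ x).val = 2 * (τ ⟨x.val / 2, exists_val_div x⟩).val + x.val % 2 := rfl

theorem mate_div (x : Fin (2 * p)) : (mate x).val / 2 = x.val / 2 := by
  rw [mate_val]; split_ifs <;> omega

theorem pairPerm_mem (τ : Perm (Fin p)) : pairPerm τ ∈ hyperoctahedral p := by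
  rw [mem_hyperoctahedral]
  intro x
  have h1 : (⟨(mate x).val / 2, exists_val_div _⟩ : Fin p) = ⟨x.val / 2, exists_val_div x⟩ :=
    Fin.ext (mate_div x)
  refine Fin.ext ?_
  rw [pairPerm_val, h1, mate_val (pairPerm τ x), pairPerm_val, mate_val]
  split_ifs <;> omega

theorem exists_hyperoctahedral (x y : Fin (2 * p)) : ∃ h ∈ hyperoctahedral p, h x = y := by
  set τ := swap (⟨x.val / 2, exists_val_div x⟩ : Fin p) ⟨y.val / 2, exists_val_div y⟩ with hτ
  have h1 : (pairPerm τ x).val / 2 = y.val / 2 := by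
    rw [pairPerm_val, hτ, Equiv.swap_apply_left]
    simp only
    omega
  have h2 : y = pairPerm τ x ∨ y = mate (pairPerm τ x) := (basePairing_rel _ _).1 h1
  rcases h2 with h2 | h2
  · exact ⟨_, pairPerm_mem τ, h2.symm⟩
  · refine ⟨swap (mate (pairPerm τ x)) (pairPerm τ x) * pairPerm τ,
      mul_mem (swap_mate_mem _) (pairPerm_mem τ), ?_⟩
    rw [Equiv.Perm.mul_apply, Equiv.swap_apply_right, h2]

/-- `∑_{a ≠ q} (a q)`. -/
def starSum (q : Fin n) : GA n := ∑ a with a ≠ q, perm (swap a q)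

theorem perm_mul_starSum (g : Perm (Fin n)) (q : Fin n) : perm g * starSum q = starSum (g q) * perm g :=
  perm_conj_star g q

theorem sum_starSum : ∑ q : Fin n, starSum q = (2 : ℂ) • ∑ q, jm q := two_smul_sum_jm.symm

theorem starSum_eq_add_jm {q : Fin n} {b : Fin n} (h : ∀ a, a ≠ q ↔ a = b ∨ a < q)
    (hbq : ¬b < q) : starSum q = perm (swap b q) + jm q := by
  have e : (Finset.univ.filter fun a => a ≠ q) =
      insert b (Finset.univ.filter fun a => a < q) := by
    ext a
    rw [Finset.mem_insert, Finset.mem_filter_univ, Finset.mem_filter_univ, h]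
  rw [starSum, e, Finset.sum_insert (by simpa using hbq), jm]

/-- By transitivity of `ℋ`, the compressions by `P` of all stars `∑_{a ≠ c} (a c)` coincide, and the
sum of all transpositions is half the sum of the `2(i + 1)` stars. The last but one point `q` is
chosen since its star is its Jucys-Murphy element plus the transposition `(mate q, q)`, which lies
in `ℋ` and accounts for the term `1`. -/
theorem sum_jm_mul_avg_hyperoctahedral (i : ℕ) (hi : 2 * i < 2 * (i + 1)) :
    (∑ k, jm k) * avg (hyperoctahedral (i + 1)) =
      avg (hyperoctahedral (i + 1)) * (((i + 1 : ℕ) : ℂ) • (1 + jm (⟨2 * i, hi⟩))) *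
        avg (hyperoctahedral (i + 1)) := by
  set P := avg (hyperoctahedral (i + 1)) with hP
  set q : Fin (2 * (i + 1)) := ⟨2 * i, hi⟩ with hq
  have hmq : (mate q).val = 2 * i + 1 := by
    rw [mate_val, if_pos (by simp [hq])]
  have hstar : ∀ c, P * starSum c * P = P * starSum q * P := fun c => by
    obtain ⟨h, hh, rfl⟩ := exists_hyperoctahedral q c
    have h1 : P * perm h = P := avg_mul_perm _ hh
    have h2 : perm h * P = P := perm_mul_avg _ hh
    calc P * starSum (h q) * P = P * (starSum (h q) * perm h) * P := by
          simp only [mul_assoc, h2]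
      _ = P * perm h * starSum q * P := by rw [← perm_mul_starSum]; simp only [mul_assoc]
      _ = _ := by rw [h1]
  have h1 : P * (1 + jm q) * P = P * starSum q * P := by
    have h0 : P * perm (swap (mate q) q) = P := avg_mul_perm _ (swap_mate_mem q)
    have h1 : starSum q = perm (swap (mate q) q) + jm q := starSum_eq_add_jm (fun a => ?_) ?_
    · rw [h1, mul_add P, mul_add P, mul_one P, h0]
    · rw [Ne, Fin.ext_iff, Fin.ext_iff, hmq, Fin.lt_def]
      have := a.2
      simp only [hq]
      omega
    · rw [Fin.lt_def, hmq]
      simp [hq]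
  have h2 : ((2 * (i + 1) : ℕ) : ℂ) • (P * starSum q * P) = (2 : ℂ) • (P * (∑ k, jm k) * P) := by
    rw [← smul_mul_assoc (2 : ℂ), ← mul_smul_comm (2 : ℂ), ← sum_starSum, Finset.mul_sum, Finset.sum_mul,
      Finset.sum_congr rfl fun c _ => hstar c, Finset.sum_const, Finset.card_univ, Fintype.card_fin,
      Nat.cast_smul_eq_nsmul]
  have h3 : (∑ k, jm k) * P = P * (∑ k, jm k) * P := by
    rw [(commute_sum_jm P).eq, mul_assoc, hP, avg_mul_avg]
  rw [h3, mul_smul_comm, smul_mul_assoc, h1]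
  have h4 := congrArg ((2 : ℂ)⁻¹ • ·) h2
  simp only [smul_smul] at h4
  rw [inv_mul_cancel₀ two_ne_zero, one_smul] at h4
  rw [← h4]
  congr 1
  push_cast
  ring

/-! ### The diagonal average of the sum of transpositions -/

/-- The two copies of the sum of transpositions agree on the diagonal average, and the diagonal
group permutes the stars of one copy transitively, so all have the same compression. -/
theorem mapGA_mul_avg_range {α β : Perm (Fin m) →* Perm (Fin n)} (hαβ : ∀ σ τ, Commute (α σ) (β τ))
    {δ : Perm (Fin m) →* Perm (Fin n)} (hδ : ∀ σ, δ σ = α σ * β σ) (q : Fin m) :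
    (mapGA α (∑ k, jm k) + mapGA β (∑ k, jm k)) * avg δ.range =
      (m : ℂ) • (avg δ.range * mapGA α (starSum q) * avg δ.range) ∧
    mapGA β (∑ k, jm k) * avg δ.range = mapGA α (∑ k, jm k) * avg δ.range := by
  set P := avg δ.range with hP
  have hmem : ∀ σ, δ σ ∈ δ.range := fun σ => ⟨σ, rfl⟩
  -- The product of the two copies of a transposition lies in the diagonal group and each copy is an
  -- involution, so on `P` either one can replace the other.
  have hswap : ∀ a b, mapGA β (perm (swap a b)) * P = mapGA α (perm (swap a b)) * P := by
    intro a b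
    have h1 : perm (α (swap a b)) * (perm (β (swap a b)) * P) = P := by
      rw [← mul_assoc, ← perm_mul, ← hδ, hP, perm_mul_avg _ (hmem _)]
    rw [mapGA_perm, mapGA_perm]
    conv_rhs => rw [← h1]
    rw [← mul_assoc, ← perm_mul, ← map_mul, Equiv.swap_mul_self, map_one, perm_one, one_mul]
  have h2 : mapGA β (∑ k, jm k) * P = mapGA α (∑ k, jm k) * P := by
    simp only [jm, map_sum, Finset.sum_mul, hswap]
  have hconj : ∀ σ (x y : GA m), perm σ * x = y * perm σ →
      perm (δ σ) * mapGA α x = mapGA α y * perm (δ σ) := fun σ x y h => by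
    have hβ : Commute (perm (β σ)) (mapGA α x) :=
      (commute_mapGA (fun τ => by
        rw [Commute, SemiconjBy, ← perm_mul, ← perm_mul, (hαβ τ σ).eq]) x).symm
    have h3 := congrArg (mapGA α) h
    rw [map_mul, map_mul, mapGA_perm] at h3
    rw [hδ, perm_mul, mul_assoc, hβ.eq, ← mul_assoc, h3, mul_assoc]
  have hT : Commute P (mapGA α (∑ k, jm k)) := commute_avg _ fun g hg => by
    obtain ⟨σ, rfl⟩ := hg
    exact hconj σ _ _ (commute_sum_jm (perm σ)).eq
  have hstar : ∀ c, P * mapGA α (starSum c) * P = P * mapGA α (starSum q) * P := fun c => by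
    have h3 := hconj (swap q c) (starSum q) (starSum c) (by
      rw [perm_mul_starSum, Equiv.swap_apply_left])
    have h4 : P * perm (δ (swap q c)) = P := avg_mul_perm _ (hmem _)
    have h5 : perm (δ (swap q c)) * P = P := perm_mul_avg _ (hmem _)
    calc P * mapGA α (starSum c) * P = P * mapGA α (starSum c) * (perm (δ (swap q c)) * P) := by rw [h5]
      _ = P * (mapGA α (starSum c) * perm (δ (swap q c))) * P := by simp only [mul_assoc]
      _ = P * perm (δ (swap q c)) * mapGA α (starSum q) * P := by rw [← h3]; simp only [mul_assoc]
      _ = _ := by rw [h4]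
  refine ⟨?_, h2⟩
  have h6 : (m : ℂ) • (P * mapGA α (starSum q) * P) = (2 : ℂ) • (P * mapGA α (∑ k, jm k) * P) := by
    rw [← smul_mul_assoc (2 : ℂ), ← mul_smul_comm (2 : ℂ), ← map_smul, ← sum_starSum, map_sum,
      Finset.mul_sum, Finset.sum_mul, Finset.sum_congr rfl fun c _ => hstar c, Finset.sum_const,
      Finset.card_univ, Fintype.card_fin, ← Nat.cast_smul_eq_nsmul ℂ]
  rw [h6, add_mul, h2, two_smul, hT.eq, mul_assoc, hP, avg_mul_avg]

end JMBrauer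

end

noncomputable section

namespace JMBrauer

open Equiv (Perm swap)

variable {n m p : ℕ}

/-! ### Families of orthogonal idempotents -/

section OrthogonalIdempotents

variable {ι A : Type*} [Fintype ι] [Ring A] [Algebra ℂ A] {e : ι → A}

theorem sum_smul_mul_sum_smul (hid : ∀ i, e i * e i = e i) (hor : ∀ i j, i ≠ j → e i * e j = 0)
    (a b : ι → ℂ) : (∑ i, a i • e i) * ∑ i, b i • e i = ∑ i, (a i * b i) • e i := by
  classical
  rw [Finset.sum_mul]
  refine Finset.sum_congr rfl fun i _ => ?_
  rw [Finset.mul_sum, Finset.sum_eq_single i]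
  · rw [smul_mul_assoc, mul_smul_comm, hid, smul_smul]
  · intro j _ hj
    rw [smul_mul_assoc, mul_smul_comm, hor i j hj.symm, smul_zero, smul_zero]
  · simp

theorem mul_inv_mul_cancel_complex (a : ℂ) : a * a⁻¹ * a = a := by
  by_cases h : a = 0
  · simp [h]
  · field_simp

theorem isPseudoInverse_sum_smul (hid : ∀ i, e i * e i = e i)
    (hor : ∀ i j, i ≠ j → e i * e j = 0) (a : ι → ℂ) :
    IsPseudoInverse (∑ i, a i • e i) (∑ i, (a i)⁻¹ • e i) := by
  constructor
  · rw [sum_smul_mul_sum_smul hid hor, sum_smul_mul_sum_smul hid hor]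
    exact Finset.sum_congr rfl fun i _ => by rw [mul_inv_mul_cancel_complex]
  · rw [sum_smul_mul_sum_smul hid hor, sum_smul_mul_sum_smul hid hor]
    refine Finset.sum_congr rfl fun i _ => ?_
    have := mul_inv_mul_cancel_complex (a i)⁻¹
    rw [inv_inv] at this
    rw [this]

theorem commute_sum_smul (hid : ∀ i, e i * e i = e i)
    (hor : ∀ i j, i ≠ j → e i * e j = 0) (a b : ι → ℂ) :
    Commute (∑ i, a i • e i) (∑ i, b i • e i) := by
  rw [Commute, SemiconjBy, sum_smul_mul_sum_smul hid hor, sum_smul_mul_sum_smul hid hor]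
  exact Finset.sum_congr rfl fun i _ => by rw [mul_comm]

theorem linearIndependent_of_orthogonal (h0 : ∀ i, e i ≠ 0) (hid : ∀ i, e i * e i = e i)
    (hor : ∀ i j, i ≠ j → e i * e j = 0) : LinearIndependent ℂ e := by
  classical
  rw [Fintype.linearIndependent_iff]
  intro g hg i
  have h1 := congrArg (e i * ·) hg
  simp only [Finset.mul_sum, mul_zero, mul_smul_comm] at h1
  rw [Finset.sum_eq_single i, hid] at h1
  · exact (smul_eq_zero.1 h1).resolve_right (h0 i)
  · intro j _ hj
    rw [hor i j hj.symm, smul_zero]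
  · simp

end OrthogonalIdempotents

/-! ### The number of shapes -/

theorem card_cellsOfRowLens (w : List ℕ) : (YoungDiagram.cellsOfRowLens w).card = w.sum := by
  induction w with
  | nil => rfl
  | cons a w ih =>
    rw [YoungDiagram.cellsOfRowLens, Finset.card_union_of_disjoint, Finset.card_map, ih,
      List.sum_cons]
    · simp
    · rw [Finset.disjoint_left]
      rintro ⟨i, j⟩ h1 h2
      obtain ⟨⟨i', j'⟩, -, h3⟩ := Finset.mem_map.1 h2
      have h4 := (Prod.ext_iff.1 h3).1
      simp at h1 h4
      omega

theorem exists_injective_shape (p : ℕ) : ∃ F : Nat.Partition p → Shape p, Function.Injective F := by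
  have hs : ∀ π : Nat.Partition p, (π.parts.sort (· ≥ ·)).SortedGE := fun π =>
    (Multiset.pairwise_sort π.parts (· ≥ ·)).sortedGE
  have hpos : ∀ π : Nat.Partition p, ∀ x ∈ π.parts.sort (· ≥ ·), 0 < x := fun π x hx =>
    π.parts_pos ((Multiset.mem_sort _).1 hx)
  refine ⟨fun π => ⟨YoungDiagram.ofRowLens _ (hs π), ?_⟩, fun π π' h => ?_⟩
  · refine (card_cellsOfRowLens _).trans ?_
    rw [← Multiset.sum_coe, Multiset.sort_eq, π.parts_sum]
  · have h1 := congrArg YoungDiagram.rowLens (Subtype.ext_iff.1 h)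
    simp only at h1
    rw [YoungDiagram.rowLens_ofRowLens_eq_self (hpos π),
      YoungDiagram.rowLens_ofRowLens_eq_self (hpos π')] at h1
    have h2 := congrArg (fun l : List ℕ => (l : Multiset ℕ)) h1
    simp only [Multiset.sort_eq] at h2
    exact Nat.Partition.ext h2

/-- Cycle types embed the conjugacy classes into the partitions, hence into the diagrams. Only this
inequality is needed: linear independence of the idempotents supplies the other one. -/
theorem card_conjClasses_le (p : ℕ) :
    Nat.card (ConjClasses (Perm (Fin p))) ≤ Fintype.card (Shape p) := by
  obtain ⟨F, hF⟩ := exists_injective_shape (Fintype.card (Fin p))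
  have h : ∀ σ τ : Perm (Fin p), IsConj σ τ ↔ σ.partition = τ.partition :=
    fun σ τ => Equiv.Perm.partition_eq_of_isConj
  let G : ConjClasses (Perm (Fin p)) → Shape (Fintype.card (Fin p)) :=
    Quotient.lift (fun σ => F σ.partition) fun σ τ hst => congrArg F ((h σ τ).1 hst)
  have hG : Function.Injective G := by
    intro a b
    induction a using Quotient.ind with | _ σ =>
    induction b using Quotient.ind with | _ τ =>
    exact fun hab => Quotient.sound ((h σ τ).2 (hF hab))
  have := Nat.card_le_card_of_injective G hG
  rw [Nat.card_eq_fintype_card (α := Shape _)] at this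
  rwa [Fintype.card_fin] at this

/-- Orthogonal idempotents indexed by the shapes span the image of a class function. -/
theorem exists_eq_sum_smul {A : Type*} [Ring A] [Algebra ℂ A] {f : Perm (Fin p) → A}
    (hf : ∀ σ τ, f (τ * σ * τ⁻¹) = f σ) {e : Shape p → A} (h0 : ∀ μ, e μ ≠ 0)
    (hid : ∀ μ, e μ * e μ = e μ) (hor : ∀ μ ν, μ ≠ ν → e μ * e ν = 0)
    (hmem : ∀ μ, e μ ∈ Submodule.span ℂ (Set.range f)) {u : A}
    (hu : u ∈ Submodule.span ℂ (Set.range f)) : ∃ c : Shape p → ℂ, u = ∑ μ, c μ • e μ := by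
  classical
  have : Fintype (ConjClasses (Perm (Fin p))) := Fintype.ofFinite _
  let f' : ConjClasses (Perm (Fin p)) → A := Quotient.lift f fun σ τ h => by
    obtain ⟨c, rfl⟩ := isConj_iff.1 h
    exact (hf _ _).symm
  have hr : Set.range f' = Set.range f := by
    ext a
    constructor
    · rintro ⟨c, rfl⟩
      induction c using Quotient.ind with | _ σ =>
      exact ⟨σ, rfl⟩
    · rintro ⟨σ, rfl⟩
      exact ⟨Quotient.mk _ σ, rfl⟩
  have hfin : FiniteDimensional ℂ (Submodule.span ℂ (Set.range f)) :=
    FiniteDimensional.span_of_finite ℂ (Set.finite_range f)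
  have h1 : Module.finrank ℂ (Submodule.span ℂ (Set.range f)) ≤ Fintype.card (Shape p) := by
    rw [← hr]
    refine (finrank_range_le_card f').trans ?_
    rw [← Nat.card_eq_fintype_card]
    exact card_conjClasses_le p
  -- The idempotents are independent in a space whose dimension is at most their number, so they
  -- span it.
  have h2 : Submodule.span ℂ (Set.range e) = Submodule.span ℂ (Set.range f) := by
    refine Submodule.eq_of_le_of_finrank_le (Submodule.span_le.2 ?_) ?_
    · rintro _ ⟨μ, rfl⟩
      exact hmem μ
    · rw [finrank_span_eq_card (linearIndependent_of_orthogonal h0 hid hor)]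
      exact h1
  rw [← h2, Submodule.mem_span_range_iff_exists_fun] at hu
  obtain ⟨c, hc⟩ := hu
  exact ⟨c, hc.symm⟩

/-! ### The decomposition of the center -/

theorem conjSum_mem_span (x : GA n) :
    conjSum x ∈ Submodule.span ℂ (Set.range fun σ : Perm (Fin n) => conjSum (perm σ)) := by
  rw [eq_sum_coef x, map_sum]
  refine Submodule.sum_mem _ fun σ _ => ?_
  rw [map_smul]
  exact Submodule.smul_mem _ _ (Submodule.subset_span ⟨σ, rfl⟩)

/-- The center is spanned by the class sums, so `1` is a combination of the `𝒫_μ`; multiplying by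
`𝒫_ν` shows that every coefficient is `1`. -/
theorem sum_proj (n : ℕ) : ∑ μ : Shape n, μ.proj = 1 := by
  have hN : (Fintype.card (Perm (Fin n)) : ℂ) ≠ 0 := Nat.cast_ne_zero.2 Fintype.card_ne_zero
  have h1 : (1 : GA n) = (Fintype.card (Perm (Fin n)) : ℂ)⁻¹ • conjSum 1 := by
    rw [conjSum_apply, Finset.sum_congr rfl (g := fun _ => 1), Finset.sum_const, Finset.card_univ,
      ← Nat.cast_smul_eq_nsmul ℂ, smul_smul, inv_mul_cancel₀ hN, one_smul]
    intro g _
    rw [mul_one, ← perm_mul, mul_inv_cancel, perm_one]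
  obtain ⟨c, hc⟩ := exists_eq_sum_smul (f := fun σ : Perm (Fin n) => conjSum (perm σ))
    (fun σ τ => by rw [perm_mul, perm_mul, conjSum_conj]) (e := fun μ : Shape n => μ.proj)
    (fun μ => μ.proj_ne_zero) (fun μ => μ.proj_mul_self) (fun μ ν h => Shape.proj_mul_proj h)
    (fun μ => by
      obtain ⟨s, -, hs⟩ := μ.exists_proj_eq
      rw [hs _ μ.isTableau_cellOf]
      exact Submodule.smul_mem _ _ (conjSum_mem_span _))
    (u := 1) (by rw [h1]; exact Submodule.smul_mem _ _ (conjSum_mem_span _))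
  have hc1 : ∀ ν, c ν = 1 := fun ν => by
    have h2 := congrArg (ν.proj * ·) hc
    simp only [mul_one, Finset.mul_sum, mul_smul_comm] at h2
    rw [Finset.sum_eq_single ν, ν.proj_mul_self] at h2
    · have h3 : (1 - c ν) • ν.proj = 0 := by rw [sub_smul, one_smul, ← h2, sub_self]
      have h4 := (smul_eq_zero.1 h3).resolve_right ν.proj_ne_zero
      exact (sub_eq_zero.1 h4).symm
    · intro μ _ hμ
      rw [Shape.proj_mul_proj hμ.symm, smul_zero]
    · simp
  rw [hc]
  exact Finset.sum_congr rfl fun μ _ => by rw [hc1, one_smul]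

theorem chain_mul_of_forall {A : Type*} [Ring A] [Algebra ℂ A] {x : ℕ → A} {v : A} {c : ℕ → ℂ}
    {k : ℕ} (h : ∀ i < k, x i * v = c i • v) :
    chain x k * v = (∏ i ∈ Finset.range k, c i) • v := by
  induction k with
  | zero => simp [chain]
  | succ k ih =>
    rw [chain, mul_assoc, ih fun i hi => h i (by omega), mul_smul_comm, h k (by omega), smul_smul,
      Finset.prod_range_succ]

theorem commute_omegaElement (z : ℂ) (y : GA p) : Commute y (omegaElement p z) := by
  refine commute_of_perm (fun g => ?_) y
  rw [Commute, SemiconjBy, omegaElement, Finset.mul_sum, Finset.sum_mul]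
  refine Fintype.sum_equiv (MulAut.conj g).toEquiv _ _ fun σ => ?_
  have hcard : Nat.card (Quotient (Equiv.Perm.SameCycle.setoid σ)) =
      Nat.card (Quotient (Equiv.Perm.SameCycle.setoid (g * σ * g⁻¹))) := by
    refine Nat.card_congr (Quotient.congr g fun a b => ?_)
    change σ.SameCycle a b ↔ (g * σ * g⁻¹).SameCycle (g a) (g b)
    rw [Equiv.Perm.sameCycle_conj, perm_inv_apply_self, perm_inv_apply_self]
  change perm g * (z ^ Nat.card (Quotient (Equiv.Perm.SameCycle.setoid σ)) • perm σ) =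
    (z ^ Nat.card (Quotient (Equiv.Perm.SameCycle.setoid (g * σ * g⁻¹))) • perm (g * σ * g⁻¹)) *
      perm g
  rw [hcard, mul_smul_comm, smul_mul_assoc, ← perm_mul, ← perm_mul, inv_mul_cancel_right]

/-- Since `Ω(z)` is central, it suffices to apply its factors one after the other to `b a` for a
column reading: each contributes `z` plus a content. -/
theorem omegaElement_mul_proj (z : ℂ) (μ : Shape p) :
    omegaElement p z * μ.proj = μ.R z • μ.proj := by
  obtain ⟨t, ht, hr⟩ := μ.exists_columnReading
  refine ht.mul_proj (fun g => commute_omegaElement _ _) ?_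
  rw [omegaElement_eq_chain, chain_mul_of_forall
    (c := fun k => if h : k < p then z + (t ⟨k, h⟩).2 - (t ⟨k, h⟩).1 else 0), Finset.prod_range]
  · simp only [Fin.is_lt, dif_pos, Fin.eta]
    rw [ht.prod_comp (fun c => z + (c.2 : ℂ) - (c.1 : ℂ)), Shape.R]
  · intro k hk
    rw [jucysMurphy_eq hk, add_mul, ht.jm_mul hr, smul_mul_assoc, one_mul, ← add_smul, dif_pos hk]
    congr 1
    ring

theorem omegaElement_eq_sum (z : ℂ) : omegaElement p z = ∑ μ : Shape p, μ.R z • μ.proj := by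
  rw [← mul_one (omegaElement p z), ← sum_proj, Finset.mul_sum]
  exact Finset.sum_congr rfl fun μ _ => omegaElement_mul_proj z μ

theorem isPseudoInverse_omegaElement (p : ℕ) (z : ℂ) :
    IsPseudoInverse (omegaElement p z) (weingartenU p z) := by
  rw [omegaElement_eq_sum, weingartenU]
  exact isPseudoInverse_sum_smul (fun μ => μ.proj_mul_self)
    (fun μ ν h => Shape.proj_mul_proj h) _

end JMBrauer

end

noncomputable section

namespace JMBrauer

open Equiv (Perm swap)

variable {n m p : ℕ}

/-! ### Double cosets of the hyperoctahedral group -/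

/-- The point `2 k`, for `k` counted from `0`. -/
def evenPt : Fin p ↪ Fin (2 * p) :=
  ⟨fun k => ⟨2 * k.val, by omega⟩, fun a b h => by
    rw [Fin.ext_iff] at h ⊢
    simp only at h
    omega⟩

@[simp]
theorem evenPt_val (k : Fin p) : (evenPt k).val = 2 * k.val := rfl

theorem exists_evenPt {x : Fin (2 * p)} (h : x.val % 2 = 0) : ∃ k, evenPt k = x :=
  ⟨⟨x.val / 2, exists_val_div x⟩, Fin.ext (by rw [evenPt_val]; simp only; omega)⟩

theorem mate_evenPt_val (k : Fin p) : (mate (evenPt k)).val = 2 * k.val + 1 := by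
  rw [mate_val, if_pos (by simp), evenPt_val]

theorem exists_mate_evenPt {x : Fin (2 * p)} (h : x.val % 2 ≠ 0) : ∃ k, mate (evenPt k) = x :=
  ⟨⟨x.val / 2, exists_val_div x⟩, Fin.ext (by rw [mate_evenPt_val]; simp only; omega)⟩

theorem eq_of_evenPt {f g : Fin (2 * p) → Fin (2 * p)} (h0 : ∀ k, f (evenPt k) = g (evenPt k))
    (h1 : ∀ k, f (mate (evenPt k)) = g (mate (evenPt k))) (x : Fin (2 * p)) : f x = g x := by
  by_cases h : x.val % 2 = 0
  · obtain ⟨k, rfl⟩ := exists_evenPt h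
    exact h0 k
  · obtain ⟨k, rfl⟩ := exists_mate_evenPt h
    exact h1 k

/-- The permutations of the points `2 k`, `k ≥ 0`. -/
def evenHom : Perm (Fin p) →* Perm (Fin (2 * p)) := Equiv.Perm.viaEmbeddingHom evenPt

theorem evenHom_evenPt (σ : Perm (Fin p)) (k : Fin p) : evenHom σ (evenPt k) = evenPt (σ k) :=
  Equiv.Perm.viaEmbedding_apply σ evenPt k

theorem evenHom_odd (σ : Perm (Fin p)) {x : Fin (2 * p)} (h : x.val % 2 ≠ 0) :
    evenHom σ x = x := by
  refine Equiv.Perm.viaEmbedding_apply_of_notMem σ evenPt x ?_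
  rintro ⟨k, rfl⟩
  simp at h

theorem evenHom_mate (σ : Perm (Fin p)) (k : Fin p) :
    evenHom σ (mate (evenPt k)) = mate (evenPt k) :=
  evenHom_odd σ (by rw [mate_evenPt_val]; omega)

theorem pairPerm_evenPt (τ : Perm (Fin p)) (k : Fin p) :
    pairPerm τ (evenPt k) = evenPt (τ k) := by
  refine Fin.ext ?_
  have : (⟨(evenPt k).val / 2, exists_val_div _⟩ : Fin p) = k := Fin.ext (by simp)
  rw [pairPerm_val, this]
  simp

theorem pairPerm_mate (τ : Perm (Fin p)) (x : Fin (2 * p)) :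
    pairPerm τ (mate x) = mate (pairPerm τ x) :=
  (mem_hyperoctahedral _).1 (pairPerm_mem τ) x

theorem pairPerm_mul_evenHom (σ τ : Perm (Fin p)) :
    pairPerm τ * evenHom σ = evenHom (τ * σ * τ⁻¹) * pairPerm τ := by
  refine Equiv.ext (eq_of_evenPt (fun k => ?_) fun k => ?_)
  · simp only [Equiv.Perm.mul_apply, evenHom_evenPt, pairPerm_evenPt, perm_inv_apply_self]
  · simp only [Equiv.Perm.mul_apply, evenHom_mate, pairPerm_mate, pairPerm_evenPt]

/-- The involution exchanging the points of each block of `π₀`. -/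
def matePerm : Perm (Fin (2 * p)) := ⟨mate, mate, mate_mate, mate_mate⟩

theorem matePerm_apply (x : Fin (2 * p)) : matePerm x = mate x := rfl

/-- A permutation of the pairs acts by two conjugate copies of `τ`, on the even and on the odd
points, so its sign is `1`. -/
theorem pairPerm_eq (τ : Perm (Fin p)) :
    pairPerm τ = evenHom τ * (matePerm * evenHom τ * matePerm⁻¹) := by
  have h : ∀ x : Fin (2 * p), matePerm⁻¹ x = mate x := fun x => rfl
  refine Equiv.ext (eq_of_evenPt (fun k => ?_) fun k => ?_)
  · simp only [Equiv.Perm.mul_apply, h, matePerm_apply, evenHom_evenPt, pairPerm_evenPt,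
      evenHom_mate, mate_mate]
  · simp only [Equiv.Perm.mul_apply, h, matePerm_apply, evenHom_evenPt, pairPerm_evenPt,
      evenHom_mate, mate_mate, pairPerm_mate]

theorem sign_pairPerm (τ : Perm (Fin p)) : Equiv.Perm.sign (pairPerm τ) = 1 := by
  rw [pairPerm_eq, map_mul, map_mul, map_mul, map_inv, mul_inv_cancel_comm, Int.units_mul_self]

/-- Two involutions without fixed points have a common transversal. -/
theorem exists_transversal {α : Type*} [LinearOrder α] {s t : Perm α}
    (hs : ∀ x, s (s x) = x) (ht : ∀ x, t (t x) = x) (hs' : ∀ x, s x ≠ x) (ht' : ∀ x, t x ≠ x) :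
    ∃ B : Set α, (∀ x, s x ∈ B ↔ x ∉ B) ∧ ∀ x, t x ∈ B ↔ x ∉ B := by
  set r : Perm α := s * t with hr
  have hss : s * s = 1 := Equiv.ext hs
  have htt : t * t = 1 := Equiv.ext ht
  have hsi : s⁻¹ = s := inv_eq_of_mul_eq_one_left hss
  have hti : t⁻¹ = t := inv_eq_of_mul_eq_one_left htt
  have hri : s * r * s⁻¹ = r⁻¹ := by
    rw [hr, mul_inv_rev, hsi, hti, ← mul_assoc, hss, one_mul]
  have hz : ∀ k : ℤ, s * r ^ k = r ^ (-k) * s := fun k => by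
    have := conj_zpow (i := k) (a := s) (b := r)
    rw [hri, inv_zpow'] at this
    rw [this, inv_mul_cancel_right]
  -- If `s x = r^k x`, then the relation `s r s⁻¹ = r⁻¹` gives a fixed point of `s` for even `k` and
  -- one of `t` for odd `k`.
  have hne : ∀ x, ¬r.SameCycle x (s x) := by
    rintro x ⟨k, hk⟩
    obtain ⟨l, hl | hl⟩ := Int.even_or_odd' k
    · refine hs' ((r ^ l) x) ?_
      rw [← Equiv.Perm.mul_apply, hz, Equiv.Perm.mul_apply, ← hk, ← Equiv.Perm.mul_apply,
        ← zpow_add]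
      congr 2
      omega
    · refine ht' ((r ^ l) x) (s.injective ?_)
      have h1 : s (t ((r ^ l) x)) = (r ^ (l + 1)) x := by
        rw [add_comm, zpow_add, zpow_one]
        rfl
      rw [h1, ← Equiv.Perm.mul_apply, hz, Equiv.Perm.mul_apply, ← hk, ← Equiv.Perm.mul_apply,
        ← zpow_add]
      congr 2
      omega
  -- So `s` pairs the cycles of `r = s t` without fixed cycle. The order of their representatives
  -- selects one cycle of each pair; `t x` and `s x` lie in the same cycle, so the selection is a
  -- transversal for `t` too.
  let c : α → α := fun x => (Quotient.mk (Equiv.Perm.SameCycle.setoid r) x).out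
  have hc : ∀ x y, c x = c y ↔ r.SameCycle x y := fun x y =>
    Quotient.out_inj.trans Quotient.eq
  have h1 : ∀ x, c (s x) < c (s (s x)) ↔ ¬c x < c (s x) := fun x => by
    rw [hs, not_lt]
    exact ⟨le_of_lt, fun h => lt_of_le_of_ne h fun e => hne x ((hc _ _).1 e.symm)⟩
  refine ⟨{x | c x < c (s x)}, h1, fun x => ?_⟩
  have h2 : c (t x) = c (s x) := (hc _ _).2 ⟨1, by rw [zpow_one, hr, Equiv.Perm.mul_apply, ht]⟩
  have h3 : c (s (t x)) = c x := (hc _ _).2 (Equiv.Perm.SameCycle.symm ⟨1, by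
    rw [zpow_one, hr, Equiv.Perm.mul_apply]⟩)
  change c (t x) < c (s (t x)) ↔ _
  have h4 := h1 x
  rw [hs] at h4
  rw [h2, h3]
  exact h4

/-- An element of the hyperoctahedral group taking the points `2 k` to a given transversal. -/
theorem exists_hyperoctahedral_transversal {B : Set (Fin (2 * p))} (hB : ∀ x, mate x ∈ B ↔ x ∉ B) :
    ∃ h ∈ hyperoctahedral p, ∀ x, h x ∈ B ↔ x.val % 2 = 0 := by
  classical
  let f : Fin (2 * p) → Fin (2 * p) := fun x => if x ∈ B ↔ x.val % 2 = 0 then x else mate x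
  have hmod : ∀ x : Fin (2 * p), (mate x).val % 2 = 0 ↔ ¬x.val % 2 = 0 := fun x => by
    rw [mate_val]; split_ifs <;> omega
  have hc : ∀ x, (mate x ∈ B ↔ (mate x).val % 2 = 0) ↔ (x ∈ B ↔ x.val % 2 = 0) := fun x => by
    rw [hB, hmod]
    exact not_iff_not
  have hm : ∀ x, f (mate x) = mate (f x) := fun x => by
    simp only [f, hc]
    split_ifs <;> rfl
  have hf : ∀ x, f (f x) = x := fun x => by
    by_cases h : x ∈ B ↔ x.val % 2 = 0
    · have : f x = x := if_pos h
      rw [this, this]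
    · have : f x = mate x := if_neg h
      rw [this, hm, this, mate_mate]
  refine ⟨⟨f, f, hf, hf⟩, (mem_hyperoctahedral _).2 hm, fun x => ?_⟩
  change f x ∈ B ↔ _
  by_cases h : x ∈ B ↔ x.val % 2 = 0
  · have : f x = x := if_pos h
    rw [this, h]
  · have : f x = mate x := if_neg h
    rw [this, hB]
    tauto

theorem exists_evenHom_eq {g : Perm (Fin (2 * p))}
    (h : ∀ x, (g x).val % 2 = 0 ↔ x.val % 2 = 0) (h1 : ∀ k, g (mate (evenPt k)) = mate (evenPt k)) :
    ∃ σ, g = evenHom σ := by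
  choose f hf using fun k => exists_evenPt ((h (evenPt k)).2 (by simp))
  have hinj : Function.Injective f := fun a b hab => by
    have := congrArg evenPt hab
    rw [hf, hf] at this
    exact evenPt.injective (g.injective this)
  refine ⟨Equiv.ofBijective f (Finite.injective_iff_bijective.1 hinj),
    Equiv.ext (eq_of_evenPt (fun k => ?_) fun k => ?_)⟩
  · rw [evenHom_evenPt, ← hf]
    rfl
  · rw [h1, evenHom_mate]

theorem exists_pairPerm_eq {g : Perm (Fin (2 * p))}
    (h : ∀ x, (g x).val % 2 = 0 ↔ x.val % 2 = 0) :
    ∃ τ, ∀ k, g (mate (evenPt k)) = pairPerm τ (mate (evenPt k)) := by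
  choose f hf using fun k => exists_mate_evenPt (x := g (mate (evenPt k)))
    (by rw [Ne, h, mate_evenPt_val]; omega)
  have hinj : Function.Injective f := fun a b hab => by
    have := congrArg (fun k => mate (evenPt k)) hab
    simp only [hf] at this
    have h2 := g.injective this
    have h3 := congrArg mate h2
    rw [mate_mate, mate_mate] at h3
    exact evenPt.injective h3
  refine ⟨Equiv.ofBijective f (Finite.injective_iff_bijective.1 hinj), fun k => ?_⟩
  rw [pairPerm_mate, pairPerm_evenPt, ← hf]
  rfl

/-- The pairings `π₀` and `g π₀` have a common transversal `B`. Elements `h₁` and `h₂` of `ℋ` carry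
the even points to `B` and to `g⁻¹ B`, so `h₁⁻¹ g h₂` preserves parity; a permutation of the pairs
corrects its action on the odd points. -/
theorem exists_double_coset (g : Perm (Fin (2 * p))) : ∃ h ∈ hyperoctahedral p,
    ∃ h' ∈ hyperoctahedral p, ∃ σ, g = h * evenHom σ * h' := by
  obtain ⟨B, hB1, hB2⟩ := exists_transversal (s := matePerm) (t := g * matePerm * g⁻¹)
    (fun x => mate_mate x) (fun x => by simp [matePerm_apply]) (fun x => mate_ne x)
    (fun x h => mate_ne (g⁻¹ x) (g.injective (h.trans (perm_apply_inv_self g x).symm)))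
  obtain ⟨h1, hh1, hB1'⟩ := exists_hyperoctahedral_transversal hB1
  obtain ⟨h2, hh2, hB2'⟩ := exists_hyperoctahedral_transversal (B := {x | g x ∈ B}) fun x => by
    have := hB2 (g x)
    rw [Equiv.Perm.mul_apply, Equiv.Perm.mul_apply, perm_inv_apply_self] at this
    exact this
  have hpar : ∀ x, ((h1⁻¹ * g * h2) x).val % 2 = 0 ↔ x.val % 2 = 0 := fun x => by
    rw [← hB1', ← hB2' x, Equiv.Perm.mul_apply, Equiv.Perm.mul_apply, perm_apply_inv_self]
    rfl
  obtain ⟨τ, hτ⟩ := exists_pairPerm_eq hpar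
  have hpar' : ∀ x, ((pairPerm τ)⁻¹ x).val % 2 = 0 ↔ x.val % 2 = 0 := fun x => by
    conv_rhs => rw [← perm_apply_inv_self (pairPerm τ) x]
    rw [pairPerm_val]
    omega
  obtain ⟨σ, hσ⟩ := exists_evenHom_eq (g := (pairPerm τ)⁻¹ * (h1⁻¹ * g * h2))
    (fun x => by rw [Equiv.Perm.mul_apply, hpar', hpar])
    (fun k => by rw [Equiv.Perm.mul_apply, hτ, perm_inv_apply_self])
  refine ⟨h1 * pairPerm τ, mul_mem hh1 (pairPerm_mem τ), h2⁻¹, inv_mem hh2, σ, ?_⟩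
  rw [← hσ]
  group

/-- The double coset of `σ`, averaged. -/
def evenSym (σ : Perm (Fin p)) : GA (2 * p) :=
  avg (hyperoctahedral p) * perm (evenHom σ) * avg (hyperoctahedral p)

/-- Permutations of the pairs belong to `ℋ` and induce on the even points all conjugations. -/
theorem evenSym_conj (σ τ : Perm (Fin p)) : evenSym (τ * σ * τ⁻¹) = evenSym σ := by
  have h1 : avg (hyperoctahedral p) * perm (pairPerm τ) = _ := avg_mul_perm _ (pairPerm_mem τ)
  have h2 : perm (pairPerm τ) * avg (hyperoctahedral p) = _ := perm_mul_avg _ (pairPerm_mem τ)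
  rw [evenSym, evenSym]
  conv_lhs => enter [2]; rw [← h2]
  rw [mul_assoc, ← mul_assoc (perm _) (perm _), ← perm_mul, ← pairPerm_mul_evenHom, perm_mul,
    ← mul_assoc, ← mul_assoc, h1]

theorem avg_mul_mul_avg_mem_span (x : GA (2 * p)) :
    avg (hyperoctahedral p) * x * avg (hyperoctahedral p) ∈
      Submodule.span ℂ (Set.range (evenSym (p := p))) := by
  induction x using ga_induction with
  | hp g =>
    obtain ⟨h, hh, h', hh', σ, rfl⟩ := exists_double_coset g
    refine Submodule.subset_span ⟨σ, ?_⟩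
    rw [perm_mul, perm_mul, ← mul_assoc, ← mul_assoc, avg_mul_perm _ hh, mul_assoc _ (perm h'),
      perm_mul_avg _ hh', evenSym]
  | ha x y hx hy => rw [mul_add, add_mul]; exact add_mem hx hy
  | hs r x hx => rw [mul_smul_comm, smul_mul_assoc]; exact Submodule.smul_mem _ _ hx

end JMBrauer

end

noncomputable section

namespace JMBrauer

open Equiv (Perm swap)

variable {n m p : ℕ}

/-! ### Products of commuting factors -/

theorem commute_jm_jm (a b : Fin n) : Commute (jm a) (jm b) := by
  have key : ∀ a b : Fin n, a < b → Commute (jm a) (jm b) := fun a b h => by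
    have h1 := commute_castHom_jm (m := b.val) b.2.le (q := b) le_rfl (jm ⟨a.val, h⟩)
    rw [mapGA_castHom_jm] at h1
    exact h1
  rcases lt_trichotomy a b with h | rfl | h
  · exact key a b h
  · exact Commute.refl _
  · exact (key b a h).symm

theorem flip_jm (a : Fin n) : flip (jm a) = jm a := by
  rw [jm, map_sum]
  exact Finset.sum_congr rfl fun b _ => flip_swap b a

theorem commute_chain {A : Type*} [Monoid A] {x : ℕ → A} {y : A} {k : ℕ}
    (h : ∀ i < k, Commute y (x i)) : Commute y (chain x k) := by
  induction k with
  | zero => exact Commute.one_right y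
  | succ k ih => exact (h k (by omega)).mul_right (ih fun i hi => h i (by omega))

theorem flip_chain {x : ℕ → GA n} {k : ℕ} (hf : ∀ i < k, flip (x i) = x i)
    (hc : ∀ i < k, ∀ j < k, Commute (x i) (x j)) : flip (chain x k) = chain x k := by
  induction k with
  | zero => exact flip_one
  | succ k ih =>
    rw [chain, flip_mul, hf k (by omega),
      ih (fun i hi => hf i (by omega)) fun i hi j hj => hc i (by omega) j (by omega)]
    exact (commute_chain fun i hi => hc k (by omega) i (by omega)).symm.eq

theorem map_chain {A B F : Type*} [Monoid A] [Monoid B] [FunLike F A B] [MonoidHomClass F A B]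
    (f : F) (x : ℕ → A) (k : ℕ) : f (chain x k) = chain (fun i => f (x i)) k := by
  induction k with
  | zero => exact map_one f
  | succ k ih => rw [chain, map_mul, ih, chain]

theorem chain_congr {A : Type*} [Monoid A] {x y : ℕ → A} {k : ℕ} (h : ∀ i < k, x i = y i) :
    chain x k = chain y k := by
  induction k with
  | zero => rfl
  | succ k ih => rw [chain, chain, h k (by omega), ih fun i hi => h i (by omega)]

/-- The factor `z + X_{2k+1}`. -/
def oddFactor (n : ℕ) (z : ℂ) (k : ℕ) : GA n := z • 1 + jucysMurphy n (2 * k + 1)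

theorem oddFactor_eq (z : ℂ) {k : ℕ} (h : 2 * k < n) :
    oddFactor n z k = z • 1 + jm ⟨2 * k, h⟩ := by
  rw [oddFactor, jucysMurphy_eq h]

theorem commute_oddFactor (z : ℂ) {i j : ℕ} (hi : 2 * i < n) (hj : 2 * j < n) :
    Commute (oddFactor n z i) (oddFactor n z j) := by
  rw [oddFactor_eq z hi, oddFactor_eq z hj]
  exact ((smul_one_commute z _).add_left
    ((smul_one_commute z _).symm.add_right (commute_jm_jm _ _)))

theorem flip_oddFactor (z : ℂ) {i : ℕ} (hi : 2 * i < n) :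
    flip (oddFactor n z i) = oddFactor n z i := by
  rw [oddFactor_eq z hi, map_add, map_smul, flip_one, flip_jm]

theorem mapGA_oddFactor (h : m ≤ n) (z : ℂ) {k : ℕ} (hk : 2 * k < m) :
    mapGA (castHom h) (oddFactor m z k) = oddFactor n z k := by
  rw [oddFactor, map_add, map_smul, map_one, mapGA_castHom_jucysMurphy h hk, oddFactor]

/-- An element of `ℋ` fixes `π₀`, so it carries the join of `π` and `π₀` to that of its image and
`π₀`. -/
theorem blocksJoin_smul {h : Perm (Fin (2 * p))} (hh : h ∈ hyperoctahedral p)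
    (π : PairPartition p) : blocksJoin (h • π) (basePairing p) = blocksJoin π (basePairing p) := by
  have key : ∀ g ∈ hyperoctahedral p, ∀ (π : PairPartition p) (u v : Fin (2 * p)),
      (π.1 ⊔ (basePairing p).1) u v → ((g • π).1 ⊔ (basePairing p).1) (g u) (g v) := by
    intro g hg π u v
    have hle : π.1 ⊔ (basePairing p).1 ≤ ((g • π).1 ⊔ (basePairing p).1).comap g := by
      refine sup_le (fun u v huv => ?_) fun u v huv => ?_
      · refine (le_sup_left : (g • π).1 ≤ _) ?_
        rw [smul_rel, perm_inv_apply_self, perm_inv_apply_self]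
        exact huv
      · refine (le_sup_right : (basePairing p).1 ≤ (g • π).1 ⊔ _) ?_
        rw [basePairing_rel] at huv ⊢
        rcases huv with rfl | rfl
        · exact Or.inl rfl
        · exact Or.inr ((mem_hyperoctahedral g).1 hg u)
    exact fun huv => hle huv
  refine (Nat.card_congr (Quotient.congr h fun u v => ⟨key h hh π u v, fun huv => ?_⟩)).symm
  have := key h⁻¹ (inv_mem hh) _ _ _ huv
  rwa [inv_smul_smul, perm_inv_apply_self, perm_inv_apply_self] at this

theorem avg_mul_gramElement_mul_avg {s : PairPartition p → Perm (Fin (2 * p))} (hs : IsSection s)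
    (z : ℂ) : avg (hyperoctahedral p) * (gramElement s z * avg (hyperoctahedral p)) =
      gramElement s z * avg (hyperoctahedral p) := by
  refine avg_mul_of_forall _ fun h hh => ?_
  rw [gramElement, Finset.sum_mul, Finset.mul_sum]
  refine Fintype.sum_equiv (MulAction.toPerm h) _ _ fun π => ?_
  rw [MulAction.toPerm_apply, blocksJoin_smul hh, smul_mul_assoc, smul_mul_assoc,
    perm_section_mul_avg hs, mul_smul_comm]

/-- Write `g` for the product and `P` for the average. Then `g P = 𝐆(z) P` is left invariant under
`ℋ`, that is `P g P = g P`. The factors of `g` commute and are fixed by the inversion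
anti-automorphism, so `g` is fixed as well, and applying it gives `P g P = P g`. -/
theorem commute_avg_chain (p : ℕ) (z : ℂ) :
    Commute (avg (hyperoctahedral p)) (chain (oddFactor (2 * p) z) p) := by
  obtain ⟨s, hs⟩ := exists_isSection p
  set P := avg (hyperoctahedral p)
  set g := chain (oddFactor (2 * p) z) p
  have h1 : gramElement s z * P = g * P := gramElement_mul_avg hs z
  have h2 : P * (g * P) = g * P := by rw [← h1]; exact avg_mul_gramElement_mul_avg hs z
  have h3 : flip g = g := flip_chain (fun i hi => flip_oddFactor z (by omega))
    fun i hi j hj => commute_oddFactor z (by omega) (by omega)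
  have h4 := congrArg flip h2
  rw [flip_mul, flip_mul, h3, flip_avg, mul_assoc] at h4
  exact h4.symm.trans h2

theorem two_mul_le {m p : ℕ} (h : m ≤ p) : 2 * m ≤ 2 * p := by omega

/-- The image of `𝒫_{ℋ_{2m}}` in `ℂ[𝔖_{2p}]`. -/
def subAvg (h : m ≤ p) : GA (2 * p) := mapGA (castHom (two_mul_le h)) (avg (hyperoctahedral m))

theorem castHom_mem_hyperoctahedral (h : m ≤ p) {σ : Perm (Fin (2 * m))}
    (hσ : σ ∈ hyperoctahedral m) : castHom (two_mul_le h) σ ∈ hyperoctahedral p := by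
  rw [mem_hyperoctahedral] at hσ ⊢
  intro x
  by_cases hx : x.val < 2 * m
  · have h1 : mate x = Fin.castLE (two_mul_le h) (mate ⟨x.val, hx⟩) := rfl
    have h2 : x = Fin.castLE (two_mul_le h) ⟨x.val, hx⟩ := rfl
    rw [h1, castHom_castLE, hσ]
    conv_rhs => rw [h2, castHom_castLE]
    rfl
  · have hm : 2 * m ≤ (mate x).val := by rw [mate_val]; split_ifs <;> omega
    rw [castHom_of_le _ _ hm, castHom_of_le _ _ (not_lt.1 hx)]

theorem avg_mul_subAvg (h : m ≤ p) :
    avg (hyperoctahedral p) * subAvg h = avg (hyperoctahedral p) :=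
  avg_mul_mapGA_avg fun _ hσ => castHom_mem_hyperoctahedral h hσ

theorem subAvg_mul_avg (h : m ≤ p) :
    subAvg h * avg (hyperoctahedral p) = avg (hyperoctahedral p) :=
  mapGA_avg_mul_avg fun _ hσ => castHom_mem_hyperoctahedral h hσ

theorem commute_subAvg_chain (h : m ≤ p) (z : ℂ) :
    Commute (subAvg h) (chain (oddFactor (2 * p) z) m) := by
  have h1 := (commute_avg_chain m z).map (mapGA (castHom (two_mul_le h)))
  rwa [map_chain, chain_congr fun i hi => mapGA_oddFactor (two_mul_le h) z (by omega)] at h1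

/-! ### Tableaux of shape `2λ` -/

theorem Shape.mem_double {μ : Shape p} {c : ℕ × ℕ} :
    c ∈ μ.double.1.cells ↔ (c.1, c.2 / 2) ∈ μ.1.cells := by
  obtain ⟨i, j⟩ := c
  change (i, j) ∈ μ.1.cells.biUnion _ ↔ _
  simp only [Finset.mem_biUnion, Finset.mem_insert, Finset.mem_singleton, Prod.mk.injEq]
  constructor
  · rintro ⟨⟨a, b⟩, hab, h⟩
    have : (i, j / 2) = (a, b) := Prod.ext (by simp only; omega) (by simp only; omega)
    rwa [this]
  · exact fun h => ⟨_, h, by simp only [true_and]; omega⟩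

theorem Shape.double_injective : Function.Injective (Shape.double (n := p)) := by
  intro μ ν h
  refine Subtype.ext (YoungDiagram.ext (Finset.ext fun c => ?_))
  have h1 : ∀ μ : Shape p, c ∈ μ.1.cells ↔ (c.1, 2 * c.2) ∈ μ.double.1.cells := fun μ => by
    rw [mem_double]
    simp
  rw [h1, h1, h]

/-- The tableau of shape `2λ` obtained by replacing `k` by the pair of points `2k, 2k + 1`. -/
def doubleT (t : Fin p → ℕ × ℕ) (x : Fin (2 * p)) : ℕ × ℕ :=
  ((t ⟨x.val / 2, exists_val_div x⟩).1, 2 * (t ⟨x.val / 2, exists_val_div x⟩).2 + x.val % 2)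

theorem IsTableau.doubleT {μ : Shape p} {t : Fin p → ℕ × ℕ} (ht : IsTableau μ t) :
    IsTableau μ.double (doubleT t) := by
  refine ⟨fun x y h => ?_, fun x => ?_⟩
  · obtain ⟨h1, h2⟩ := Prod.ext_iff.1 h
    simp only [JMBrauer.doubleT] at h1 h2
    have h3 := congrArg Fin.val (ht.1 (Prod.ext h1 (by omega)))
    simp only at h3
    exact Fin.ext (by omega)
  · rw [Shape.mem_double, JMBrauer.doubleT]
    have : ∀ a b : ℕ, (2 * a + b % 2) / 2 = a := fun a b => by omega
    simp only [this]
    exact ht.2 _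

theorem doubleT_mate (t : Fin p → ℕ × ℕ) (x : Fin (2 * p)) :
    (doubleT t (mate x)).1 = (doubleT t x).1 ∧
      (doubleT t (mate x)).2 / 2 = (doubleT t x).2 / 2 ∧
      (doubleT t x).2 % 2 = x.val % 2 := by
  have h1 : (⟨(mate x).val / 2, exists_val_div _⟩ : Fin p) = ⟨x.val / 2, exists_val_div x⟩ :=
    Fin.ext (mate_div x)
  simp only [doubleT, h1]
  refine ⟨trivial, ?_, ?_⟩ <;> omega

theorem mate_mod (x : Fin (2 * p)) : (mate x).val % 2 = 1 - x.val % 2 := by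
  rw [mate_val]; split_ifs <;> omega

/-- The average absorbs `(mate a, a)`, and `(mate a, a)(a k) = (a k)(mate a, k)`, so the product
equals its own opposite. -/
theorem subAvg_mul_swap_mul {v : GA (2 * p)} (h : m ≤ p) {a k : Fin (2 * p)} (ha : a.val < 2 * m)
    (hk : 2 * m ≤ k.val) (hv : perm (swap (mate a) k) * v = -v) :
    subAvg h * (perm (swap a k) * v) = 0 := by
  have hne : k ≠ a := fun e => by rw [e] at hk; omega
  have hm : (mate a).val < 2 * m := by rw [mate_val]; split_ifs <;> omega
  have hne' : k ≠ mate a := fun e => by rw [e] at hk; omega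
  have h1 : subAvg h * perm (swap (mate a) a) = subAvg h := by
    have h2 : castHom (two_mul_le h) (swap (mate ⟨a.val, ha⟩) ⟨a.val, ha⟩) = swap (mate a) a :=
      castHom_swap _ _ _
    rw [subAvg, ← h2, ← mapGA_perm, ← map_mul, avg_mul_perm _ (swap_mate_mem _)]
  have h3 : perm (swap (mate a) a) * perm (swap a k) = perm (swap a k) * perm (swap (mate a) k) := by
    rw [perm_conj_swap (swap a k), Equiv.swap_apply_right,
      Equiv.swap_apply_of_ne_of_ne (mate_ne a) hne'.symm]
  have h4 : subAvg h * (perm (swap a k) * v) = -(subAvg h * (perm (swap a k) * v)) := by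
    conv_lhs => rw [← h1, mul_assoc, ← mul_assoc (perm _) (perm _), h3, mul_assoc, hv, mul_neg,
      mul_neg]
  exact eq_zero_of_eq_neg h4

/-- The doubled tableau is filled by double columns, so it is not a column reading. Before the point
`k = 2m` come the points to its left, those above it, and those above it in the next column. The
first two families give `2j` and `-i`; the third is killed by the average over the pairs already
placed. -/
theorem IsTableau.subAvg_mul_oddFactor {μ : Shape p} {t : Fin p → ℕ × ℕ} (ht : IsTableau μ t)
    (hr : IsColumnReading t) (z : ℂ) (hm : m < p) :
    subAvg hm.le * (oddFactor (2 * p) z m * (colT (JMBrauer.doubleT t) * rowT (JMBrauer.doubleT t))) =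
      (z + 2 * (t ⟨m, hm⟩).2 - (t ⟨m, hm⟩).1) •
        (subAvg hm.le * (colT (JMBrauer.doubleT t) * rowT (JMBrauer.doubleT t))) := by
  set T := JMBrauer.doubleT t with hT
  have hTt : IsTableau μ.double T := ht.doubleT
  set k : Fin (2 * p) := ⟨2 * m, by omega⟩ with hk
  have hkh : (⟨k.val / 2, exists_val_div k⟩ : Fin p) = ⟨m, hm⟩ := Fin.ext (by simp [hk])
  have hTk : T k = ((t ⟨m, hm⟩).1, 2 * (t ⟨m, hm⟩).2) := by
    rw [hT, JMBrauer.doubleT, hkh]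
    simp [hk]
  have hlt : ∀ a : Fin (2 * p), a < k ↔ ((T a).2 < (T k).2 ∨
      ((T a).2 = (T k).2 ∧ (T a).1 < (T k).1)) ∨ ((T a).2 = (T k).2 + 1 ∧ (T a).1 < (T k).1) := by
    intro a
    have h1 := hr ⟨a.val / 2, exists_val_div a⟩ ⟨m, hm⟩
    have h2 : a < k ↔ (⟨a.val / 2, exists_val_div a⟩ : Fin p) < ⟨m, hm⟩ := by
      rw [Fin.lt_def, Fin.lt_def, hk]
      simp only
      omega
    rw [h2, h1, hTk]
    simp only [hT, JMBrauer.doubleT]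
    omega
  have hd : Finset.univ.filter (fun a : Fin (2 * p) => a < k) =
      (Finset.univ.filter (fun a => (T a).2 < (T k).2) ∪
        Finset.univ.filter (fun a => (T a).2 = (T k).2 ∧ (T a).1 < (T k).1)) ∪
        Finset.univ.filter (fun a => (T a).2 = (T k).2 + 1 ∧ (T a).1 < (T k).1) := by
    rw [← Finset.filter_or, ← Finset.filter_or]
    exact Finset.filter_congr fun a _ => hlt a
  -- The column of `k` is even, so a point `a` of the next column has its mate in the column of `k`,
  -- where `(mate a, k)` acts on the antisymmetrizer by `-1`.
  have h0 : subAvg hm.le * ∑ a : Fin (2 * p) with (T a).2 = (T k).2 + 1 ∧ (T a).1 < (T k).1,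
      perm (swap a k) * (colT T * rowT T) = 0 := by
    rw [Finset.mul_sum]
    refine Finset.sum_eq_zero fun a ha => ?_
    rw [Finset.mem_filter_univ] at ha
    obtain ⟨ha2, ha1⟩ := ha
    have hak : a.val < 2 * m := (hlt a).2 (Or.inr ⟨ha2, ha1⟩)
    refine subAvg_mul_swap_mul hm.le hak le_rfl ?_
    obtain ⟨-, h5, h6⟩ := doubleT_mate t a
    obtain ⟨-, -, h7⟩ := doubleT_mate t (mate a)
    rw [← hT] at h5 h6 h7
    have h8 := mate_mod a
    have h9 : (T k).2 % 2 = 0 := by rw [hTk]; simp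
    rw [← mul_assoc, swap_mul_colSym _ (by omega), neg_mul]
    intro e
    have : (mate a).val = 2 * m := by rw [e]
    rw [mate_val] at this
    split_ifs at this <;> omega
  have hjm : subAvg hm.le * (jm k * (colT T * rowT T)) =
      (2 * ((t ⟨m, hm⟩).2 : ℂ) - (t ⟨m, hm⟩).1) • (subAvg hm.le * (colT T * rowT T)) := by
    rw [jm, Finset.sum_mul, hd, Finset.sum_union, Finset.sum_union, hTt.sum_left, hTt.sum_above,
      mul_add, h0, add_zero, ← add_smul, mul_smul_comm, hTk]
    · push_cast
      rw [sub_eq_add_neg]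
    · exact Finset.disjoint_filter.2 fun a _ h1 h2 => h1.ne h2.1
    · rw [← Finset.filter_or]
      exact Finset.disjoint_filter.2 fun a _ h1 h2 => by omega
  rw [oddFactor_eq z k.2, add_mul, mul_add, hjm, smul_mul_assoc, one_mul, mul_smul_comm, ← add_smul]
  congr 1
  ring

/-- The eigenvalue equation of a factor holds only behind the average over the earlier pairs. That
average may be inserted next to the factor: it is absorbed by `P` and commutes with the product of
the earlier factors. -/
theorem IsTableau.avg_mul_chain {μ : Shape p} {t : Fin p → ℕ × ℕ} (ht : IsTableau μ t)
    (hr : IsColumnReading t) (z : ℂ) (hm : m ≤ p) :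
    avg (hyperoctahedral p) * (chain (oddFactor (2 * p) z) m *
        (colT (JMBrauer.doubleT t) * rowT (JMBrauer.doubleT t))) =
      (∏ k : Fin m, (z + 2 * (t (Fin.castLE hm k)).2 - (t (Fin.castLE hm k)).1)) •
        (avg (hyperoctahedral p) * (colT (JMBrauer.doubleT t) * rowT (JMBrauer.doubleT t))) := by
  set v := colT (JMBrauer.doubleT t) * rowT (JMBrauer.doubleT t) with hv
  set P := avg (hyperoctahedral p) with hP
  induction m with
  | zero => simp [chain]
  | succ m ih =>
    have hm' : m ≤ p := by omega
    have h1 : Commute (oddFactor (2 * p) z m) (chain (oddFactor (2 * p) z) m) :=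
      commute_chain fun i hi => commute_oddFactor z (by omega) (by omega)
    have h2 := ht.subAvg_mul_oddFactor hr z (m := m) (by omega)
    have h3 := commute_subAvg_chain hm' z
    have h4 : P * subAvg hm' = P := avg_mul_subAvg hm'
    have h5 : ∀ y, P * (chain (oddFactor (2 * p) z) m * y) =
        P * (chain (oddFactor (2 * p) z) m * (subAvg hm' * y)) := fun y => by
      conv_lhs => rw [← h4]
      rw [mul_assoc, ← mul_assoc (subAvg hm'), h3.eq, mul_assoc]
    rw [chain, h1.eq, mul_assoc, h5, h2, mul_smul_comm, mul_smul_comm, ← h5, ih hm', smul_smul,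
      Fin.prod_univ_castSucc, mul_comm (_ - _)]
    rfl

end JMBrauer

end

noncomputable section

namespace JMBrauer

open Equiv (Perm swap)

variable {n m p : ℕ}

/-! ### The hyperoctahedral invariants of an isotypic component -/

theorem sign_eq_one_of_commute_mate {c : Perm (Fin (2 * p))} (h : c ∈ hyperoctahedral p)
    (hpar : ∀ x, (c x).val % 2 = x.val % 2) : Equiv.Perm.sign c = 1 := by
  obtain ⟨τ, hτ⟩ := exists_pairPerm_eq (g := c) fun x => by rw [hpar]
  have h1 : c = pairPerm τ := by
    rw [mem_hyperoctahedral] at h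
    refine Equiv.ext (eq_of_evenPt (fun k => ?_) hτ)
    have h2 := congrArg mate (hτ k)
    rwa [h, mate_mate, pairPerm_mate, mate_mate] at h2
  rw [h1, sign_pairPerm]

/-- A column permutation of the doubled tableau preserves the parity of points. If `c r ∈ ℋ`, then
`r`, and therefore `c`, commutes with `mate`; so `c` is a permutation of pairs and is even. -/
theorem IsTableau.sign_eq_one {μ : Shape p} {t : Fin p → ℕ × ℕ} (ht : IsTableau μ t)
    {c r : Perm (Fin (2 * p))} (h : c * r ∈ hyperoctahedral p)
    (hc : ∀ x, (JMBrauer.doubleT t (c x)).2 = (JMBrauer.doubleT t x).2)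
    (hr : ∀ x, (JMBrauer.doubleT t (r x)).1 = (JMBrauer.doubleT t x).1) :
    Equiv.Perm.sign c = 1 := by
  have hm := (mem_hyperoctahedral _).1 h
  have hd := doubleT_mate t
  set T := JMBrauer.doubleT t with hT
  have hpar : ∀ x, (c x).val % 2 = x.val % 2 := fun x => by
    rw [← (hd (c x)).2.2, ← (hd x).2.2, hc]
  -- Mates share a row, so the rows agree. The columns have the same half, because `c` preserves
  -- columns and `c r` commutes with `mate`, and they have the same parity.
  have hr' : ∀ x, r (mate x) = mate (r x) := fun x => by
    refine ht.doubleT.1 (Prod.ext ?_ ?_)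
    · rw [hr, (hd x).1, (hd (r x)).1, hr]
    · have h1 := hm x
      rw [Equiv.Perm.mul_apply, Equiv.Perm.mul_apply] at h1
      have h2 := hc (r (mate x))
      rw [h1] at h2
      have h3 := hc (r x)
      have h4 := (hd (c (r x))).2.1
      have h5 := (hd (mate (c (r x)))).2.2
      have h6 := (hd (c (r x))).2.2
      have h7 := (hd (r x)).2.1
      have h8 := (hd (mate (r x))).2.2
      have h9 := (hd (r x)).2.2
      rw [mate_mod] at h5 h8
      change (T _).2 = (T _).2
      omega
  refine sign_eq_one_of_commute_mate ((mem_hyperoctahedral _).2 fun x => ?_) hpar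
  have h1 := hm (r⁻¹ x)
  rwa [Equiv.Perm.mul_apply, hr', Equiv.Perm.mul_apply, perm_apply_inv_self] at h1

theorem coef_mul (x y : GA n) (g : Perm (Fin n)) :
    coef g (x * y) = ∑ σ, coef σ x * coef (σ⁻¹ * g) y := by
  have h := coef_one_mul x (y * perm g⁻¹)
  rw [← mul_assoc, coef_mul_perm] at h
  simpa [coef_mul_perm] using h

/-- The coefficient counts with sign the factorizations `h = c r`, and all these signs are `+1`. -/
theorem IsTableau.exists_coef_eq {μ : Shape p} {t : Fin p → ℕ × ℕ} (ht : IsTableau μ t)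
    {h : Perm (Fin (2 * p))} (hh : h ∈ hyperoctahedral p) : ∃ N : ℕ,
    coef h (colT (JMBrauer.doubleT t) * rowT (JMBrauer.doubleT t)) = N := by
  classical
  refine ⟨∑ c : Perm (Fin (2 * p)), if (∀ x, (JMBrauer.doubleT t (c x)).2 = (JMBrauer.doubleT t x).2) ∧
    ∀ x, (JMBrauer.doubleT t ((c⁻¹ * h) x)).1 = (JMBrauer.doubleT t x).1 then 1 else 0, ?_⟩
  rw [coef_mul, Nat.cast_sum]
  refine Finset.sum_congr rfl fun c _ => ?_
  rw [coef_levelSym, coef_levelSym]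
  by_cases h1 : ∀ x, (JMBrauer.doubleT t (c x)).2 = (JMBrauer.doubleT t x).2
  · by_cases h2 : ∀ x, (JMBrauer.doubleT t ((c⁻¹ * h) x)).1 = (JMBrauer.doubleT t x).1
    · rw [if_pos h1, if_pos h2, if_pos ⟨h1, h2⟩,
        ht.sign_eq_one (r := c⁻¹ * h) (by rwa [mul_inv_cancel_left]) h1 h2]
      simp
    · rw [if_neg h2, mul_zero, if_neg fun h3 => h2 (And.right h3), Nat.cast_zero]
  · rw [if_neg h1, zero_mul, if_neg fun h3 => h1 (And.left h3), Nat.cast_zero]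

/-- The coefficient at the identity is the mean over `ℋ` of the coefficients of `b a`. These are
nonnegative integers and the one at the identity is `1`, so nothing can cancel. -/
theorem IsTableau.avg_mul_ne_zero {μ : Shape p} {t : Fin p → ℕ × ℕ} (ht : IsTableau μ t) :
    avg (hyperoctahedral p) * (colT (JMBrauer.doubleT t) * rowT (JMBrauer.doubleT t)) ≠ 0 := by
  classical
  intro h0
  set v := colT (JMBrauer.doubleT t) * rowT (JMBrauer.doubleT t) with hv
  have h1 : ∀ σ, ∃ N : ℕ, σ ∈ hyperoctahedral p → coef σ⁻¹ v = N := fun σ => by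
    by_cases hσ : σ ∈ hyperoctahedral p
    · obtain ⟨N, hN⟩ := ht.exists_coef_eq (inv_mem hσ)
      exact ⟨N, fun _ => hN⟩
    · exact ⟨0, fun h => absurd h hσ⟩
  choose N hN using h1
  have h2 := congrArg (coef 1) h0
  rw [avg, smul_mul_assoc, map_smul, Finset.sum_mul, map_sum, map_zero, smul_eq_mul,
    mul_eq_zero] at h2
  have h3 := h2.resolve_left (inv_ne_zero (card_subgroup_ne_zero _))
  rw [Finset.sum_congr rfl (g := fun σ => ((N σ : ℕ) : ℂ)), ← Nat.cast_sum, Nat.cast_eq_zero,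
    Finset.sum_eq_zero_iff] at h3
  · have h4 := h3 1 ((Finset.mem_filter_univ _).2 (one_mem _))
    have h5 := hN 1 (one_mem _)
    rw [h4, inv_one, ht.doubleT.coef_one_colT_mul_rowT] at h5
    simp at h5
  · intro σ hσ
    rw [coef_perm_mul, mul_one, hN σ ((Finset.mem_filter_univ _).1 hσ)]

/-- `𝒫_ℋ 𝒫_{2λ}`. -/
def zonal (μ : Shape p) : GA (2 * p) := avg (hyperoctahedral p) * μ.double.proj

theorem zonal_eq (μ : Shape p) : zonal μ = μ.double.proj * avg (hyperoctahedral p) :=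
  (μ.double.commute_proj _).eq

theorem zonal_mul_self (μ : Shape p) : zonal μ * zonal μ = zonal μ := by
  conv_lhs => enter [2]; rw [zonal_eq]
  rw [zonal, mul_assoc, ← mul_assoc μ.double.proj, μ.double.proj_mul_self, ← zonal_eq, zonal,
    ← mul_assoc, avg_mul_avg]

theorem zonal_mul_zonal {μ ν : Shape p} (h : μ ≠ ν) : zonal μ * zonal ν = 0 := by
  rw [zonal_eq ν, zonal, mul_assoc, ← mul_assoc μ.double.proj,
    Shape.proj_mul_proj fun e => h (Shape.double_injective e), zero_mul, mul_zero]

theorem zonal_ne_zero (μ : Shape p) : zonal μ ≠ 0 := by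
  obtain ⟨t, ht, -⟩ := μ.exists_columnReading
  intro h
  refine ht.avg_mul_ne_zero ?_
  rw [← ht.doubleT.proj_mul, ← mul_assoc]
  change zonal μ * _ = 0
  rw [h, zero_mul]

theorem avg_mul_zonal (μ : Shape p) : avg (hyperoctahedral p) * zonal μ = zonal μ := by
  rw [zonal, ← mul_assoc, avg_mul_avg]

theorem zonal_mul_avg (μ : Shape p) : zonal μ * avg (hyperoctahedral p) = zonal μ := by
  rw [zonal_eq, mul_assoc, avg_mul_avg]

/-- The bi-invariant elements are spanned by the averaged double cosets `evenSym σ`, a class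
function on `𝔖_p`, so the same count as for the center applies. No multiplicity of an `ℋ`-invariant
has to be computed. -/
theorem exists_eq_sum_zonal {u : GA (2 * p)} (h1 : avg (hyperoctahedral p) * u = u)
    (h2 : u * avg (hyperoctahedral p) = u) : ∃ c : Shape p → ℂ, u = ∑ μ, c μ • zonal μ := by
  refine exists_eq_sum_smul (f := evenSym) evenSym_conj zonal_ne_zero zonal_mul_self
    (fun _ _ => zonal_mul_zonal) (fun μ => ?_) ?_
  · have := avg_mul_mul_avg_mem_span (zonal μ)
    rwa [avg_mul_zonal, zonal_mul_avg] at this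
  · have := avg_mul_mul_avg_mem_span u
    rwa [h1, h2] at this

theorem zonal_mul_young {μ ν : Shape p} {t : Fin (2 * p) → ℕ × ℕ} (ht : IsTableau ν.double t)
    (h : μ ≠ ν) : zonal μ * (colT t * rowT t) = 0 := by
  rw [← ht.proj_mul, ← mul_assoc, zonal, mul_assoc (avg _),
    Shape.proj_mul_proj fun e => h (Shape.double_injective e), mul_zero, zero_mul]

/-- The coefficients in the basis of the `𝒫_ℋ 𝒫_{2λ}`. -/
theorem eq_sum_zonal {u : GA (2 * p)} (h1 : avg (hyperoctahedral p) * u = u)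
    (h2 : u * avg (hyperoctahedral p) = u) {c : Shape p → ℂ}
    (hc : ∀ μ : Shape p, ∃ t, IsTableau μ t ∧ u * (colT (doubleT t) * rowT (doubleT t)) =
      c μ • (avg (hyperoctahedral p) * (colT (doubleT t) * rowT (doubleT t)))) :
    u = ∑ μ, c μ • zonal μ := by
  obtain ⟨d, hd⟩ := exists_eq_sum_zonal h1 h2
  rw [hd]
  refine Finset.sum_congr rfl fun μ _ => ?_
  obtain ⟨t, ht, h3⟩ := hc μ
  rw [hd, Finset.sum_mul, Finset.sum_eq_single μ, smul_mul_assoc] at h3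
  · have h4 : zonal μ * (colT (doubleT t) * rowT (doubleT t)) =
        avg (hyperoctahedral p) * (colT (doubleT t) * rowT (doubleT t)) := by
      rw [zonal, mul_assoc, ht.doubleT.proj_mul]
    rw [h4] at h3
    -- Only the term of index `μ` survives on `b a` of shape `2μ`, and nonvanishing of `𝒫_ℋ b a`
    -- permits comparing the scalars.
    have h5 : d μ = c μ := smul_left_injective ℂ ht.avg_mul_ne_zero h3
    rw [h5]
  · intro ν _ hν
    rw [smul_mul_assoc, zonal_mul_young ht.doubleT hν, smul_zero]
  · simp

theorem sum_zonal (p : ℕ) : avg (hyperoctahedral p) = ∑ μ : Shape p, zonal μ := by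
  rw [eq_sum_zonal (u := avg (hyperoctahedral p)) (avg_mul_avg _) (avg_mul_avg _) (c := fun _ => 1)]
  · simp only [one_smul]
  · intro μ
    obtain ⟨t, ht, -⟩ := μ.exists_columnReading
    exact ⟨t, ht, by rw [one_smul]⟩

/-- Commuting the average to the left of the product of odd factors exposes the form in which the
eigenvalues on the doubled tableau are known; their product over the cells is `R₂`. -/
theorem gramElement_mul_avg_eq_sum {s : PairPartition p → Perm (Fin (2 * p))} (hs : IsSection s)
    (z : ℂ) : gramElement s z * avg (hyperoctahedral p) = ∑ μ : Shape p, μ.R₂ z • zonal μ := by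
  refine eq_sum_zonal (avg_mul_gramElement_mul_avg hs z) (by rw [mul_assoc, avg_mul_avg]) fun μ => ?_
  obtain ⟨t, ht, hr⟩ := μ.exists_columnReading
  refine ⟨t, ht, ?_⟩
  have h1 : gramElement s z * avg (hyperoctahedral p) =
      chain (oddFactor (2 * p) z) p * avg (hyperoctahedral p) := gramElement_mul_avg hs z
  rw [h1, ← (commute_avg_chain p z).eq, mul_assoc, ht.avg_mul_chain hr z le_rfl]
  congr 1
  exact ht.prod_comp fun c => z + 2 * (c.2 : ℂ) - (c.1 : ℂ)

theorem weingartenO_mul_avg (p : ℕ) (z : ℂ) :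
    weingartenO p z * avg (hyperoctahedral p) = ∑ μ : Shape p, (μ.R₂ z)⁻¹ • zonal μ := by
  rw [weingartenO, Finset.sum_mul]
  exact Finset.sum_congr rfl fun μ _ => by rw [smul_mul_assoc, zonal_eq]

theorem isPseudoInverse_gramElement {s : PairPartition p → Perm (Fin (2 * p))} (hs : IsSection s)
    (z : ℂ) : IsPseudoInverse (gramElement s z * avg (hyperoctahedral p))
      (weingartenO p z * avg (hyperoctahedral p)) := by
  rw [gramElement_mul_avg_eq_sum hs, weingartenO_mul_avg]
  exact isPseudoInverse_sum_smul zonal_mul_self (fun _ _ => zonal_mul_zonal) _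

end JMBrauer

end

noncomputable section

namespace JMBrauer

open Equiv (Perm swap)

variable {n m p : ℕ}

/-! ### Pseudo-inverses commuting with an element -/

section PseudoInverse

variable {A : Type*}

/-- `y` is the pseudo-inverse of `x` commuting with `x`. -/
def IsGroupInverse [Mul A] (x y : A) : Prop := IsPseudoInverse x y ∧ Commute x y

/-- An element commuting with `x` commutes with the idempotent `x y = y x`, and hence with the
inverse `y` of `x` on its range. This lets the averages pass through the pseudo-inverses. -/
theorem IsGroupInverse.commute [Semigroup A] {x y a : A} (h : IsGroupInverse x y)
    (ha : Commute a x) : Commute a y := by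
  obtain ⟨⟨h1, h2⟩, hc⟩ := h
  have e1 : y * x * a = y * x * a * (y * x) := by
    calc y * x * a = y * (x * a) := mul_assoc _ _ _
      _ = y * (a * x) := by rw [ha.eq]
      _ = y * (a * (x * y * x)) := by rw [h1]
      _ = y * (a * x) * (y * x) := by simp only [mul_assoc]
      _ = y * (x * a) * (y * x) := by rw [ha.eq]
      _ = _ := by simp only [mul_assoc]
  have e2 : a * (x * y) = y * x * a * (x * y) := by
    calc a * (x * y) = a * x * y := (mul_assoc _ _ _).symm
      _ = x * y * x * a * y := by rw [ha.eq, h1]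
      _ = x * y * (x * a) * y := by simp only [mul_assoc]
      _ = y * x * (a * x) * y := by rw [← ha.eq, hc.eq]
      _ = _ := by simp only [mul_assoc]
  have e3 : y * x * a = a * (x * y) := by rw [e1, e2, hc.eq]
  have h3 : x * y * y = y := by rw [hc.eq, h2]
  calc a * y = a * (x * y * y) := by rw [h3]
    _ = a * (x * y) * y := by simp only [mul_assoc]
    _ = y * (x * a) * y := by rw [← e3]; simp only [mul_assoc]
    _ = y * (a * (x * y)) := by rw [← ha.eq]; simp only [mul_assoc]
    _ = y * (y * x * a) := by rw [e3]
    _ = y * (x * y) * a := by rw [hc.eq]; simp only [mul_assoc]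
    _ = y * a := by rw [← mul_assoc, h2]

theorem IsGroupInverse.pinv_spec [Ring A] {x y : A} (h : IsGroupInverse x y) :
    IsGroupInverse x (pinv x) := by
  have h' : ∃ y, IsPseudoInverse x y ∧ Commute x y := ⟨y, h⟩
  rw [pinv, dif_pos h']
  exact h'.choose_spec

theorem IsGroupInverse.map {B F : Type*} [Mul A] [Mul B] [FunLike F A B] [MulHomClass F A B]
    {x y : A} (h : IsGroupInverse x y) (f : F) : IsGroupInverse (f x) (f y) := by
  refine ⟨⟨?_, ?_⟩, h.2.map f⟩
  · rw [← map_mul, ← map_mul, h.1.1]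
  · rw [← map_mul, ← map_mul, h.1.2]

theorem IsUnit.isGroupInverse [Ring A] {x : A} (h : IsUnit x) :
    IsGroupInverse x (Ring.inverse x) := by
  have h1 := Ring.mul_inverse_cancel x h
  have h2 := Ring.inverse_mul_cancel x h
  exact ⟨⟨by rw [h1, one_mul], by rw [h2, one_mul]⟩, h1.trans h2.symm⟩

theorem isGroupInverse_sum_smul {ι : Type*} [Fintype ι] [Ring A] [Algebra ℂ A] {e : ι → A}
    (hid : ∀ i, e i * e i = e i) (hor : ∀ i j, i ≠ j → e i * e j = 0) (a : ι → ℂ) :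
    IsGroupInverse (∑ i, a i • e i) (∑ i, (a i)⁻¹ • e i) :=
  ⟨isPseudoInverse_sum_smul hid hor a, commute_sum_smul hid hor _ _⟩

/-- If `u` is a sum of eigenvectors of `x` and `F` kills those for the eigenvalue `0`, then `x y`
acts on `F u` as the identity. -/
theorem map_mul_mul_eq {B ι : Type*} [Ring A] [Algebra ℂ A] [Semiring B] [Algebra ℂ B] [Fintype ι]
    (F : A →ₐ[ℂ] B) {x y : A} (h : IsPseudoInverse x y) {v : ι → A} {η : ι → ℂ}
    (hv : ∀ i, x * v i = η i • v i) (h0 : ∀ i, η i = 0 → F (v i) = 0) :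
    F (x * y * ∑ i, v i) = F (∑ i, v i) := by
  rw [Finset.mul_sum, map_sum, map_sum]
  refine Finset.sum_congr rfl fun i _ => ?_
  by_cases hi : η i = 0
  · rw [map_mul, h0 i hi, mul_zero]
  · have h1 : v i = (η i)⁻¹ • (x * v i) := by rw [hv, smul_smul, inv_mul_cancel₀ hi, one_smul]
    have h2 : x * y * v i = v i := by
      rw [h1, mul_smul_comm, ← mul_assoc, h.1]
    rw [h2]

end PseudoInverse

/-! ### Telescoping products -/

/-- If the `P k` are nested idempotents and `P (k + 1) * x k * P (k + 1)` is inverse to `w k` up to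
the factor `z / (k + 1)`, then `x (p - 1) ⋯ x 0` and `w 0 ⋯ w (p - 1)` are inverse to each other
on `P p` up to the factor `z ^ p / p!`. -/
theorem mul_chain_mul_prod_mul {A : Type*} [Semiring A] [Algebra ℂ A] {P x w : ℕ → A} {z : ℂ} {p : ℕ}
    (h0 : P 0 = 1) (h1 : ∀ k < p, P (k + 1) * P k = P (k + 1))
    (h2 : ∀ k < p, P k * P (k + 1) = P (k + 1)) (h3 : ∀ k < p, Commute (P k) (x k))
    (h4 : ∀ k < p, Commute (P k) (w k)) (h5 : ∀ k < p, Commute (P (k + 1)) (w k))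
    (h6 : ∀ k < p, P (k + 1) * x k * P (k + 1) * w k = (z / ((k + 1 : ℕ) : ℂ)) • P (k + 1)) :
    P p * chain x p * ((List.range p).map w).prod * P p =
      (z ^ p / (p.factorial : ℂ)) • P p := by
  induction p with
  | zero => simp [h0, chain]
  | succ p ih =>
    have hi := ih (fun k hk => h1 k (by omega)) (fun k hk => h2 k (by omega))
      (fun k hk => h3 k (by omega)) (fun k hk => h4 k (by omega)) (fun k hk => h5 k (by omega))
      fun k hk => h6 k (by omega)
    have hp : p < p + 1 := Nat.lt_succ_self p
    set W := ((List.range p).map w).prod with hW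
    -- Since `P p` commutes with `x p` and `w p` and is absorbed by `P (p + 1)`, it can be inserted
    -- around the inner product, which the induction hypothesis turns into a scalar times `P p`.
    have e1 : P (p + 1) * x p = P (p + 1) * x p * P p := by
      rw [mul_assoc, ← (h3 p hp).eq, ← mul_assoc, h1 p hp]
    have e2 : w p * P (p + 1) = P p * (w p * P (p + 1)) := by
      rw [← mul_assoc, (h4 p hp).eq, mul_assoc, h2 p hp]
    have e3 : ((List.range (p + 1)).map w).prod = W * w p := by
      rw [List.range_succ, List.map_append, List.prod_append, List.map_singleton,
        List.prod_singleton]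
    calc P (p + 1) * chain x (p + 1) * ((List.range (p + 1)).map w).prod * P (p + 1)
        = (P (p + 1) * x p) * chain x p * W * (w p * P (p + 1)) := by
          rw [e3, chain]; simp only [mul_assoc]
      _ = P (p + 1) * x p * (P p * chain x p * W * P p) * (w p * P (p + 1)) := by
          have e4 : P (p + 1) * x p * (P p * chain x p * W * P p) * (w p * P (p + 1)) =
              P (p + 1) * x p * P p * chain x p * W * (P p * (w p * P (p + 1))) := by
            simp only [mul_assoc]
          rw [e4, ← e1, ← e2]
      _ = (z ^ p / (p.factorial : ℂ)) • (P (p + 1) * x p * P (p + 1) * w p) := by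
          rw [hi, mul_smul_comm, ← e1, smul_mul_assoc, ← (h5 p hp).eq, ← mul_assoc]
      _ = _ := by
          rw [h6 p hp, smul_smul, Nat.factorial_succ]
          congr 1
          push_cast
          rw [pow_succ]
          field_simp

/-! ### Sums of transpositions -/

theorem transpositionSum_image {f : Fin m → Fin n} (hf : StrictMono f)
    {F : Perm (Fin m) →* Perm (Fin n)} (h : ∀ a b, F (swap a b) = swap (f a) (f b)) :
    transpositionSum (Finset.univ.image f) = mapGA F (∑ k, jm k) := by
  rw [transpositionSum, Finset.sum_image fun _ _ _ _ e => hf.injective e, map_sum]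
  refine Finset.sum_congr rfl fun b _ => ?_
  rw [jm, map_sum]
  refine (Finset.sum_bij (fun a _ => f a) (fun a ha => ?_) (fun _ _ _ _ e => hf.injective e)
    (fun c hc => ?_) fun a _ => ?_).symm
  · rw [Finset.mem_filter_univ] at ha
    exact Finset.mem_filter.2 ⟨Finset.mem_image_of_mem _ (Finset.mem_univ _), hf ha⟩
  · obtain ⟨h1, h2⟩ := Finset.mem_filter.1 hc
    obtain ⟨a, -, rfl⟩ := Finset.mem_image.1 h1
    exact ⟨a, (Finset.mem_filter_univ _).2 (hf.lt_iff_lt.1 h2), rfl⟩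
  · rw [mapGA_perm, h]

theorem filter_val_lt (h : m ≤ n) :
    (Finset.univ.filter fun k : Fin n => k.val < m) = Finset.univ.image (Fin.castLE h) := by
  ext k
  rw [Finset.mem_filter_univ, Finset.mem_image]
  constructor
  · exact fun hk => ⟨⟨k.val, hk⟩, Finset.mem_univ _, rfl⟩
  · rintro ⟨a, -, rfl⟩
    exact a.2

theorem transpositionSum_lt (h : m ≤ n) :
    transpositionSum (Finset.univ.filter fun k : Fin n => k.val < m) =
      mapGA (castHom h) (∑ k, jm k) :=
  (congrArg transpositionSum (filter_val_lt h)).trans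
    (transpositionSum_image (F := castHom h) (Fin.strictMono_castLE h) (castHom_swap h))

theorem mapGA_castHom_self (h : m ≤ m) (x : GA m) : mapGA (castHom h) x = x := by
  have e : (mapGA (castHom h)).toLinearMap = LinearMap.id :=
    linearMap_ext fun σ => by simp [castHom_self]
  exact LinearMap.congr_fun e x

theorem zElement_eq (h : m ≤ n) (z : ℂ) : zElement n m z = mapGA (castHom h) (zElement m m z) := by
  have h1 : ∀ {k : ℕ} (h : m ≤ k), zElement k m z =
      ((1 - z⁻¹) * m / 2) • (1 : GA k) + z⁻¹ • mapGA (castHom h) (∑ k, jm k) := fun h => by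
    rw [zElement, zSet, transpositionSum_lt h, filter_val_lt h,
      Finset.card_image_of_injective _ (Fin.castLE_injective h), Finset.card_univ, Fintype.card_fin]
  rw [h1 h, h1 le_rfl, mapGA_castHom_self, map_add, map_smul, map_smul, map_one]

theorem zElement_self (m : ℕ) (z : ℂ) :
    zElement m m z = ((1 - z⁻¹) * m / 2) • (1 : GA m) + z⁻¹ • ∑ k, jm k := by
  have : (Finset.univ.filter fun k : Fin m => k.val < m) = Finset.univ :=
    Finset.filter_true_of_mem fun k _ => k.2
  rw [zElement, zSet, this, Finset.card_univ, Fintype.card_fin, transpositionSum_univ]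

theorem commute_zElement_self (z : ℂ) (x : GA m) : Commute x (zElement m m z) := by
  rw [zElement_self]
  exact (smul_one_commute _ x).symm.add_right ((commute_sum_jm x).smul_right _)

theorem commute_zElement (h : m ≤ n) (z : ℂ) (x : GA m) :
    Commute (mapGA (castHom h) x) (zElement n m z) := by
  rw [zElement_eq h]
  exact (commute_zElement_self z x).map _

theorem zElement_mul_proj (z : ℂ) (μ : Shape m) :
    zElement m m z * μ.proj = ((1 - z⁻¹) * m / 2 + z⁻¹ * μ.content) • μ.proj := by
  rw [zElement_self, add_mul, smul_mul_assoc, one_mul, smul_mul_assoc, μ.sum_jm_mul_proj, smul_smul,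
    ← add_smul]

/-- `Z` is central in the smaller group algebra, hence diagonal on its `𝒫_μ`; inverting the nonzero
eigenvalues shows that `pinv` takes the intended value and not its default. -/
theorem isGroupInverse_pinv_zElement (h : m ≤ n) (z : ℂ) :
    IsGroupInverse (zElement n m z) (pinv (zElement n m z)) := by
  have h1 : zElement m m z =
      ∑ μ : Shape m, ((1 - z⁻¹) * m / 2 + z⁻¹ * μ.content) • μ.proj := by
    rw [← mul_one (zElement m m z), ← sum_proj, Finset.mul_sum]
    exact Finset.sum_congr rfl fun μ _ => zElement_mul_proj z μ
  have h2 := isGroupInverse_sum_smul (fun μ : Shape m => μ.proj_mul_self)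
    (fun μ ν h => Shape.proj_mul_proj h) fun μ => (1 - z⁻¹) * m / 2 + z⁻¹ * μ.content
  rw [← h1] at h2
  have h3 := h2.map (mapGA (castHom h))
  rw [← zElement_eq h] at h3
  exact h3.pinv_spec

/-! ### The products of the elements `Z_{2k}` -/

theorem mapGA_subAvg {l : ℕ} (h : l ≤ m) (h' : m ≤ p) :
    mapGA (castHom (two_mul_le h')) (subAvg h) = subAvg (h.trans h') := by
  rw [subAvg, ← mapGA_comp, ← castHom_comp, subAvg]

theorem subAvg_mul_subAvg {l : ℕ} (h : l ≤ m) (h' : m ≤ p) :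
    subAvg h' * subAvg (h.trans h') = subAvg h' := by
  rw [← mapGA_subAvg h h']
  exact (map_mul _ _ _).symm.trans (congrArg _ (avg_mul_subAvg h))

theorem subAvg_mul_subAvg' {l : ℕ} (h : l ≤ m) (h' : m ≤ p) :
    subAvg (h.trans h') * subAvg h' = subAvg h' := by
  rw [← mapGA_subAvg h h']
  exact (map_mul _ _ _).symm.trans (congrArg _ (subAvg_mul_avg h))

theorem subAvg_zero (p : ℕ) : subAvg (Nat.zero_le p) = 1 := by
  have h : avg (hyperoctahedral 0) = 1 := by
    rw [← mul_one (avg (hyperoctahedral 0))]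
    refine avg_mul_of_forall _ fun σ _ => ?_
    rw [show σ = 1 from Equiv.ext fun x => absurd x.2 (by omega), perm_one, one_mul]
  rw [subAvg, h, map_one]

theorem subAvg_self (h : p ≤ p) : subAvg h = avg (hyperoctahedral p) := mapGA_castHom_self _ _

/-- This is (i) rewritten: on `P` the sum of transpositions becomes `(k + 1)(1 + X_{2k+1})`, and the
constant of `Z` is chosen so that `Z` becomes `(k + 1)(1 + z⁻¹ X_{2k+1})`. -/
theorem avg_mul_oddFactor_mul_avg {z : ℂ} (hz : z ≠ 0) (k : ℕ) :
    avg (hyperoctahedral (k + 1)) * oddFactor (2 * (k + 1)) z k * avg (hyperoctahedral (k + 1)) =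
      (z / ((k + 1 : ℕ) : ℂ)) • (zElement (2 * (k + 1)) (2 * (k + 1)) z *
        avg (hyperoctahedral (k + 1))) := by
  have hk : ((k + 1 : ℕ) : ℂ) ≠ 0 := Nat.cast_ne_zero.2 k.succ_ne_zero
  have h1 := sum_jm_mul_avg_hyperoctahedral k (by omega)
  set P := avg (hyperoctahedral (k + 1))
  have hP : P * P = P := avg_mul_avg _
  rw [zElement_self, add_mul, smul_mul_assoc z⁻¹, h1, oddFactor_eq z (show 2 * k < 2 * (k + 1) by omega)]
  simp only [mul_add, add_mul, smul_mul_assoc, mul_smul_comm, mul_one, one_mul, hP, smul_add,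
    smul_smul]
  rw [← add_assoc, ← add_smul]
  refine congrArg₂ (· + ·) (congrArg (· • P) ?_) ?_
  · push_cast
    push_cast at hk
    field_simp
    ring
  · have : z / ((k + 1 : ℕ) : ℂ) * (z⁻¹ * ((k + 1 : ℕ) : ℂ)) = 1 := by field_simp
    rw [this, one_smul]

/-- The homomorphism `F` serves both uses: the identity with true inverses, and a representation
with pseudo-inverses. The hypothesis `hF` requires `Z w` to act as the identity only on the image of
the average. -/
theorem map_avg_mul_chain_mul_prod {B : Type*} [Semiring B] [Algebra ℂ B] (F : GA (2 * p) →ₐ[ℂ] B)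
    {z : ℂ} (hz : z ≠ 0) {w : ℕ → GA (2 * p)}
    (hw : ∀ k < p, IsGroupInverse (zElement (2 * p) (2 * (k + 1)) z) (w k))
    (hF : ∀ k, ∀ h : k + 1 ≤ p, F (zElement (2 * p) (2 * (k + 1)) z * w k * subAvg h) =
      F (subAvg h)) :
    F (avg (hyperoctahedral p) * chain (oddFactor (2 * p) z) p * ((List.range p).map w).prod *
      avg (hyperoctahedral p)) =
    (z ^ p / (p.factorial : ℂ)) • F (avg (hyperoctahedral p)) := by
  have hc : ∀ k (h : k + 1 ≤ p) (x : GA (2 * (k + 1))),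
      Commute (mapGA (castHom (two_mul_le h)) x) (w k) := fun k h x =>
    (hw k h).commute (commute_zElement (two_mul_le h) z x)
  -- The value `1` beyond `p` is a filler: only indices up to `p` are used.
  let P : ℕ → B := fun k => if h : k ≤ p then F (subAvg h) else 1
  have hP : ∀ {k} (h : k ≤ p), P k = F (subAvg h) := fun h => dif_pos h
  have key := mul_chain_mul_prod_mul (P := P) (x := fun k => F (oddFactor (2 * p) z k))
    (w := fun k => F (w k)) (z := z) (p := p) ?_ ?_ ?_ ?_ ?_ ?_ ?_
  · rw [hP le_rfl, subAvg_self, ← map_chain] at key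
    rw [map_mul, map_mul, map_mul, map_list_prod, List.map_map]
    exact key
  · rw [hP (Nat.zero_le _), subAvg_zero, map_one]
  · intro k hk
    rw [hP hk, hP hk.le, ← map_mul, subAvg_mul_subAvg k.le_succ hk]
  · intro k hk
    rw [hP hk, hP hk.le, ← map_mul, subAvg_mul_subAvg' k.le_succ hk]
  · intro k hk
    have hk2 : 2 * k < 2 * p := by omega
    have h1 : Commute (subAvg hk.le) (jm ⟨2 * k, hk2⟩) :=
      commute_castHom_jm (two_mul_le hk.le) (le_refl (2 * k)) _
    rw [hP hk.le, oddFactor_eq z hk2]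
    exact ((smul_one_commute z _).symm.add_right h1).map F
  · intro k hk
    rw [hP hk.le, ← mapGA_subAvg k.le_succ hk]
    exact (hc k hk _).map F
  · intro k hk
    rw [hP hk]
    exact (hc k hk _).map F
  · intro k hk
    have h1 := congrArg (mapGA (castHom (two_mul_le (show k + 1 ≤ p from hk))))
      (avg_mul_oddFactor_mul_avg hz k)
    rw [map_mul, map_mul, map_smul, map_mul, ← zElement_eq, mapGA_oddFactor _ z (by omega)] at h1
    change subAvg hk * _ * subAvg hk = _ • (_ * subAvg hk) at h1
    have h2 : Commute (subAvg hk) (w k) := hc k hk _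
    rw [hP hk, ← map_mul, ← map_mul, ← map_mul, h1, smul_mul_assoc, mul_assoc, h2.eq,
      ← mul_assoc, map_smul, hF]

end JMBrauer

end

/-! ### Inverses and pseudo-inverses for the hyperoctahedral group. -/

noncomputable section

namespace JMBrauer

open Equiv (Perm swap)

variable {n m p : ℕ}

theorem chain_eq_zero {A : Type*} [Ring A] {x : ℕ → A} (h : x 0 = 0) {k : ℕ} (hk : k ≠ 0) :
    chain x k = 0 := by
  obtain ⟨k, rfl⟩ := Nat.exists_eq_succ_of_ne_zero hk
  induction k with
  | zero => rw [chain, h, zero_mul]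
  | succ k ih => rw [chain, ih k.succ_ne_zero, mul_zero]

theorem jucysMurphy_one (n : ℕ) : jucysMurphy n 1 = 0 := by
  rw [jucysMurphy]
  refine Finset.sum_eq_zero fun b hb => Finset.sum_eq_zero fun a ha => ?_
  rw [Finset.mem_filter_univ] at ha hb
  rw [Fin.lt_def] at ha
  omega

theorem ring_inverse_gramElement_mul_avg {z : ℂ} {s : PairPartition p → Perm (Fin (2 * p))}
    (hs : IsSection s) (hG : IsUnit (gramElement s z))
    (hZ : ∀ k ∈ Finset.Icc 1 p, IsUnit (zElement (2 * p) (2 * k) z)) :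
    z ^ p • (Ring.inverse (gramElement s z) * avg (hyperoctahedral p)) =
      (p.factorial : ℂ) • (avg (hyperoctahedral p) *
        ((List.range p).map fun k => Ring.inverse (zElement (2 * p) (2 * (k + 1)) z)).prod *
        avg (hyperoctahedral p)) := by
  have h1 : gramElement s z * avg (hyperoctahedral p) =
      chain (oddFactor (2 * p) z) p * avg (hyperoctahedral p) := gramElement_mul_avg hs z
  have hinv := Ring.inverse_mul_cancel _ hG
  set P := avg (hyperoctahedral p) with hP
  -- At `z = 0` the first factor `z + X_1` vanishes, so `𝐆(0) P = 0`; as `𝐆(0)` is assumed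
  -- invertible, `P = 0` and both sides vanish.
  by_cases h0 : z = 0 ∧ p ≠ 0
  · have h2 : P = 0 := by
      have h3 : oddFactor (2 * p) z 0 = 0 := by
        rw [oddFactor, h0.1, zero_smul, zero_add, mul_zero, zero_add, jucysMurphy_one]
      rw [chain_eq_zero h3 h0.2, zero_mul] at h1
      rw [← one_mul P, ← hinv, mul_assoc, h1, mul_zero]
    rw [h2]
    simp only [mul_zero, smul_zero]
  by_cases hz : z = 0
  · have hp : p = 0 := by tauto
    subst hp
    have h3 : P = 1 := by rw [hP, ← subAvg_self le_rfl, subAvg_zero]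
    have h2 : gramElement s z = 1 := by simpa [chain, h3] using h1
    simp [h2, h3]
  · have h2 := map_avg_mul_chain_mul_prod (AlgHom.id ℂ (GA (2 * p))) hz
      (w := fun k => Ring.inverse (zElement (2 * p) (2 * (k + 1)) z))
      (fun k hk => IsUnit.isGroupInverse (hZ (k + 1) (Finset.mem_Icc.2 ⟨by omega, by omega⟩)))
      (fun k hk => by
        rw [Ring.mul_inverse_cancel _ (hZ (k + 1) (Finset.mem_Icc.2 ⟨by omega, by omega⟩)), one_mul])
    simp only [AlgHom.coe_id, id_eq] at h2
    rw [← hP, (commute_avg_chain p z).eq, ← h1] at h2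
    have h3 := congrArg (fun y => (p.factorial : ℂ) • (Ring.inverse (gramElement s z) * y)) h2
    have hf : (p.factorial : ℂ) ≠ 0 := Nat.cast_ne_zero.2 p.factorial_ne_zero
    simp only [mul_smul_comm, smul_smul, mul_div_cancel₀ _ hf] at h3
    rw [← h3]
    simp only [← mul_assoc, hinv, one_mul]

theorem zElement_mul_mapGA_zonal (h : m ≤ p) (z : ℂ) (μ : Shape m) :
    zElement (2 * p) (2 * m) z * mapGA (castHom (two_mul_le h)) (zonal μ) =
      ((1 - z⁻¹) * (2 * m : ℕ) / 2 + z⁻¹ * μ.double.content) •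
        mapGA (castHom (two_mul_le h)) (zonal μ) := by
  rw [zElement_eq (two_mul_le h), ← map_mul, zonal_eq, ← mul_assoc, zElement_mul_proj,
    smul_mul_assoc, map_smul]

/-- Under `F`, the product of pseudo-inverses is, up to a scalar, a right inverse on `P` of the
product `g` of odd factors, and the Weingarten element is a left inverse. Both hold because `F`
kills every component on which an eigenvalue is zero; comparing them gives the identity. -/
theorem map_avg_mul_prod_mul_avg {B : Type*} [Semiring B] [Algebra ℂ B] (F : GA (2 * p) →ₐ[ℂ] B)
    {z : ℂ} (hz : z ≠ 0) (hR : ∀ μ : Shape p, μ.R₂ z = 0 → F μ.double.proj = 0)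
    (hζ : ∀ k, ∀ h : k + 1 ≤ p, ∀ μ : Shape (k + 1),
      (1 - z⁻¹) * (2 * (k + 1) : ℕ) / 2 + z⁻¹ * μ.double.content = 0 →
      F (mapGA (castHom (two_mul_le h)) μ.double.proj) = 0) :
    ((p.factorial : ℂ) * (z ^ p)⁻¹) • F (avg (hyperoctahedral p) *
        ((List.range p).map fun k => pinv (zElement (2 * p) (2 * (k + 1)) z)).prod *
        avg (hyperoctahedral p)) = F (weingartenO p z * avg (hyperoctahedral p)) := by
  have h1 := map_avg_mul_chain_mul_prod F hz
    (w := fun k => pinv (zElement (2 * p) (2 * (k + 1)) z))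
    (fun k hk => isGroupInverse_pinv_zElement (two_mul_le hk) z) fun k h => by
      have e : subAvg h = ∑ μ : Shape (k + 1), mapGA (castHom (two_mul_le h)) (zonal μ) := by
        rw [subAvg, sum_zonal, map_sum]
      rw [e]
      refine map_mul_mul_eq F (isGroupInverse_pinv_zElement (two_mul_le h) z).1
        (zElement_mul_mapGA_zonal h z) fun μ hμ => ?_
      rw [zonal, map_mul, map_mul, hζ k h μ hμ, mul_zero]
  obtain ⟨s, hs⟩ := exists_isSection p
  have h2 : gramElement s z * avg (hyperoctahedral p) =
      chain (oddFactor (2 * p) z) p * avg (hyperoctahedral p) := gramElement_mul_avg hs z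
  rw [gramElement_mul_avg_eq_sum hs, ← (commute_avg_chain p z).eq] at h2
  set W := ((List.range p).map fun k => pinv (zElement (2 * p) (2 * (k + 1)) z)).prod
  have hP : avg (hyperoctahedral p) * avg (hyperoctahedral p) = avg (hyperoctahedral p) :=
    avg_mul_avg _
  -- The Gram and Weingarten elements are mutually inverse on the components with `R₂ ≠ 0`, and `F`
  -- annihilates the others.
  have h3 : F ((∑ μ : Shape p, μ.R₂ z • zonal μ) * (∑ μ : Shape p, (μ.R₂ z)⁻¹ • zonal μ) *
      ∑ μ : Shape p, zonal μ) = F (∑ μ : Shape p, zonal μ) := by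
    refine map_mul_mul_eq F (isPseudoInverse_sum_smul zonal_mul_self (fun _ _ => zonal_mul_zonal) _)
      (η := fun μ => μ.R₂ z) (fun μ => ?_) fun μ hμ => ?_
    · rw [Finset.sum_mul, Finset.sum_eq_single μ, smul_mul_assoc, zonal_mul_self]
      · intro ν _ hν
        rw [smul_mul_assoc, zonal_mul_zonal hν, smul_zero]
      · simp
    · rw [zonal, map_mul, hR μ hμ, mul_zero]
  rw [← sum_zonal, (commute_sum_smul zonal_mul_self (fun _ _ => zonal_mul_zonal) _ _).eq,
    ← weingartenO_mul_avg, h2] at h3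
  set P := avg (hyperoctahedral p)
  set g := chain (oddFactor (2 * p) z) p
  have hg : P * g * P = P * g := by rw [(commute_avg_chain p z).eq, mul_assoc, hP]
  have h4 : F (P * W * P) = (z ^ p / (p.factorial : ℂ)) • F (weingartenO p z * P) := by
    calc F (P * W * P) = F P * F (W * P) := by rw [← map_mul, mul_assoc]
      _ = F (weingartenO p z * P * (P * g) * P) * F (W * P) := by rw [h3]
      _ = F (weingartenO p z * P * (P * g * W * P)) := by
        rw [← map_mul, mul_assoc (_ * P), hg]
        simp only [mul_assoc]
      _ = (z ^ p / (p.factorial : ℂ)) • F (weingartenO p z * P * P) := by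
        rw [map_mul, h1, mul_smul_comm, ← map_mul]
      _ = _ := by rw [mul_assoc, hP]
  have hf : (p.factorial : ℂ) ≠ 0 := Nat.cast_ne_zero.2 p.factorial_ne_zero
  have hzp : z ^ p ≠ 0 := pow_ne_zero p hz
  have h5 : (p.factorial : ℂ) * (z ^ p)⁻¹ * (z ^ p / (p.factorial : ℂ)) = 1 := by field_simp
  rw [h4, smul_smul, h5, one_smul]

end JMBrauer

end

noncomputable section

namespace JMBrauer

open Equiv (Perm swap)

variable {n m p : ℕ}

/-! ### The embeddings of symmetric groups in `𝔖ₚ × 𝔖ₚ` -/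

/-- The point `a` of the first half. -/
def fstPt (a : Fin p) : Fin (2 * p) := (finSumFinEquiv.trans (finCongr (two_mul p).symm)) (.inl a)

/-- The point `p + a` of the second half. -/
def sndPt (a : Fin p) : Fin (2 * p) := (finSumFinEquiv.trans (finCongr (two_mul p).symm)) (.inr a)

@[simp]
theorem fstPt_val (a : Fin p) : (fstPt a).val = a.val := rfl

@[simp]
theorem sndPt_val (a : Fin p) : (sndPt a).val = p + a.val := rfl

theorem fstPt_strictMono : StrictMono (fstPt (p := p)) := fun _ _ h => h

theorem sndPt_strictMono : StrictMono (sndPt (p := p)) := fun a b h => by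
  rw [Fin.lt_def, sndPt_val, sndPt_val]
  exact Nat.add_lt_add_left h p

theorem blockHom_swap_one (a b : Fin p) :
    blockHom p (swap a b, 1) = swap (fstPt a) (fstPt b) := by
  have h : blockHom p (swap a b, 1) = (finSumFinEquiv.trans (finCongr (two_mul p).symm)).permCongr
      (Equiv.Perm.sumCongr (swap a b) 1) := rfl
  rw [h, Equiv.Perm.sumCongr_swap_one]
  exact Equiv.symm_trans_swap_trans _ _ _

theorem blockHom_one_swap (a b : Fin p) :
    blockHom p (1, swap a b) = swap (sndPt a) (sndPt b) := by
  have h : blockHom p (1, swap a b) = (finSumFinEquiv.trans (finCongr (two_mul p).symm)).permCongr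
      (Equiv.Perm.sumCongr 1 (swap a b)) := rfl
  rw [h, Equiv.Perm.sumCongr_one_swap]
  exact Equiv.symm_trans_swap_trans _ _ _

/-- `𝔖ₘ` acting on `{1, …, m}`. -/
def leftHom (h : m ≤ p) : Perm (Fin m) →* Perm (Fin (2 * p)) :=
  ((blockHom p).comp (MonoidHom.inl _ _)).comp (castHom h)

/-- `𝔖ₘ` acting on `{p + 1, …, p + m}`. -/
def rightHom (h : m ≤ p) : Perm (Fin m) →* Perm (Fin (2 * p)) :=
  ((blockHom p).comp (MonoidHom.inr _ _)).comp (castHom h)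

/-- `𝔖ₘ` acting diagonally on `{1, …, m}` and `{p + 1, …, p + m}`. -/
def diagHom (h : m ≤ p) : Perm (Fin m) →* Perm (Fin (2 * p)) :=
  ((blockHom p).comp ((MonoidHom.id _).prod (MonoidHom.id _))).comp (castHom h)

theorem diagHom_apply (h : m ≤ p) (σ : Perm (Fin m)) :
    diagHom h σ = leftHom h σ * rightHom h σ := by
  simp only [diagHom, leftHom, rightHom, MonoidHom.comp_apply, ← map_mul]
  simp

theorem commute_leftHom_rightHom {l : ℕ} (h : m ≤ p) (h' : l ≤ p) (σ : Perm (Fin m))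
    (τ : Perm (Fin l)) : Commute (leftHom h σ) (rightHom h' τ) := by
  simp only [leftHom, rightHom, MonoidHom.comp_apply]
  refine Commute.map ?_ _
  simp [Commute, SemiconjBy]

theorem leftHom_swap (h : m ≤ p) (a b : Fin m) :
    leftHom h (swap a b) = swap (fstPt (Fin.castLE h a)) (fstPt (Fin.castLE h b)) := by
  rw [← blockHom_swap_one, ← castHom_swap]
  rfl

theorem rightHom_swap (h : m ≤ p) (a b : Fin m) :
    rightHom h (swap a b) = swap (sndPt (Fin.castLE h a)) (sndPt (Fin.castLE h b)) := by
  rw [← blockHom_one_swap, ← castHom_swap]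
  rfl

theorem mapGA_leftHom (h : m ≤ p) (x : GA m) :
    mapGA (leftHom h) x = inclFirst p (mapGA (castHom h) x) :=
  mapGA_comp _ _ x

theorem commute_left_right {l : ℕ} (h : m ≤ p) (h' : l ≤ p) (x : GA m) (y : GA l) :
    Commute (mapGA (leftHom h) x) (mapGA (rightHom h') y) :=
  commute_mapGA (fun σ => (commute_mapGA (fun τ => by
    rw [Commute, SemiconjBy, ← perm_mul, ← perm_mul, (commute_leftHom_rightHom h h' σ τ).eq]) y).symm) x

theorem transpositionSum_left (h : m ≤ p) :
    transpositionSum (Finset.univ.filter fun k : Fin (2 * p) => k.val < m) =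
      mapGA (leftHom h) (∑ k, jm k) := by
  have e : (Finset.univ.filter fun k : Fin (2 * p) => k.val < m) =
      Finset.univ.image fun a => fstPt (Fin.castLE h a) := filter_val_lt (by omega)
  exact (congrArg transpositionSum e).trans
    (transpositionSum_image (f := fun a => fstPt (Fin.castLE h a)) (fun _ _ hab => hab)
      (leftHom_swap h))

theorem transpositionSum_right (h : m ≤ p) :
    transpositionSum (Finset.univ.filter fun k : Fin (2 * p) => p ≤ k.val ∧ k.val < p + m) =
      mapGA (rightHom h) (∑ k, jm k) := by
  have e : (Finset.univ.filter fun k : Fin (2 * p) => p ≤ k.val ∧ k.val < p + m) =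
      Finset.univ.image fun a => sndPt (Fin.castLE h a) := by
    ext k
    rw [Finset.mem_filter_univ, Finset.mem_image]
    constructor
    · exact fun hk => ⟨⟨k.val - p, by omega⟩, Finset.mem_univ _, Fin.ext (by
        rw [sndPt_val, Fin.val_castLE]; simp only; omega)⟩
    · rintro ⟨a, -, rfl⟩
      rw [sndPt_val, Fin.val_castLE]
      omega
  exact (congrArg transpositionSum e).trans
    (transpositionSum_image (f := fun a => sndPt (Fin.castLE h a))
      (fun _ _ hab => sndPt_strictMono hab)
      (rightHom_swap h))

/-! ### The elements `Y_k` -/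

theorem coef_wallProj (x : GA (2 * p)) (σ : Perm (Fin (2 * p)))
    [Decidable (∀ k, (σ k).val < p ↔ k.val < p)] :
    coef σ (wallProj p x) = if ∀ k, (σ k).val < p ↔ k.val < p then coef σ x else 0 := by
  classical
  have h : coef σ (wallProj p x) =
      (x.coeff.filter fun σ : Perm (Fin (2 * p)) => ∀ k, (σ k).val < p ↔ k.val < p) σ := by
    rw [wallProj]
    rfl
  rw [h, Finsupp.filter_apply]
  split_ifs <;> rfl

/-- The walled projection as a linear map. -/
def wallLin (p : ℕ) : GA (2 * p) →ₗ[ℂ] GA (2 * p) where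
  toFun := wallProj p
  map_add' x y := by
    classical
    refine ga_ext fun σ => ?_
    simp only [map_add, coef_wallProj]
    split_ifs <;> simp
  map_smul' r x := by
    classical
    refine ga_ext fun σ => ?_
    simp only [map_smul, coef_wallProj, RingHom.id_apply]
    split_ifs <;> simp

theorem wallLin_perm_of_forall {σ : Perm (Fin (2 * p))} (h : ∀ k, (σ k).val < p ↔ k.val < p) :
    wallLin p (perm σ) = perm σ := by
  classical
  refine ga_ext fun τ => ?_
  change coef τ (wallProj p (perm σ)) = _
  rw [coef_wallProj, coef_perm]
  split_ifs with h1 h2 h2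
  · rfl
  · rfl
  · exact absurd (h2 ▸ h) h1
  · rfl

theorem wallLin_perm_eq_zero {σ : Perm (Fin (2 * p))} (h : ¬∀ k, (σ k).val < p ↔ k.val < p) :
    wallLin p (perm σ) = 0 := by
  classical
  refine ga_ext fun τ => ?_
  change coef τ (wallProj p (perm σ)) = _
  rw [coef_wallProj, coef_perm, map_zero]
  split_ifs with h1 h2
  · exact absurd (h2 ▸ h1) h
  · rfl
  · rfl

theorem wallLin_swap {a b : Fin (2 * p)} (h : a.val < p ↔ b.val < p) :
    wallLin p (perm (swap a b)) = perm (swap a b) := by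
  refine wallLin_perm_of_forall fun k => ?_
  rw [Equiv.swap_apply_def]
  split_ifs with h1 h1
  · rw [h1, h]
  · rw [h1, h]
  · rfl

theorem wallLin_transpositionSum {C D : Finset (Fin (2 * p))} (hC : ∀ k ∈ C, k.val < p)
    (hD : ∀ k ∈ D, p ≤ k.val) :
    wallLin p (transpositionSum (C ∪ D)) = transpositionSum C + transpositionSum D := by
  have hd : Disjoint C D := Finset.disjoint_left.2 fun k h1 h2 => by
    have := hC k h1
    have := hD k h2
    omega
  rw [transpositionSum, Finset.sum_union hd, map_add, map_sum, map_sum]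
  refine congrArg₂ (· + ·) (Finset.sum_congr rfl fun b hb => ?_) (Finset.sum_congr rfl fun b hb => ?_)
  · have hb' := hC b hb
    have e : (C ∪ D).filter (· < b) = C.filter (· < b) := by
      rw [Finset.filter_union, Finset.filter_false_of_mem (s := D), Finset.union_empty]
      intro a ha h
      have := hD a ha
      rw [Fin.lt_def] at h
      omega
    rw [e, map_sum]
    refine Finset.sum_congr rfl fun a ha => wallLin_swap ?_
    have := hC a (Finset.mem_filter.1 ha).1
    omega
  · have hb' := hD b hb
    rw [map_sum]
    refine (Finset.sum_subset (Finset.filter_subset_filter _ Finset.subset_union_right)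
      fun a ha ha' => ?_).symm.trans (Finset.sum_congr rfl fun a ha => ?_)
    · rw [Finset.mem_filter] at ha ha'
      have haC : a ∈ C := (Finset.mem_union.1 ha.1).resolve_right fun h => ha' ⟨h, ha.2⟩
      have := hC a haC
      refine wallLin_perm_eq_zero fun h => ?_
      have h1 := h a
      rw [Equiv.swap_apply_left] at h1
      omega
    · have := hD a (Finset.mem_filter.1 ha).1
      exact wallLin_swap (by omega)

/-- The walled projection removes exactly the transpositions that join the two halves. The scalar is
`m` because `(1 - z⁻¹) 2m / 2 + 2m z⁻¹ / 2 = m`. -/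
theorem yElement_eq (h : m ≤ p) (z : ℂ) :
    yElement p m z = (m : ℂ) • (1 : GA (2 * p)) +
      z⁻¹ • (mapGA (leftHom h) (∑ k, jm k) + mapGA (rightHom h) (∑ k, jm k)) := by
  rw [← transpositionSum_left, ← transpositionSum_right,
    ← wallLin_transpositionSum (fun k hk => (((Finset.mem_filter_univ k).1 hk).trans_le h))
      (fun k hk => ((Finset.mem_filter_univ k).1 hk).1), ← Finset.filter_or]
  have hcard : (Finset.univ.filter fun k : Fin (2 * p) =>
      k.val < m ∨ (p ≤ k.val ∧ k.val < p + m)).card = 2 * m := by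
    have e : (Finset.univ.filter fun k : Fin (2 * p) => k.val < m ∨ (p ≤ k.val ∧ k.val < p + m)) =
        (Finset.univ.image fun a => fstPt (Fin.castLE h a)) ∪
          Finset.univ.image fun a => sndPt (Fin.castLE h a) := by
      ext k
      simp only [Finset.mem_filter_univ, Finset.mem_union, Finset.mem_image, Finset.mem_univ,
        true_and, Fin.ext_iff, fstPt_val, sndPt_val, Fin.val_castLE]
      constructor
      · rintro (h1 | h1)
        · exact Or.inl ⟨⟨k.val, h1⟩, rfl⟩
        · exact Or.inr ⟨⟨k.val - p, by omega⟩, by simp only; omega⟩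
      · rintro (⟨a, h1⟩ | ⟨a, h1⟩) <;> omega
    rw [e, Finset.card_union_of_disjoint, Finset.card_image_of_injective,
      Finset.card_image_of_injective, Finset.card_univ, Fintype.card_fin, two_mul]
    · exact sndPt_strictMono.injective.comp (Fin.castLE_injective h)
    · exact fstPt_strictMono.injective.comp (Fin.castLE_injective h)
    · rw [Finset.disjoint_left]
      intro x hx hx'
      obtain ⟨a, -, rfl⟩ := Finset.mem_image.1 hx
      obtain ⟨b, -, hb⟩ := Finset.mem_image.1 hx'
      rw [Fin.ext_iff, sndPt_val, fstPt_val, Fin.val_castLE, Fin.val_castLE] at hb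
      omega
  rw [yElement, ySet, zSet, hcard]
  change wallLin p _ + _ = _
  have h1 : wallLin p 1 = 1 := by
    rw [← perm_one]
    exact wallLin_perm_of_forall fun k => Iff.rfl
  rw [map_add, map_smul, map_smul, h1, add_right_comm, ← add_smul]
  congr 2
  push_cast
  ring

theorem commute_left_yElement (h : m ≤ p) (z : ℂ) (x : GA m) :
    Commute (mapGA (leftHom h) x) (yElement p m z) := by
  rw [yElement_eq h]
  exact (smul_one_commute _ _).symm.add_right
    ((((commute_sum_jm x).map _).add_right (commute_left_right h h x _)).smul_right _)

theorem commute_right_yElement (h : m ≤ p) (z : ℂ) (x : GA m) :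
    Commute (mapGA (rightHom h) x) (yElement p m z) := by
  rw [yElement_eq h]
  exact (smul_one_commute _ _).symm.add_right
    (((commute_left_right h h _ x).symm.add_right ((commute_sum_jm x).map _)).smul_right _)

/-- The idempotents of `ℂ[𝔖ₘ × 𝔖ₘ]`. -/
def biproj (h : m ≤ p) (i : Shape m × Shape m) : GA (2 * p) :=
  mapGA (leftHom h) i.1.proj * mapGA (rightHom h) i.2.proj

theorem biproj_mul_biproj (h : m ≤ p) (i j : Shape m × Shape m) : biproj h i * biproj h j =
    mapGA (leftHom h) (i.1.proj * j.1.proj) * mapGA (rightHom h) (i.2.proj * j.2.proj) := by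
  rw [biproj, biproj, map_mul, map_mul]
  exact (commute_left_right h h _ _).symm.mul_mul_mul_comm _ _

theorem sum_biproj (h : m ≤ p) : ∑ i, biproj h i = 1 := by
  simp only [biproj]
  rw [Fintype.sum_prod_type]
  simp only [← Finset.mul_sum, ← map_sum, sum_proj, map_one, ← Finset.sum_mul, one_mul]

/-- `Y` is diagonal on the products of isotypic idempotents of the two commuting copies of `𝔖_m`,
the contents of the two shapes being added. -/
theorem isGroupInverse_pinv_yElement (h : m ≤ p) (z : ℂ) :
    IsGroupInverse (yElement p m z) (pinv (yElement p m z)) := by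
  have h1 : yElement p m z =
      ∑ i : Shape m × Shape m, ((m : ℂ) + z⁻¹ * (i.1.content + i.2.content)) • biproj h i := by
    rw [← mul_one (yElement p m z), ← sum_biproj h, Finset.mul_sum]
    refine Finset.sum_congr rfl fun i _ => ?_
    have h1 : mapGA (leftHom h) (∑ k, jm k) * biproj h i = i.1.content • biproj h i := by
      rw [biproj, ← mul_assoc, ← map_mul, Shape.sum_jm_mul_proj, map_smul, smul_mul_assoc]
    have h2 : mapGA (rightHom h) (∑ k, jm k) * biproj h i = i.2.content • biproj h i := by
      rw [biproj, (commute_left_right h h _ _).eq, ← mul_assoc, ← map_mul, Shape.sum_jm_mul_proj,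
        map_smul, smul_mul_assoc]
    rw [yElement_eq h, add_mul, smul_mul_assoc, one_mul, smul_mul_assoc, add_mul, h1, h2,
      ← add_smul, smul_smul, ← add_smul]
  have h2 := isGroupInverse_sum_smul (e := biproj h)
    (fun i => by rw [biproj_mul_biproj, Shape.proj_mul_self, Shape.proj_mul_self, biproj])
    (fun i j hij => by
      rw [biproj_mul_biproj]
      by_cases h1 : i.1 = j.1
      · rw [Shape.proj_mul_proj (μ := i.2) fun h2 => hij (Prod.ext h1 h2), map_zero, mul_zero]
      · rw [Shape.proj_mul_proj h1, map_zero, zero_mul])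
    fun i => (m : ℂ) + z⁻¹ * (i.1.content + i.2.content)
  rw [← h1] at h2
  exact h2.pinv_spec

end JMBrauer

end

noncomputable section

namespace JMBrauer

open Equiv (Perm swap)

variable {n m p : ℕ}

/-! ### The products of the elements `Y_k` -/

/-- The averaging idempotent of `D(𝔖ₘ)`. -/
def diagAvg (h : m ≤ p) : GA (2 * p) := avg (diagHom h).range

theorem diagAvg_self (h : p ≤ p) : diagAvg h = avg (diagonal p) := by
  have e : diagHom h = (blockHom p).comp ((MonoidHom.id _).prod (MonoidHom.id _)) :=
    MonoidHom.ext fun σ => by rw [diagHom, MonoidHom.comp_apply, castHom_self]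
  rw [diagAvg, e, diagonal]

theorem diagAvg_zero (p : ℕ) : diagAvg (Nat.zero_le p) = 1 := by
  rw [← mul_one (diagAvg _)]
  refine avg_mul_of_forall _ ?_
  rintro _ ⟨σ, rfl⟩
  rw [Subsingleton.elim σ 1, map_one, perm_one, one_mul]

theorem diagHom_mem {l : ℕ} (h : l ≤ m) (h' : m ≤ p) (σ : Perm (Fin l)) :
    diagHom (h.trans h') σ ∈ (diagHom h').range := by
  refine ⟨castHom h σ, ?_⟩
  rw [diagHom, diagHom, castHom_comp h h']
  rfl

theorem diagAvg_mul_diagAvg {l : ℕ} (h : l ≤ m) (h' : m ≤ p) :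
    diagAvg (h.trans h') * diagAvg h' = diagAvg h' := by
  refine avg_mul_of_forall _ ?_
  rintro _ ⟨σ, rfl⟩
  exact perm_mul_avg _ (diagHom_mem h h' σ)

theorem diagAvg_mul_diagAvg' {l : ℕ} (h : l ≤ m) (h' : m ≤ p) :
    diagAvg h' * diagAvg (h.trans h') = diagAvg h' := by
  have := congrArg flip (diagAvg_mul_diagAvg h h')
  rwa [flip_mul, diagAvg, diagAvg, flip_avg, flip_avg] at this

theorem commute_diagAvg (h : m ≤ p) {x : GA (2 * p)}
    (h1 : ∀ σ, Commute (perm (leftHom h σ)) x) (h2 : ∀ σ, Commute (perm (rightHom h σ)) x) :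
    Commute (diagAvg h) x := by
  refine commute_avg _ ?_
  rintro _ ⟨σ, rfl⟩
  rw [diagHom_apply, perm_mul]
  exact (h1 σ).mul_left (h2 σ)

theorem inclFirst_eq (x : GA p) : inclFirst p x = mapGA (leftHom le_rfl) x := by
  rw [mapGA_leftHom, mapGA_castHom_self]

theorem inclFirst_jm (q : Fin p) : inclFirst p (jm q) = jm (fstPt q) := by
  refine Eq.trans ?_ (mapGA_castHom_jm (by omega) q)
  rw [inclFirst_eq, jm, map_sum, map_sum]
  refine Finset.sum_congr rfl fun a _ => ?_
  rw [mapGA_perm, mapGA_perm, leftHom_swap, castHom_swap]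
  rfl

theorem commute_diagAvg_inclFirst (h : m ≤ p) {x : GA p}
    (hx : ∀ σ, Commute (perm (castHom h σ)) x) : Commute (diagAvg h) (inclFirst p x) := by
  refine commute_diagAvg h (fun σ => ?_) fun σ => ?_
  · rw [← mapGA_perm, mapGA_leftHom, mapGA_perm]
    exact (hx σ).map (inclFirst p)
  · rw [← mapGA_perm, inclFirst_eq]
    exact (commute_left_right _ _ _ _).symm

theorem starSum_last (k : ℕ) : starSum (Fin.last k) = jm (Fin.last k) := by
  rw [starSum, jm]
  refine Finset.sum_congr (Finset.filter_congr fun a _ => ?_) fun _ _ => rfl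
  rw [lt_iff_le_and_ne]
  exact ⟨fun h => ⟨Fin.le_last a, h⟩, fun h => h.2⟩

/-- The star of the last point of the first copy is its Jucys-Murphy element, with no extra
transposition, unlike in the hyperoctahedral case. -/
theorem sum_transpositions_mul_diagAvg {k : ℕ} (h : k + 1 ≤ p) :
    (mapGA (leftHom h) (∑ k, jm k) + mapGA (rightHom h) (∑ k, jm k)) * diagAvg h =
      ((k + 1 : ℕ) : ℂ) • (diagAvg h * inclFirst p (jm ⟨k, h⟩) * diagAvg h) := by
  have h1 := (mapGA_mul_avg_range (commute_leftHom_rightHom h h) (diagHom_apply h) (Fin.last k)).1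
  rw [starSum_last, mapGA_leftHom h (jm _), mapGA_castHom_jm] at h1
  exact h1

theorem diagAvg_mul_mul_diagAvg {z : ℂ} (hz : z ≠ 0) {k : ℕ} (h : k + 1 ≤ p) :
    diagAvg h * inclFirst p (z • 1 + jucysMurphy p (k + 1)) * diagAvg h =
      (z / ((k + 1 : ℕ) : ℂ)) • (yElement p (k + 1) z * diagAvg h) := by
  have hk : ((k + 1 : ℕ) : ℂ) ≠ 0 := Nat.cast_ne_zero.2 k.succ_ne_zero
  have h1 := sum_transpositions_mul_diagAvg h
  have hP : diagAvg h * diagAvg h = diagAvg h := avg_mul_avg _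
  rw [yElement_eq h, add_mul, smul_mul_assoc z⁻¹, h1, jucysMurphy_eq h, map_add, map_smul, map_one]
  simp only [mul_add, add_mul, smul_mul_assoc, mul_smul_comm, mul_one, one_mul, hP, smul_add,
    smul_smul]
  have e1 : z / ((k + 1 : ℕ) : ℂ) * ((k + 1 : ℕ) : ℂ) = z := by field_simp
  have e2 : z / ((k + 1 : ℕ) : ℂ) * (z⁻¹ * ((k + 1 : ℕ) : ℂ)) = 1 := by field_simp
  rw [e1, e2, one_smul]

/-- The telescoping of the hyperoctahedral case, with `Ω(z)` as the product. The diagonal average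
commutes with whatever commutes with both copies, which suffices for all the commutation hypotheses.
-/
theorem map_diagonal_mul_omegaElement_mul_prod {B : Type*} [Semiring B] [Algebra ℂ B]
    (F : GA (2 * p) →ₐ[ℂ] B) {z : ℂ} (hz : z ≠ 0) {w : ℕ → GA (2 * p)}
    (hw : ∀ k < p, IsGroupInverse (yElement p (k + 1) z) (w k))
    (hF : ∀ k, ∀ h : k + 1 ≤ p, F (yElement p (k + 1) z * w k * diagAvg h) = F (diagAvg h)) :
    F (avg (diagonal p) * inclFirst p (omegaElement p z) * ((List.range p).map w).prod *
      avg (diagonal p)) =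
    (z ^ p / (p.factorial : ℂ)) • F (avg (diagonal p)) := by
  have hl : ∀ k (h : k + 1 ≤ p) (x : GA (k + 1)), Commute (mapGA (leftHom h) x) (w k) :=
    fun k h x => (hw k h).commute (commute_left_yElement h z x)
  have hr : ∀ k (h : k + 1 ≤ p) (x : GA (k + 1)), Commute (mapGA (rightHom h) x) (w k) :=
    fun k h x => (hw k h).commute (commute_right_yElement h z x)
  let P : ℕ → B := fun k => if h : k ≤ p then F (diagAvg h) else 1
  have hP : ∀ {k} (h : k ≤ p), P k = F (diagAvg h) := fun h => dif_pos h
  have key := mul_chain_mul_prod_mul (P := P)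
    (x := fun k => F (inclFirst p (z • 1 + jucysMurphy p (k + 1))))
    (w := fun k => F (w k)) (z := z) (p := p) ?_ ?_ ?_ ?_ ?_ ?_ ?_
  · rw [hP le_rfl, diagAvg_self, ← map_chain F,
      ← map_chain (inclFirst p) fun k => z • 1 + jucysMurphy p (k + 1), ← omegaElement_eq_chain] at key
    rw [map_mul, map_mul, map_mul, map_list_prod, List.map_map]
    exact key
  · rw [hP (Nat.zero_le _), diagAvg_zero, map_one]
  · intro k hk
    rw [hP hk, hP hk.le, ← map_mul, diagAvg_mul_diagAvg' k.le_succ hk]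
  · intro k hk
    rw [hP hk, hP hk.le, ← map_mul, diagAvg_mul_diagAvg k.le_succ hk]
  · intro k hk
    rw [hP hk.le, jucysMurphy_eq hk]
    refine (commute_diagAvg_inclFirst hk.le fun σ => ?_).map F
    have h1 := commute_castHom_jm hk.le (q := ⟨k, hk⟩) le_rfl (perm σ)
    rw [mapGA_perm] at h1
    exact (smul_one_commute z _).symm.add_right h1
  · intro k hk
    rw [hP hk.le]
    refine (commute_diagAvg hk.le (fun σ => ?_) fun σ => ?_).map F
    · have h1 := hl k hk (perm (castHom k.le_succ σ))
      rw [mapGA_perm, leftHom, MonoidHom.comp_apply, ← MonoidHom.comp_apply (castHom _) (castHom _),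
        ← castHom_comp] at h1
      exact h1
    · have h1 := hr k hk (perm (castHom k.le_succ σ))
      rw [mapGA_perm, rightHom, MonoidHom.comp_apply, ← MonoidHom.comp_apply (castHom _) (castHom _),
        ← castHom_comp] at h1
      exact h1
  · intro k hk
    rw [hP hk]
    refine (commute_diagAvg hk (fun σ => ?_) fun σ => ?_).map F
    · rw [← mapGA_perm]
      exact hl k hk _
    · rw [← mapGA_perm]
      exact hr k hk _
  · intro k hk
    have h2 : Commute (diagAvg hk) (w k) := commute_diagAvg hk
      (fun σ => by rw [← mapGA_perm]; exact hl k hk _)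
      fun σ => by rw [← mapGA_perm]; exact hr k hk _
    rw [hP hk, ← map_mul, ← map_mul, ← map_mul, diagAvg_mul_mul_diagAvg hz, smul_mul_assoc,
      mul_assoc, h2.eq, ← mul_assoc, map_smul, hF]

theorem commute_avg_diagonal_omegaElement (z : ℂ) :
    Commute (avg (diagonal p)) (inclFirst p (omegaElement p z)) := by
  rw [← diagAvg_self le_rfl]
  exact commute_diagAvg_inclFirst le_rfl fun σ => commute_omegaElement z _

theorem ring_inverse_omegaElement_mul_avg {z : ℂ} (hΩ : IsUnit (omegaElement p z))
    (hY : ∀ k ∈ Finset.Icc 1 p, IsUnit (yElement p k z)) :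
    z ^ p • (inclFirst p (Ring.inverse (omegaElement p z)) * avg (diagonal p)) =
      (p.factorial : ℂ) • (avg (diagonal p) *
        ((List.range p).map fun k => Ring.inverse (yElement p (k + 1) z)).prod *
        avg (diagonal p)) := by
  have hinv := Ring.inverse_mul_cancel _ hΩ
  set P := avg (diagonal p) with hP
  by_cases h0 : z = 0 ∧ p ≠ 0
  · have h3 : omegaElement p z = 0 := by
      rw [omegaElement_eq_chain]
      refine chain_eq_zero ?_ h0.2
      rw [h0.1, zero_smul, zero_add, zero_add, jucysMurphy_one]
    have h2 : P = 0 := by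
      rw [← one_mul P, ← map_one (inclFirst p), ← hinv, h3, mul_zero, map_zero, zero_mul]
    rw [h2]
    simp only [mul_zero, smul_zero]
  by_cases hz : z = 0
  · have hp : p = 0 := by tauto
    subst hp
    have h3 : P = 1 := by rw [hP, ← diagAvg_self le_rfl, diagAvg_zero]
    have h2 : omegaElement 0 z = 1 := by rw [omegaElement_eq_chain, chain]
    simp [h2, h3]
  · have h2 := map_diagonal_mul_omegaElement_mul_prod (AlgHom.id ℂ (GA (2 * p))) hz
      (w := fun k => Ring.inverse (yElement p (k + 1) z))
      (fun k hk => IsUnit.isGroupInverse (hY (k + 1) (Finset.mem_Icc.2 ⟨by omega, by omega⟩)))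
      (fun k hk => by
        rw [Ring.mul_inverse_cancel _ (hY (k + 1) (Finset.mem_Icc.2 ⟨by omega, by omega⟩)), one_mul])
    simp only [AlgHom.coe_id, id_eq] at h2
    rw [← hP, (commute_avg_diagonal_omegaElement z).eq] at h2
    have h3 := congrArg
      (fun y => (p.factorial : ℂ) • (inclFirst p (Ring.inverse (omegaElement p z)) * y)) h2
    have hf : (p.factorial : ℂ) ≠ 0 := Nat.cast_ne_zero.2 p.factorial_ne_zero
    simp only [mul_smul_comm, smul_smul, mul_div_cancel₀ _ hf] at h3
    rw [← h3]
    simp only [← mul_assoc, ← map_mul, hinv, map_one, one_mul, hP]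

/-- On the diagonal average the second copy of the sum of transpositions acts as the first, so the
content of a single shape is counted twice and pairs of different shapes need not be considered. -/
theorem yElement_mul_mapGA_proj (h : m ≤ p) (z : ℂ) (μ : Shape m) :
    yElement p m z * (mapGA (leftHom h) μ.proj * diagAvg h) =
      ((m : ℂ) + z⁻¹ * (2 * μ.content)) • (mapGA (leftHom h) μ.proj * diagAvg h) := by
  -- The diagonal identity is stated with a reference point, so the empty case is separate.
  rcases Nat.eq_zero_or_pos m with rfl | hm
  · have h0 : μ.content = 0 := by
      rw [Shape.content, Finset.card_eq_zero.1 μ.2, Finset.sum_empty]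
    rw [yElement_eq h, h0]
    simp
  have h1 := (mapGA_mul_avg_range (commute_leftHom_rightHom h h) (diagHom_apply h) ⟨0, hm⟩).2
  have h2 : yElement p m z * diagAvg h =
      mapGA (leftHom h) ((m : ℂ) • 1 + z⁻¹ • (2 : ℂ) • ∑ k, jm k) * diagAvg h := by
    rw [yElement_eq h, add_mul, smul_mul_assoc z⁻¹, add_mul, diagAvg, h1, ← two_smul ℂ, map_add,
      map_smul, map_smul, map_smul, map_one, add_mul, smul_mul_assoc z⁻¹, smul_mul_assoc (2 : ℂ)]
  rw [← mul_assoc, ← (commute_left_yElement h z μ.proj).eq, mul_assoc, h2, ← mul_assoc, ← map_mul,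
    mul_add, mul_smul_comm, mul_one, mul_smul_comm, mul_smul_comm, (commute_sum_jm μ.proj).eq,
    Shape.sum_jm_mul_proj, smul_smul, smul_smul, ← add_smul, map_smul, smul_mul_assoc]
  congr 2
  ring

theorem map_avg_diagonal_mul_prod_mul_avg {B : Type*} [Semiring B] [Algebra ℂ B]
    (F : GA (2 * p) →ₐ[ℂ] B) {z : ℂ} (hz : z ≠ 0)
    (hR : ∀ μ : Shape p, μ.R z = 0 → F (inclFirst p μ.proj) = 0)
    (hζ : ∀ k, ∀ h : k + 1 ≤ p, ∀ μ : Shape (k + 1),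
      ((k + 1 : ℕ) : ℂ) + z⁻¹ * (2 * μ.content) = 0 → F (mapGA (leftHom h) μ.proj) = 0) :
    ((p.factorial : ℂ) * (z ^ p)⁻¹) • F (avg (diagonal p) *
        ((List.range p).map fun k => pinv (yElement p (k + 1) z)).prod * avg (diagonal p)) =
      F (inclFirst p (weingartenU p z) * avg (diagonal p)) := by
  have h1 := map_diagonal_mul_omegaElement_mul_prod F hz
    (w := fun k => pinv (yElement p (k + 1) z))
    (fun k hk => isGroupInverse_pinv_yElement hk z) fun k h => by
      have e : diagAvg h = ∑ μ : Shape (k + 1), mapGA (leftHom h) μ.proj * diagAvg h := by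
        rw [← Finset.sum_mul, ← map_sum, sum_proj, map_one, one_mul]
      rw [e]
      refine map_mul_mul_eq F (isGroupInverse_pinv_yElement h z).1
        (yElement_mul_mapGA_proj h z) fun μ hμ => ?_
      rw [map_mul, hζ k h μ hμ, zero_mul]
  -- The terms omitted from the Weingarten element are killed by `F`, so it becomes a genuine
  -- inverse of `Ω(z)`.
  have h3 : F (inclFirst p (weingartenU p z)) * F (inclFirst p (omegaElement p z)) = 1 := by
    have h4 := map_mul_mul_eq (F.comp (inclFirst p)) (isPseudoInverse_omegaElement p z)
      (v := fun μ : Shape p => μ.proj) (η := fun μ => μ.R z) (fun μ => omegaElement_mul_proj z μ)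
      fun μ hμ => by rw [AlgHom.comp_apply, hR μ hμ]
    rw [sum_proj, mul_one, map_one, ← (commute_omegaElement z _).eq, map_mul, AlgHom.comp_apply,
      AlgHom.comp_apply] at h4
    exact h4
  set W := ((List.range p).map fun k => pinv (yElement p (k + 1) z)).prod
  set P := avg (diagonal p)
  have h4 : F (P * W * P) = (z ^ p / (p.factorial : ℂ)) • F (inclFirst p (weingartenU p z) * P) := by
    calc F (P * W * P) = F (inclFirst p (weingartenU p z)) * F (inclFirst p (omegaElement p z)) *
          F (P * W * P) := by rw [h3, one_mul]
      _ = F (inclFirst p (weingartenU p z)) * F (P * inclFirst p (omegaElement p z) * W * P) := by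
        have hc : Commute P (inclFirst p (omegaElement p z)) := commute_avg_diagonal_omegaElement z
        rw [mul_assoc, ← map_mul, hc.eq]
        simp only [mul_assoc]
      _ = _ := by rw [h1, mul_smul_comm, map_mul]
  have hf : (p.factorial : ℂ) ≠ 0 := Nat.cast_ne_zero.2 p.factorial_ne_zero
  have hzp : z ^ p ≠ 0 := pow_ne_zero p hz
  have h5 : (p.factorial : ℂ) * (z ^ p)⁻¹ * (z ^ p / (p.factorial : ℂ)) = 1 := by field_simp
  rw [h4, smul_smul, h5, one_smul]

end JMBrauer

end

noncomputable section

namespace JMBrauer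

open Equiv (Perm swap)

variable {n m p d N : ℕ}

/-! ### Kernels of the tensor representations -/

/-- The basis tensors. -/
def basisTensor (φ : Fin n → Fin d) : Tensor d n :=
  PiTensorProduct.tprod ℂ fun k => Pi.basisFun ℂ (Fin d) (φ k)

theorem tensor_ext {A : Module.End ℂ (Tensor d n)} (h : ∀ φ : Fin n → Fin d, A (basisTensor φ) = 0) :
    A = 0 := by
  refine PiTensorProduct.ext (Module.Basis.ext_multilinear (fun _ => Pi.basisFun ℂ (Fin d)) fun φ => ?_)
  exact h φ

theorem permTensor_basisTensor (σ : Perm (Fin n)) (φ : Fin n → Fin d) :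
    permTensor d n σ (basisTensor φ) = basisTensor (φ ∘ σ.symm) :=
  PiTensorProduct.reindex_tprod (R := ℂ) (s := fun _ : Fin n => (Fin d → ℂ)) σ _

theorem rhoO_perm (σ : Perm (Fin n)) : rhoO N n (perm σ) = permTensor N n σ :=
  MonoidAlgebra.lift_of _ _

theorem rhoS_perm (σ : Perm (Fin n)) : rhoS N n (perm σ) =
    ((Equiv.Perm.sign σ : ℤ) : ℂ) • permTensor (2 * N) n σ :=
  MonoidAlgebra.lift_of _ _

theorem permTensor_swap_basisTensor {a b : Fin n} {φ : Fin n → Fin d} (h : φ a = φ b) :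
    permTensor d n (swap a b) (basisTensor φ) = basisTensor φ := by
  rw [permTensor_basisTensor]
  congr 1
  funext k
  rw [Function.comp_apply, Equiv.symm_swap, Equiv.swap_apply_def]
  split_ifs with h1 h1
  · rw [h1, h]
  · rw [h1, h]
  · rfl

theorem exists_ne_map_eq_of_card {μ : Shape m} {t : Fin m → ℕ × ℕ} (ht : IsTableau μ t)
    {c : ℕ → ℕ × ℕ} (hc : Function.Injective c) (hmem : ∀ i ≤ d, c i ∈ μ.1.cells)
    (φ : Fin m → Fin d) : ∃ a b, a ≠ b ∧ φ a = φ b ∧ ∃ i j, t a = c i ∧ t b = c j := by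
  choose f hf using fun i : Fin (d + 1) => ht.exists_eq (hmem i.val (by omega))
  obtain ⟨i, j, hij, h⟩ := Fintype.exists_ne_map_eq_of_card_lt (fun i => φ (f i)) (by simp)
  refine ⟨f i, f j, fun e => hij (Fin.ext (hc ?_)), h, i, j, hf i, hf j⟩
  rw [← hf i, ← hf j, e]

/-- The first column has at least `N + 1` cells, so in a basis tensor two of its points carry the
same basis vector: their transposition fixes the tensor and changes the sign of the column
antisymmetrizer. -/
theorem rhoO_mapGA_proj_eq_zero {μ : Shape m} (hμ : (N, 0) ∈ μ.1.cells)
    {f : Perm (Fin m) →* Perm (Fin n)} {g : Fin m → Fin n}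
    (hf : ∀ a b, f (swap a b) = swap (g a) (g b)) : rhoO N n (mapGA f μ.proj) = 0 := by
  have ht := μ.isTableau_cellOf
  refine ht.map_proj_eq_zero ((rhoO N n).comp (mapGA f)) (Or.inl ?_)
  refine tensor_ext fun φ => ?_
  obtain ⟨a, b, hab, h, i, j, hi, hj⟩ := exists_ne_map_eq_of_card ht (d := N) (c := fun i => (i, 0))
    (fun i j h => (Prod.ext_iff.1 h).1) (fun i hi => μ.1.up_left_mem hi le_rfl hμ) fun k => φ (g k)
  have h1 : colT μ.cellOf * perm (swap a b) = -colT μ.cellOf :=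
    colSym_mul_swap hab (by rw [hi, hj])
  have h2 : rhoO N n (mapGA f (perm (swap a b))) (basisTensor φ) = basisTensor φ := by
    rw [mapGA_perm, rhoO_perm, hf, permTensor_swap_basisTensor h]
  refine eq_zero_of_eq_neg ?_
  rw [AlgHom.comp_apply]
  conv_lhs => rw [← h2, ← Module.End.mul_apply, ← map_mul, ← map_mul, h1]
  rw [map_neg, map_neg, LinearMap.neg_apply]

/-- With the sign twist the row symmetrizer acts as an antisymmetrizer, and the first row has more
than `2N` cells. Injectivity of `g` keeps the two points distinct, so that the transposition has
sign `-1`. -/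
theorem rhoS_mapGA_proj_eq_zero {μ : Shape m} (hμ : (0, 2 * N) ∈ μ.1.cells)
    {f : Perm (Fin m) →* Perm (Fin n)} {g : Fin m → Fin n} (hg : Function.Injective g)
    (hf : ∀ a b, f (swap a b) = swap (g a) (g b)) : rhoS N n (mapGA f μ.proj) = 0 := by
  have ht := μ.isTableau_cellOf
  refine ht.map_proj_eq_zero ((rhoS N n).comp (mapGA f)) (Or.inr ?_)
  refine tensor_ext fun φ => ?_
  obtain ⟨a, b, hab, h, i, j, hi, hj⟩ := exists_ne_map_eq_of_card ht (d := 2 * N)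
    (c := fun j => (0, j)) (fun i j h => (Prod.ext_iff.1 h).2)
    (fun i hi => μ.1.up_left_mem le_rfl hi hμ) fun k => φ (g k)
  have h1 : rowT μ.cellOf * perm (swap a b) = rowT μ.cellOf := rowSym_mul_swap (by rw [hi, hj])
  have h2 : rhoS N n (mapGA f (perm (swap a b))) (basisTensor φ) = -basisTensor φ := by
    rw [mapGA_perm, rhoS_perm, hf, LinearMap.smul_apply, permTensor_swap_basisTensor h,
      Equiv.Perm.sign_swap fun e => hab (hg e)]
    simp
  refine eq_zero_of_eq_neg ?_
  rw [AlgHom.comp_apply]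
  conv_lhs => rw [← h1, map_mul, map_mul, Module.End.mul_apply, h2, map_neg]

/-! ### Eigenvalues -/

theorem sum_cells_eq_sum_col (μ : YoungDiagram) (f : ℕ × ℕ → ℤ) :
    ∑ c ∈ μ.cells, f c = ∑ j ∈ μ.cells.image Prod.snd, ∑ i ∈ Finset.range (μ.colLen j), f (i, j) := by
  rw [← Finset.sum_fiberwise_of_maps_to (t := μ.cells.image Prod.snd) (g := Prod.snd)
    fun c hc => Finset.mem_image_of_mem _ hc]
  refine Finset.sum_congr rfl fun j _ => ?_
  change ∑ c ∈ μ.col j, f c = _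
  rw [YoungDiagram.col_eq_prod, Finset.sum_product]
  simp

theorem sum_cells_eq_sum_row (μ : YoungDiagram) (f : ℕ × ℕ → ℤ) :
    ∑ c ∈ μ.cells, f c = ∑ i ∈ μ.cells.image Prod.fst, ∑ j ∈ Finset.range (μ.rowLen i), f (i, j) := by
  rw [← Finset.sum_fiberwise_of_maps_to (t := μ.cells.image Prod.fst) (g := Prod.fst)
    fun c hc => Finset.mem_image_of_mem _ hc]
  refine Finset.sum_congr rfl fun j _ => ?_
  change ∑ c ∈ μ.row j, f c = _
  rw [YoungDiagram.row_eq_prod, Finset.sum_product]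
  simp

theorem sum_range_odd (h : ℕ) : ∑ i ∈ Finset.range h, (2 * (i : ℤ) + 1) = h * h := by
  induction h with
  | zero => simp
  | succ h ih => rw [Finset.sum_range_succ, ih]; push_cast; ring

/-- Without the cell `(N, 0)` all columns have height at most `N`, and a column of height `h`
contributes `h² ≤ N h`. -/
theorem sum_odd_row_le {μ : YoungDiagram} (h : (N, 0) ∉ μ) :
    ∑ c ∈ μ.cells, (2 * (c.1 : ℤ) + 1) ≤ N * μ.card := by
  have e : (μ.card : ℤ) = ∑ c ∈ μ.cells, 1 := by simp [YoungDiagram.card]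
  rw [e, sum_cells_eq_sum_col μ fun c => 2 * (c.1 : ℤ) + 1, sum_cells_eq_sum_col μ fun _ => 1,
    Finset.mul_sum]
  refine Finset.sum_le_sum fun j _ => ?_
  simp only
  rw [sum_range_odd, Finset.sum_const, Finset.card_range, nsmul_one]
  refine mul_le_mul_of_nonneg_right ?_ (by positivity)
  have : μ.colLen j ≤ N := by
    by_contra! hj
    exact h (μ.up_left_mem le_rfl (Nat.zero_le j) (YoungDiagram.mem_iff_lt_colLen.2 hj))
  exact_mod_cast this

theorem sum_odd_col_le {μ : YoungDiagram} (h : (0, N) ∉ μ) :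
    ∑ c ∈ μ.cells, (2 * (c.2 : ℤ) + 1) ≤ N * μ.card := by
  have e : (μ.card : ℤ) = ∑ c ∈ μ.cells, 1 := by simp [YoungDiagram.card]
  rw [e, sum_cells_eq_sum_row μ fun c => 2 * (c.2 : ℤ) + 1, sum_cells_eq_sum_row μ fun _ => 1,
    Finset.mul_sum]
  refine Finset.sum_le_sum fun j _ => ?_
  simp only
  rw [sum_range_odd, Finset.sum_const, Finset.card_range, nsmul_one]
  refine mul_le_mul_of_nonneg_right ?_ (by positivity)
  have : μ.rowLen j ≤ N := by
    by_contra! hj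
    exact h (μ.up_left_mem (Nat.zero_le j) le_rfl (YoungDiagram.mem_iff_lt_rowLen.2 hj))
  exact_mod_cast this

theorem Shape.mem_of_le {μ : Shape n} {c c' : ℕ × ℕ} (hc : c ∈ μ.1.cells) (h1 : c'.1 ≤ c.1)
    (h2 : c'.2 ≤ c.2) : c' ∈ μ.1.cells := μ.1.up_left_mem h1 h2 hc

/-- If all columns had height at most `N`, the sum would be at least `(N + 1)|μ| - N|μ| = |μ| > 0`.
The coefficient `a` is `2` for `Y` and `4` for `Z`. -/
theorem mem_of_sum_eq_zero {μ : Shape m} (hm : 0 < m) {a : ℤ} (ha : 0 ≤ a)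
    (h : ∑ c ∈ μ.1.cells, ((N : ℤ) + a * c.2 - 2 * c.1) = 0) : (N, 0) ∈ μ.1.cells := by
  by_contra h0
  have h1 := sum_odd_row_le (N := N) (μ := μ.1) h0
  have h2 : ∑ c ∈ μ.1.cells, ((N : ℤ) + a * c.2 - 2 * c.1) + ∑ c ∈ μ.1.cells, (2 * (c.1 : ℤ) + 1) =
      (N + 1) * μ.1.card + ∑ c ∈ μ.1.cells, a * (c.2 : ℤ) := by
    have e : (μ.1.card : ℤ) = ∑ c ∈ μ.1.cells, 1 := by simp [YoungDiagram.card]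
    rw [e, Finset.mul_sum, ← Finset.sum_add_distrib, ← Finset.sum_add_distrib]
    exact Finset.sum_congr rfl fun c _ => by ring
  have h3 : 0 ≤ ∑ c ∈ μ.1.cells, a * (c.2 : ℤ) := Finset.sum_nonneg fun c _ => by positivity
  have h4 : 0 < (μ.1.card : ℤ) := by rw [μ.2]; exact_mod_cast hm
  nlinarith

/-- If all rows had length at most `N`, the sum would be at most `2N|μ| - 2(N + 1)|μ| < 0`. -/
theorem mem_of_sum_eq_zero' {μ : Shape m} (hm : 0 < m)
    (h : ∑ c ∈ μ.1.cells, (-2 * (N : ℤ) + 4 * c.2 - 2 * c.1) = 0) : (0, N) ∈ μ.1.cells := by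
  by_contra h0
  have h1 := sum_odd_col_le (N := N) (μ := μ.1) h0
  have h2 : ∑ c ∈ μ.1.cells, (-2 * (N : ℤ) + 4 * c.2 - 2 * c.1) + ∑ c ∈ μ.1.cells, 2 * (c.1 : ℤ) =
      2 * ∑ c ∈ μ.1.cells, (2 * (c.2 : ℤ) + 1) - 2 * (N + 1) * μ.1.card := by
    have e : (μ.1.card : ℤ) = ∑ c ∈ μ.1.cells, 1 := by simp [YoungDiagram.card]
    rw [e, Finset.mul_sum, Finset.mul_sum, ← Finset.sum_add_distrib, ← Finset.sum_sub_distrib]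
    exact Finset.sum_congr rfl fun c _ => by ring
  have h3 : 0 ≤ ∑ c ∈ μ.1.cells, 2 * (c.1 : ℤ) := Finset.sum_nonneg fun c _ => by positivity
  have h4 : 0 < (μ.1.card : ℤ) := by rw [μ.2]; exact_mod_cast hm
  nlinarith

theorem Shape.content_double (μ : Shape m) :
    μ.double.content = ∑ c ∈ μ.1.cells, (4 * (c.2 : ℂ) + 1 - 2 * c.1) := by
  have h : μ.double.1.cells = μ.1.cells.biUnion fun c => {(c.1, 2 * c.2), (c.1, 2 * c.2 + 1)} := rfl
  rw [Shape.content, h, Finset.sum_biUnion]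
  · refine Finset.sum_congr rfl fun c _ => ?_
    rw [Finset.sum_pair (by simp)]
    push_cast
    ring
  · rintro ⟨a, b⟩ _ ⟨c, d⟩ _ h
    refine Finset.disjoint_left.2 ?_
    rintro ⟨i, j⟩ h1 h2
    simp only [Finset.mem_insert, Finset.mem_singleton, Prod.mk.injEq] at h1 h2
    apply h
    ext <;> simp only <;> omega

/-- Multiplying the eigenvalue of `Z` by `z` distributes it over the cells of `λ`; the `-1` in `z -
1` cancels the `+1` that each doubled cell contributes to the content. -/
theorem sum_eq_zero_of_double {z : ℂ} (hz : z ≠ 0) {μ : Shape m}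
    (h : (1 - z⁻¹) * (2 * m : ℕ) / 2 + z⁻¹ * μ.double.content = 0) :
    ∑ c ∈ μ.1.cells, (z + 4 * (c.2 : ℂ) - 2 * c.1) = 0 := by
  have e : (m : ℂ) = ∑ c ∈ μ.1.cells, 1 := by
    rw [Finset.sum_const, nsmul_one]
    exact congrArg Nat.cast μ.2.symm
  have h1 : z * ((1 - z⁻¹) * (2 * m : ℕ) / 2 + z⁻¹ * μ.double.content) =
      (z - 1) * m + μ.double.content := by
    push_cast
    field_simp
  rw [h, mul_zero, μ.content_double, e, Finset.mul_sum, ← Finset.sum_add_distrib] at h1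
  rw [h1]
  exact Finset.sum_congr rfl fun c _ => by ring

theorem sum_eq_zero_of_content {z : ℂ} (hz : z ≠ 0) {μ : Shape m}
    (h : (m : ℂ) + z⁻¹ * (2 * μ.content) = 0) :
    ∑ c ∈ μ.1.cells, (z + 2 * (c.2 : ℂ) - 2 * c.1) = 0 := by
  have e : (m : ℂ) = ∑ c ∈ μ.1.cells, 1 := by
    rw [Finset.sum_const, nsmul_one]
    exact congrArg Nat.cast μ.2.symm
  have h1 : z * ((m : ℂ) + z⁻¹ * (2 * μ.content)) = z * m + 2 * μ.content := by
    field_simp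
  rw [h, mul_zero, Shape.content, e, Finset.mul_sum, Finset.mul_sum, ← Finset.sum_add_distrib] at h1
  rw [h1]
  exact Finset.sum_congr rfl fun c _ => by ring

theorem mem_of_R_eq_zero {μ : Shape p} (h : μ.R (N : ℂ) = 0) : (N, 0) ∈ μ.1.cells := by
  obtain ⟨c, hc, h1⟩ := Finset.prod_eq_zero_iff.1 h
  have h2 : N + c.2 = c.1 := by
    have := sub_eq_zero.1 h1
    exact_mod_cast this
  exact Shape.mem_of_le hc (by simp only; omega) (Nat.zero_le _)

theorem mem_of_R₂_eq_zero {μ : Shape p} (h : μ.R₂ (N : ℂ) = 0) : (N, 0) ∈ μ.1.cells := by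
  obtain ⟨c, hc, h1⟩ := Finset.prod_eq_zero_iff.1 h
  have h2 : N + 2 * c.2 = c.1 := by
    have := sub_eq_zero.1 h1
    exact_mod_cast this
  exact Shape.mem_of_le hc (by simp only; omega) (Nat.zero_le _)

/-- A zero factor gives a cell with `2j = 2N + i`, hence with `j ≥ N`. The first row of `2λ` then
has more than `2N` cells. -/
theorem mem_of_R₂_neg_eq_zero {μ : Shape p} (h : μ.R₂ (-2 * (N : ℂ)) = 0) : (0, N) ∈ μ.1.cells := by
  obtain ⟨c, hc, h1⟩ := Finset.prod_eq_zero_iff.1 h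
  have h2 : 2 * c.2 = 2 * N + c.1 := by
    have : 2 * (c.2 : ℂ) = 2 * N + c.1 := by linear_combination h1
    exact_mod_cast this
  exact Shape.mem_of_le hc (Nat.zero_le _) (by simp only; omega)

theorem double_mem_left {μ : Shape m} (h : (N, 0) ∈ μ.1.cells) : (N, 0) ∈ μ.double.1.cells :=
  Shape.mem_double.2 (by simpa using h)

theorem double_mem_top {μ : Shape m} (h : (0, N) ∈ μ.1.cells) : (0, 2 * N) ∈ μ.double.1.cells :=
  Shape.mem_double.2 (by simpa using h)

end JMBrauer

end

/-! ### Assembly of the three parts. -/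

theorem mainTheorem7 :
    -- (i), hyperoctahedral group
    (∀ i : ℕ, 1 ≤ i →
      (∑ k ∈ Finset.Icc 1 (2 * i), jucysMurphy (2 * i) k) * avg (hyperoctahedral i) =
        avg (hyperoctahedral i) * ((i : ℂ) • (1 + jucysMurphy (2 * i) (2 * i - 1))) *
          avg (hyperoctahedral i)) ∧
    -- (i), diagonal
    (∀ i : ℕ, 1 ≤ i →
      (transpositionSum {k : Fin (2 * i) | k.val < i} +
          transpositionSum {k : Fin (2 * i) | i ≤ k.val}) * avg (diagonal i) =
        avg (diagonal i) * ((i : ℂ) • jucysMurphy (2 * i) i) * avg (diagonal i)) ∧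
    -- (ii), hyperoctahedral group
    (∀ (p : ℕ) (z : ℂ) (s : PairPartition p → Equiv.Perm (Fin (2 * p))), IsSection s →
      IsUnit (gramElement s z) → (∀ k ∈ Finset.Icc 1 p, IsUnit (zElement (2 * p) (2 * k) z)) →
      z ^ p • (Ring.inverse (gramElement s z) * avg (hyperoctahedral p)) =
        (p.factorial : ℂ) • (avg (hyperoctahedral p) *
          ((List.range p).map fun k => Ring.inverse (zElement (2 * p) (2 * (k + 1)) z)).prod *
          avg (hyperoctahedral p))) ∧
    -- (ii), diagonal
    (∀ (p : ℕ) (z : ℂ), IsUnit (omegaElement p z) →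
      (∀ k ∈ Finset.Icc 1 p, IsUnit (yElement p k z)) →
      z ^ p • (inclFirst p (Ring.inverse (omegaElement p z)) * avg (diagonal p)) =
        (p.factorial : ℂ) • (avg (diagonal p) *
          ((List.range p).map fun k => Ring.inverse (yElement p (k + 1) z)).prod *
          avg (diagonal p))) ∧
    -- (iii), pseudo-inverses
    (∀ (p : ℕ) (z : ℂ) (s : PairPartition p → Equiv.Perm (Fin (2 * p))), IsSection s →
      IsPseudoInverse (gramElement s z * avg (hyperoctahedral p))
        (weingartenO p z * avg (hyperoctahedral p))) ∧
    (∀ (p : ℕ) (z : ℂ), IsPseudoInverse (omegaElement p z) (weingartenU p z)) ∧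
    -- (iii), the terms omitted at `z = N` and `z = -2N` are in the kernel of the representation
    (∀ (p N : ℕ), 1 ≤ N → ∀ μ : Shape p,
      (μ.R₂ (-2 * (N : ℂ)) = 0 → rhoS N (2 * p) μ.double.proj = 0) ∧
      (μ.R (N : ℂ) = 0 → rhoO N (2 * p) (inclFirst p μ.proj) = 0) ∧
      (μ.R₂ (N : ℂ) = 0 → rhoO N (2 * p) μ.double.proj = 0)) ∧
    -- (iii), symplectic group
    (∀ (p N : ℕ), 1 ≤ N →
      ((p.factorial : ℂ) * ((-2 * (N : ℂ)) ^ p)⁻¹) • rhoS N (2 * p) (avg (hyperoctahedral p) *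
          ((List.range p).map fun k => pinv (zElement (2 * p) (2 * (k + 1)) (-2 * (N : ℂ)))).prod *
          avg (hyperoctahedral p)) =
        rhoS N (2 * p) (weingartenO p (-2 * (N : ℂ)) * avg (hyperoctahedral p))) ∧
    -- (iii), unitary group
    (∀ (p N : ℕ), 1 ≤ N →
      ((p.factorial : ℂ) * ((N : ℂ) ^ p)⁻¹) • rhoO N (2 * p) (avg (diagonal p) *
          ((List.range p).map fun k => pinv (yElement p (k + 1) (N : ℂ))).prod *
          avg (diagonal p)) =
        rhoO N (2 * p) (inclFirst p (weingartenU p (N : ℂ)) * avg (diagonal p))) ∧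
    -- (iii), orthogonal group
    (∀ (p N : ℕ), 1 ≤ N →
      ((p.factorial : ℂ) * ((N : ℂ) ^ p)⁻¹) • rhoO N (2 * p) (avg (hyperoctahedral p) *
          ((List.range p).map fun k => pinv (zElement (2 * p) (2 * (k + 1)) (N : ℂ))).prod *
          avg (hyperoctahedral p)) =
        rhoO N (2 * p) (weingartenO p (N : ℂ) * avg (hyperoctahedral p))) := by
  have hneg : ∀ N : ℕ, 1 ≤ N → -2 * (N : ℂ) ≠ 0 := fun N hN =>
    mul_ne_zero (by norm_num) (Nat.cast_ne_zero.2 (by omega))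
  have hpos : ∀ N : ℕ, 1 ≤ N → (N : ℂ) ≠ 0 := fun N hN => Nat.cast_ne_zero.2 (by omega)
  -- The vanishing is needed at every level `m ≤ p`, since each factor `Z_{2k}` or `Y_k` has its own
  -- components to kill; the case `m = p` also gives the statement about poles.
  have hS : ∀ p N m (h : m ≤ p) (μ : Shape m), (0, N) ∈ μ.1.cells →
      rhoS N (2 * p) (mapGA (castHom (two_mul_le h)) μ.double.proj) = 0 := fun p N m h μ hμ =>
    rhoS_mapGA_proj_eq_zero (double_mem_top hμ) (Fin.castLE_injective _) (castHom_swap _)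
  have hO : ∀ p N m (h : m ≤ p) (μ : Shape m), (N, 0) ∈ μ.1.cells →
      rhoO N (2 * p) (mapGA (castHom (two_mul_le h)) μ.double.proj) = 0 := fun p N m h μ hμ =>
    rhoO_mapGA_proj_eq_zero (double_mem_left hμ) (castHom_swap _)
  have hU : ∀ p N m (h : m ≤ p) (μ : Shape m), (N, 0) ∈ μ.1.cells →
      rhoO N (2 * p) (mapGA (leftHom h) μ.proj) = 0 := fun p N m h μ hμ =>
    rhoO_mapGA_proj_eq_zero hμ (leftHom_swap h)
  have hS' : ∀ (p N : ℕ) (μ : Shape p), μ.R₂ (-2 * (N : ℂ)) = 0 →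
      rhoS N (2 * p) μ.double.proj = 0 := fun p N μ hμ => by
    rw [← mapGA_castHom_self (two_mul_le le_rfl) μ.double.proj]
    exact hS p N p le_rfl μ (mem_of_R₂_neg_eq_zero hμ)
  have hO' : ∀ (p N : ℕ) (μ : Shape p), μ.R₂ (N : ℂ) = 0 →
      rhoO N (2 * p) μ.double.proj = 0 := fun p N μ hμ => by
    rw [← mapGA_castHom_self (two_mul_le le_rfl) μ.double.proj]
    exact hO p N p le_rfl μ (mem_of_R₂_eq_zero hμ)
  have hU' : ∀ (p N : ℕ) (μ : Shape p), μ.R (N : ℂ) = 0 →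
      rhoO N (2 * p) (inclFirst p μ.proj) = 0 := fun p N μ hμ => by
    rw [inclFirst_eq]
    exact hU p N p le_rfl μ (mem_of_R_eq_zero hμ)
  refine ⟨?_, ?_, fun p z s hs hG hZ => ring_inverse_gramElement_mul_avg hs hG hZ,
    fun p z hΩ hY => ring_inverse_omegaElement_mul_avg hΩ hY,
    fun p z s hs => isPseudoInverse_gramElement hs z, isPseudoInverse_omegaElement,
    fun p N _ μ => ⟨hS' p N μ, hU' p N μ, hO' p N μ⟩, fun p N hN => ?_, fun p N hN => ?_,
    fun p N hN => ?_⟩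
  · intro i hi
    obtain ⟨i, rfl⟩ := Nat.exists_eq_add_of_le' hi
    have h1 : ∑ k ∈ Finset.Icc 1 (2 * (i + 1)), jucysMurphy (2 * (i + 1)) k =
        ∑ k : Fin (2 * (i + 1)), jm k := by
      rw [← Finset.Ico_add_one_right_eq_Icc, Finset.sum_Ico_eq_sum_range, Finset.sum_range]
      refine Finset.sum_congr rfl fun k _ => ?_
      rw [add_comm 1]
      exact jucysMurphy_eq k.2
    have h2 : 2 * (i + 1) - 1 = 2 * i + 1 := by omega
    rw [h1, h2, jucysMurphy_eq (show 2 * i < 2 * (i + 1) by omega)]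
    exact sum_jm_mul_avg_hyperoctahedral i (by omega)
  · intro i hi
    obtain ⟨i, rfl⟩ := Nat.exists_eq_add_of_le' hi
    have h1 : (Finset.univ.filter fun k : Fin (2 * (i + 1)) => i + 1 ≤ k.val) =
        Finset.univ.filter fun k => i + 1 ≤ k.val ∧ k.val < i + 1 + (i + 1) :=
      Finset.filter_congr fun k _ => ⟨fun h => ⟨h, by omega⟩, fun h => h.1⟩
    rw [h1, transpositionSum_left le_rfl, transpositionSum_right le_rfl, ← diagAvg_self le_rfl,
      sum_transpositions_mul_diagAvg, inclFirst_jm,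
      jucysMurphy_eq (show i < 2 * (i + 1) by omega), mul_smul_comm, smul_mul_assoc]
    rfl
  · exact map_avg_mul_prod_mul_avg (rhoS N (2 * p)) (hneg N hN) (hS' p N) fun k h μ hμ =>
      hS p N _ h μ (mem_of_sum_eq_zero' k.succ_pos (by
        have := sum_eq_zero_of_double (hneg N hN) hμ
        exact_mod_cast this))
  · exact map_avg_diagonal_mul_prod_mul_avg (rhoO N (2 * p)) (hpos N hN) (hU' p N) fun k h μ hμ =>
      hU p N _ h μ (mem_of_sum_eq_zero (a := 2) k.succ_pos (by norm_num) (by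
        have := sum_eq_zero_of_content (hpos N hN) hμ
        exact_mod_cast this))
  · exact map_avg_mul_prod_mul_avg (rhoO N (2 * p)) (hpos N hN) (hO' p N) fun k h μ hμ =>
      hO p N _ h μ (mem_of_sum_eq_zero (a := 4) k.succ_pos (by norm_num) (by
        have := sum_eq_zero_of_double (hpos N hN) hμ
        exact_mod_cast this))
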